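/- Let $\zeta\in\mathbb T$, let $V$ be a finite-dimensional Hilbert space with a representation $\pi$ of $\mathbb T$, and let $e_1,\dots,e_n$ be an orthonormal basis with $\pi_z(e_i)=z^{d_i}e_i$, $d_i\in\mathbb Z$. Let $\omega=\sum_{i,j}\omega_{ij}\,e_i\otimes e_j\in V\otimes V$ be homogeneous of degree $d\in\mathbb Z$, that is, $d_i+d_j=d$ whenever $\omega_{ij}\neq0$. Let $\Omega=(\omega_{ij})$ and assume that $\overline{\Omega}\,\Omega=c\cdot\mathrm{diag}(\zeta^{d d_1},\dots,\zeta^{d d_n})$ for some $c\in\mathbb C^\times$. Let $B=A_o(V,\pi,\omega)$ be the universal unital C*-algebra with generators $u_{ij}$, $1\le i,j\le n$, and the relations $$\sum_k u_{ki}^*u_{kj}=\delta_{ij},\qquad \sum_k u_{ik}u_{jk}^*=\delta_{ij},\qquad \zeta^{d_jd_i}\sum_k\omega_{ik}u_{jk}=\zeta^{d_j(d-d_j)}\sum_k\omega_{kj}u_{ki}^*,$$ with the $\mathbb T$-action $\beta_z(u_{ik})=z^{d_k-d_i}u_{ik}$. Represent $B$ faithfully and $\mathbb T$-equivariantly on a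 Hilbert space $L$ with an orthonormal basis $(\lambda_m)$ of $\mathbb T$-homogeneous vectors. For represented $\mathbb T$-C*-algebras $X$ on $H$ and $Y$ on $K$, the braided tensor product $X\boxtimes Y$ is the C*-algebra on $H\otimes K$ generated by $j_1(x)=x\otimes1$ and $j_2(y)=b(y\otimes1)b^*$, where $b\colon K\otimes H\to H\otimes K$ is the unitary $\kappa\otimes\eta\mapsto\zeta^{kl}\,\eta\otimes\kappa$ for homogeneous $\kappa,\eta$ of degrees $k,l$. With $C(\mathbb T)$ acting on $L^2(\mathbb T)$ by multiplication, where $z^k\in L^2(\mathbb T)$ has degree $k$, let $C=C(\mathbb T)\boxtimes B$ be the C*-algebra of the bosonisation, and regard $z\in C(\mathbb T)$ and $u_{ij}\in B$ as elements of $C$ through $j_1$ and $j_2$. The comultiplication is $\Delta_C=\psi\circ(\mathrm{id}\boxtimes\Delta_B)\colon C\to C\otimes C$ (spatial tensor product), where $\Delta_B\colon B\to B\boxtimes B$ is given by $\Delta_B(u_{ik})=\sum_l j_1(u_{il})j_2(u_{lk})$, and where $\psi\colon C(\mathbb T)\boxtimes B\boxtimes B\to C\otimes C$ is given by $\psi(j_1(z))=z\otimes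 z$, by $\psi(j_2(b))=b\otimes z^m$ if $\beta_w(b)=w^mb$ for all $w\in\mathbb T$, and by $\psi(j_3(b))=1\otimes b$ for $b\in B$. Put $t_{hi}=z^{d_h}u_{hi}$, $t=(t_{hi})$, $\overline t=(t_{hi}^*)$, and $F_{ij}=\zeta^{d d_j}\omega_{ji}$. Then: 1. The C*-algebra $C$ is generated by the coefficients of $z\oplus t$. 2. $\Delta_C$ exists and is unique, and $(C,z\oplus t)$, with comultiplication $\Delta_C$, is a compact matrix quantum group in Woronowicz's sense. That is, with $w=z\oplus t$: the *-subalgebra $\mathcal C$ generated by the entries of $w$ is dense in $C$; $\Delta_C\colon C\to C\otimes C$ is a *-homomorphism with $\Delta_C(w_{kl})=\sum_r w_{kr}\otimes w_{rl}$; and there is a linear antimultiplicative map $\kappa\colon\mathcal C\to\mathcal C$ with $\kappa(\kappa(a^*)^*)=a$ for all $a\in\mathcal C$ and $\sum_r\kappa(w_{kr})w_{rl}=\delta_{kl}=\sum_r w_{kr}\kappa(w_{rl})$. 3. The matrix $z\oplus t$ is unitary and its entrywise adjoint $\overline z\oplus\overline t$ is invertible. The matrix $F\in\mathbb M_n(\mathbb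 C)$ is invertible and $t\,F=z^d\,F\,\overline t$, that is, $F$ intertwines $z^d\,\overline t$ and $t$. -/

import Mathlib

/-! ## The free unital *-algebra -/

/-- The free unital *-algebra on `X`; the letter `inl x` stands for `x` and `inr x` for `x*`. -/
def FreeStarAlgebra (X : Type*) : Type _ := FreeAlgebra ℂ (X ⊕ X)

namespace FreeStarAlgebra

variable {X : Type*}

noncomputable instance : Ring (FreeStarAlgebra X) :=
  inferInstanceAs (Ring (FreeAlgebra ℂ (X ⊕ X)))

noncomputable instance : Algebra ℂ (FreeStarAlgebra X) :=
  inferInstanceAs (Algebra ℂ (FreeAlgebra ℂ (X ⊕ X)))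

/-- The letters of the free *-algebra. -/
noncomputable def letter (y : X ⊕ X) : FreeStarAlgebra X := FreeAlgebra.ι ℂ y

/-- The generator `x`. -/
noncomputable def gen (x : X) : FreeStarAlgebra X := letter (Sum.inl x)

/-- The adjoint generator `x*`. -/
noncomputable def genStar (x : X) : FreeStarAlgebra X := letter (Sum.inr x)

/-- The opposite algebra with complex conjugate scalar multiplication. -/
def ConjOp (X : Type*) : Type _ := (FreeStarAlgebra X)ᵐᵒᵖ

noncomputable instance : Ring (ConjOp X) := inferInstanceAs (Ring (FreeStarAlgebra X)ᵐᵒᵖ)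

noncomputable instance : Algebra ℂ (ConjOp X) :=
  ((algebraMap ℂ (FreeStarAlgebra X)ᵐᵒᵖ).comp (starRingEnd ℂ)).toAlgebra' fun c x =>
    Algebra.commutes (A := (FreeStarAlgebra X)ᵐᵒᵖ) (starRingEnd ℂ c) x

/-- The conjugate-linear anti-homomorphism exchanging `x` and `x*`. -/
noncomputable def starAux : FreeStarAlgebra X →ₐ[ℂ] ConjOp X :=
  FreeAlgebra.lift ℂ (fun y => (MulOpposite.op (letter y.swap) : (FreeStarAlgebra X)ᵐᵒᵖ))

theorem starAux_algebraMap (c : ℂ) : starAux (algebraMap ℂ (FreeStarAlgebra X) c) =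
    MulOpposite.op (algebraMap ℂ (FreeStarAlgebra X) (starRingEnd ℂ c)) :=
  starAux.commutes c

noncomputable instance : Star (FreeStarAlgebra X) := ⟨fun a => MulOpposite.unop (starAux a)⟩

theorem star_def (a : FreeStarAlgebra X) : star a = MulOpposite.unop (starAux a) := rfl

theorem star_add' (a b : FreeStarAlgebra X) : star (a + b) = star a + star b := by
  simp only [star_def, map_add]; rfl

theorem star_mul' (a b : FreeStarAlgebra X) : star (a * b) = star b * star a := by
  simp only [star_def, map_mul]; rfl

theorem star_algebraMap (c : ℂ) : star (algebraMap ℂ (FreeStarAlgebra X) c) =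
    algebraMap ℂ (FreeStarAlgebra X) (star c) := by
  rw [star_def, starAux_algebraMap]; rfl

theorem star_letter (y : X ⊕ X) : star (letter y) = letter y.swap :=
  congrArg MulOpposite.unop (FreeAlgebra.lift_ι_apply (R := ℂ) (A := ConjOp X)
    (fun y : X ⊕ X => (MulOpposite.op (letter y.swap) : (FreeStarAlgebra X)ᵐᵒᵖ)) y)

@[elab_as_elim]
theorem induction {motive : FreeStarAlgebra X → Prop}
    (algebraMap : ∀ c : ℂ, motive (algebraMap ℂ _ c)) (gen : ∀ x, motive (gen x))
    (genStar : ∀ x, motive (genStar x)) (mul : ∀ a b, motive a → motive b → motive (a * b))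
    (add : ∀ a b, motive a → motive b → motive (a + b)) (a : FreeStarAlgebra X) : motive a :=
  FreeAlgebra.induction ℂ (X ⊕ X) (motive := motive) algebraMap
    (fun y => by rcases y with x | x; exacts [gen x, genStar x]) mul add a

noncomputable instance : StarRing (FreeStarAlgebra X) where
  star_involutive a := by
    induction a using induction with
    | algebraMap c => rw [star_algebraMap, star_algebraMap, star_star]
    | gen x => exact (congrArg star (star_letter _)).trans (star_letter _)
    | genStar x => exact (congrArg star (star_letter _)).trans (star_letter _)
    | mul a b ha hb => rw [star_mul', star_mul', ha, hb]
    | add a b ha hb => rw [star_add', star_add', ha, hb]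
  star_mul := star_mul'
  star_add := star_add'

instance : StarModule ℂ (FreeStarAlgebra X) where
  star_smul c a := by
    rw [Algebra.smul_def, Algebra.smul_def, star_mul', star_algebraMap, Algebra.commutes]

@[simp] theorem star_gen (x : X) : star (gen x) = genStar x := star_letter _

@[simp] theorem star_genStar (x : X) : star (genStar x) = gen x := star_letter _

/-- The unital *-homomorphism determined by the images of the generators. -/
noncomputable def lift {D : Type*} [Ring D] [StarRing D] [Algebra ℂ D] [StarModule ℂ D]
    (f : X → D) : FreeStarAlgebra X →⋆ₐ[ℂ] D :=
  let φ : FreeStarAlgebra X →ₐ[ℂ] D :=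
    FreeAlgebra.lift ℂ (Sum.elim f (fun x => star (f x)))
  have h1 : ∀ x, φ (gen x) = f x := fun x => FreeAlgebra.lift_ι_apply _ _
  have h2 : ∀ x, φ (genStar x) = star (f x) := fun x => FreeAlgebra.lift_ι_apply _ _
  { φ with
    map_star' := fun a => by
      change φ (star a) = star (φ a)
      induction a using induction with
      | algebraMap c => rw [star_algebraMap, φ.commutes, φ.commutes, algebraMap_star_comm]
      | gen x => rw [star_gen, h1, h2]
      | genStar x => rw [star_genStar, h1, h2, star_star]
      | mul a b ha hb => rw [star_mul', map_mul, map_mul, ha, hb, star_mul]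
      | add a b ha hb => rw [star_add', map_add, map_add, ha, hb, star_add] }

theorem lift_gen {D : Type*} [Ring D] [StarRing D] [Algebra ℂ D] [StarModule ℂ D]
    (f : X → D) (x : X) : lift f (gen x) = f x :=
  FreeAlgebra.lift_ι_apply (R := ℂ) (Sum.elim f (fun x => star (f x))) (Sum.inl x)

theorem hom_ext {D : Type*} [Ring D] [StarRing D] [Algebra ℂ D]
    {φ ψ : FreeStarAlgebra X →⋆ₐ[ℂ] D} (h : ∀ x, φ (gen x) = ψ (gen x)) : φ = ψ := by
  ext a
  induction a using induction with
  | algebraMap c => rw [AlgHomClass.commutes, AlgHomClass.commutes]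
  | gen x => exact h x
  | genStar x => rw [← star_gen, map_star, map_star, h]
  | mul a b ha hb => rw [map_mul, map_mul, ha, hb]
  | add a b ha hb => rw [map_add, map_add, ha, hb]

end FreeStarAlgebra

/-! ## C*-seminorms and their completions -/

/-- A C*-seminorm on a complex *-algebra. -/
structure CStarSeminorm (F : Type*) [Ring F] [StarRing F] [Algebra ℂ F] extends
    Seminorm ℂ F where
  mul_le' : ∀ x y : F, toFun (x * y) ≤ toFun x * toFun y
  star_mul_self' : ∀ x : F, toFun (star x * x) = toFun x * toFun x

namespace CStarSeminorm

variable {F : Type*} [Ring F] [StarRing F] [Algebra ℂ F]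

noncomputable instance : CoeFun (CStarSeminorm F) (fun _ => F → ℝ) := ⟨fun p => p.toSeminorm⟩

theorem mul_le (p : CStarSeminorm F) (x y : F) : p (x * y) ≤ p x * p y := p.mul_le' x y

theorem star_mul_self (p : CStarSeminorm F) (x : F) : p (star x * x) = p x * p x :=
  p.star_mul_self' x

theorem nonneg (p : CStarSeminorm F) (x : F) : 0 ≤ p x := apply_nonneg p.toSeminorm x

theorem star_eq (p : CStarSeminorm F) (x : F) : p (star x) = p x := by
  have key : ∀ y : F, p y ≤ p (star y) := fun y => by
    rcases (p.nonneg y).eq_or_lt with h | h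
    · rw [← h]; exact p.nonneg _
    · have := (p.star_mul_self y).symm.le.trans (p.mul_le _ _)
      exact le_of_mul_le_mul_right this h
  exact le_antisymm ((key _).trans_eq (by rw [star_star])) (key x)

/-- A copy of `F`, to carry the topology of the seminorm `p`. -/
def Carrier (_p : CStarSeminorm F) : Type _ := F

variable (p : CStarSeminorm F)

instance : Ring p.Carrier := inferInstanceAs (Ring F)
instance : StarRing p.Carrier := inferInstanceAs (StarRing F)
instance : Algebra ℂ p.Carrier := inferInstanceAs (Algebra ℂ F)

noncomputable instance : SeminormedRing p.Carrier :=
  { (inferInstance : Ring p.Carrier),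
    (AddGroupSeminorm.toSeminormedAddCommGroup
      (E := p.Carrier) (p.toSeminorm.toAddGroupSeminorm)) with
    norm_mul_le := fun x y => p.mul_le x y }

theorem norm_carrier (x : p.Carrier) : ‖x‖ = p x := rfl

noncomputable instance : NormedAlgebra ℂ p.Carrier where
  norm_smul_le c x := (map_smul_eq_mul p.toSeminorm c x).le

instance : NormedStarGroup p.Carrier where
  norm_star_le x := (p.star_eq x).le

/-- The Hausdorff completion of `F` in the C*-seminorm `p`. -/
def Completion : Type _ := UniformSpace.Completion p.Carrier

namespace Completion

noncomputable instance : NormedRing p.Completion :=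
  inferInstanceAs (NormedRing (UniformSpace.Completion p.Carrier))
instance : CompleteSpace p.Completion :=
  inferInstanceAs (CompleteSpace (UniformSpace.Completion p.Carrier))
noncomputable instance : Algebra ℂ p.Completion :=
  inferInstanceAs (Algebra ℂ (UniformSpace.Completion p.Carrier))

/-- The canonical map of `F` to its completion. -/
noncomputable def coe (x : F) : p.Completion :=
  ((show p.Carrier from x : p.Carrier) : UniformSpace.Completion p.Carrier)

theorem coe_add (x y : F) : coe p (x + y) = coe p x + coe p y :=
  UniformSpace.Completion.coe_add (α := p.Carrier) x y

theorem coe_mul (x y : F) : coe p (x * y) = coe p x * coe p y :=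
  UniformSpace.Completion.coe_mul (α := p.Carrier) x y

theorem coe_one : coe p (1 : F) = 1 := rfl

theorem coe_smul (c : ℂ) (x : F) : coe p (c • x) = c • coe p x :=
  UniformSpace.Completion.coe_smul (X := p.Carrier) c x

theorem norm_coe (x : F) : ‖coe p x‖ = p x :=
  UniformSpace.Completion.norm_coe (E := p.Carrier) x

theorem denseRange_coe : DenseRange (coe p) :=
  UniformSpace.Completion.denseRange_coe (α := p.Carrier)

noncomputable instance : NormedAlgebra ℂ p.Completion where
  norm_smul_le c x :=
    norm_smul_le (β := UniformSpace.Completion p.Carrier) c x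

noncomputable instance : Star p.Completion :=
  ⟨UniformSpace.Completion.map (star : p.Carrier → p.Carrier)⟩

theorem uniformContinuous_star : UniformContinuous (star : p.Carrier → p.Carrier) :=
  (star_isometry (E := p.Carrier)).uniformContinuous

theorem continuous_star' : Continuous (star : p.Completion → p.Completion) :=
  UniformSpace.Completion.continuous_map (f := (star : p.Carrier → p.Carrier))

theorem coe_star (x : F) : coe p (star x) = star (coe p x) :=
  (UniformSpace.Completion.map_coe (uniformContinuous_star p) x).symm

@[elab_as_elim]
theorem induction {motive : p.Completion → Prop} (x : p.Completion)
    (closed : IsClosed {x | motive x}) (coe : ∀ x : F, motive (coe p x)) : motive x :=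
  (denseRange_coe p).induction_on x closed coe

noncomputable instance : StarRing p.Completion where
  star_involutive x := by
    refine induction p x (isClosed_eq ((continuous_star' p).comp (continuous_star' p))
      continuous_id) fun x => ?_
    rw [← coe_star, ← coe_star, star_star]
  star_mul x y := by
    refine induction p x (isClosed_eq ((continuous_star' p).comp (continuous_mul_const y))
      ((continuous_const_mul _).comp (continuous_star' p))) fun x => ?_
    refine induction p y (isClosed_eq ((continuous_star' p).comp (continuous_const_mul _))
      ((continuous_mul_const _).comp (continuous_star' p))) fun y => ?_
    rw [← coe_mul, ← coe_star, ← coe_star, ← coe_star, ← coe_mul, star_mul]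
  star_add x y := by
    refine induction p x (isClosed_eq ((continuous_star' p).comp (continuous_add_const y))
      ((continuous_add_const _).comp (continuous_star' p))) fun x => ?_
    refine induction p y (isClosed_eq ((continuous_star' p).comp (continuous_const_add _))
      ((continuous_const_add _).comp (continuous_star' p))) fun y => ?_
    rw [← coe_add, ← coe_star, ← coe_star, ← coe_star, ← coe_add, star_add]

instance : CStarRing p.Completion where
  norm_mul_self_le x := by
    have hs := continuous_star' p
    refine induction p x (isClosed_le (by fun_prop) (by fun_prop)) fun x => ?_
    rw [← coe_star, ← coe_mul, norm_coe, norm_coe, p.star_mul_self]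

noncomputable instance [StarModule ℂ F] : CStarAlgebra p.Completion where
  star_smul c x := by
    refine induction p x (isClosed_eq ((continuous_star' p).comp (continuous_const_smul c))
      ((continuous_const_smul (star c)).comp (continuous_star' p))) fun x => ?_
    rw [← coe_smul, ← coe_star, ← coe_star, ← coe_smul, star_smul]

/-- The canonical *-homomorphism of `F` to its completion. -/
noncomputable def of : F →⋆ₐ[ℂ] p.Completion where
  toFun := coe p
  map_one' := coe_one p
  map_mul' := coe_mul p
  map_zero' := UniformSpace.Completion.coe_zero (α := p.Carrier)
  map_add' := coe_add p
  commutes' _ := rfl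
  map_star' := coe_star p

theorem norm_of (x : F) : ‖of p x‖ = p x := norm_coe p x

theorem denseRange_of : DenseRange (of p) := denseRange_coe p

end Completion
end CStarSeminorm

namespace CStarSeminorm

variable {F : Type*} [Ring F] [StarRing F] [Algebra ℂ F]

theorem of_eq_of_iff (p : CStarSeminorm F) (x y : F) :
    Completion.of p x = Completion.of p y ↔ p (x - y) = 0 := by
  rw [← sub_eq_zero, ← map_sub, ← norm_eq_zero, Completion.norm_of]

/-- The norm of a C*-algebra, pulled back along a *-homomorphism. -/
noncomputable def comap {D : Type*} [CStarAlgebra D] (φ : F →⋆ₐ[ℂ] D) : CStarSeminorm F where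
  toSeminorm := Seminorm.of (fun x => ‖φ x‖) (fun x y => by rw [map_add]; exact norm_add_le _ _)
    (fun c x => by rw [map_smul, norm_smul])
  mul_le' x y := by
    change ‖φ (x * y)‖ ≤ ‖φ x‖ * ‖φ y‖
    rw [map_mul]; exact norm_mul_le _ _
  star_mul_self' x := by
    change ‖φ (star x * x)‖ = ‖φ x‖ * ‖φ x‖
    rw [map_mul, map_star]; exact CStarRing.norm_star_mul_self

theorem comap_apply {D : Type*} [CStarAlgebra D] (φ : F →⋆ₐ[ℂ] D) (x : F) :
    comap φ x = ‖φ x‖ := rfl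

namespace Completion

variable (p : CStarSeminorm F) {D : Type*} [CStarAlgebra D]

theorem continuous_hom (φ : F →⋆ₐ[ℂ] D) (h : ∀ x, ‖φ x‖ ≤ p x) :
    Continuous (show p.Carrier →+* D from (φ : F →+* D)) :=
  AddMonoidHomClass.continuous_of_bound (show p.Carrier →+* D from (φ : F →+* D)) 1
    fun x => (h x).trans_eq (one_mul (p x)).symm

/-- The extension of a *-homomorphism dominated by `p` to the completion. -/
noncomputable def lift (φ : F →⋆ₐ[ℂ] D) (h : ∀ x, ‖φ x‖ ≤ p x) : p.Completion →⋆ₐ[ℂ] D :=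
  let ψ : p.Completion →+* D := UniformSpace.Completion.extensionHom
    (show p.Carrier →+* D from (φ : F →+* D)) (continuous_hom p φ h)
  have hψ : ∀ x : F, ψ (of p x) = φ x :=
    fun x => UniformSpace.Completion.extensionHom_coe
      (show p.Carrier →+* D from (φ : F →+* D)) (continuous_hom p φ h) x
  have hc : Continuous ψ := UniformSpace.Completion.continuous_extension
  { ψ with
    commutes' := fun c => (hψ (algebraMap ℂ F c)).trans (AlgHomClass.commutes φ c)
    map_star' := fun x => by
      change ψ (star x) = star (ψ x)
      refine induction p x (isClosed_eq (hc.comp (continuous_star' p)) hc.star) fun x => ?_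
      change ψ (star (of p x)) = star (ψ (of p x))
      rw [← map_star, hψ, hψ, map_star] }

theorem lift_of (φ : F →⋆ₐ[ℂ] D) (h : ∀ x, ‖φ x‖ ≤ p x) (x : F) :
    lift p φ h (of p x) = φ x :=
  UniformSpace.Completion.extensionHom_coe
    (show p.Carrier →+* D from (φ : F →+* D)) (continuous_hom p φ h) x

end Completion
end CStarSeminorm

/-! ## The C*-algebra of the braided free orthogonal quantum group -/

/-- The datum `(V, π, ω)` together with the twisting parameter `ζ`: in an orthonormal eigenbasis
`e_1, …, e_n` of `V` the representation is `π_z e_i = z ^ deg i • e_i`, and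
`∑ i j, ω i j • e_i ⊗ e_j` is a vector in `V ⊗ V` that is homogeneous of degree `d`. -/
structure BraidedDatum (n : ℕ) where
  ζ : Circle
  deg : Fin n → ℤ
  d : ℤ
  ω : Matrix (Fin n) (Fin n) ℂ
  homogeneous : ∀ i j, ω i j ≠ 0 → deg i + deg j = d

namespace BraidedDatum

variable {n : ℕ} (P : BraidedDatum n)

/-- The power `ζ ^ k` as a complex number. -/
noncomputable def ζpow (k : ℤ) : ℂ := ((P.ζ ^ k : Circle) : ℂ)

/-- The defining relations of `A_o(V, π, ω)` for a matrix `u` over a unital *-algebra: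
`u` is unitary and `ω` is invariant. -/
structure Relations {D : Type*} [Ring D] [StarRing D] [Algebra ℂ D]
    (u : Fin n → Fin n → D) : Prop where
  isometry : ∀ i j, ∑ k, star (u k i) * u k j = if i = j then 1 else 0
  coisometry : ∀ i j, ∑ k, u i k * star (u j k) = if i = j then 1 else 0
  invariant : ∀ i j,
    P.ζpow (P.deg j * P.deg i) • ∑ k, P.ω i k • u j k =
      P.ζpow (P.deg j * (P.d - P.deg j)) • ∑ k, P.ω k j • star (u k i)

theorem Relations.map {P : BraidedDatum n} {D E : Type*} [Ring D] [StarRing D] [Algebra ℂ D]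
    [Ring E] [StarRing E] [Algebra ℂ E] {u : Fin n → Fin n → D} (h : P.Relations u)
    (φ : D →⋆ₐ[ℂ] E) : P.Relations (fun i k => φ (u i k)) where
  isometry i j := by
    simpa only [map_sum, map_mul, map_star, apply_ite φ, map_one, map_zero] using
      congrArg φ (h.isometry i j)
  coisometry i j := by
    simpa only [map_sum, map_mul, map_star, apply_ite φ, map_one, map_zero] using
      congrArg φ (h.coisometry i j)
  invariant i j := by
    simpa only [map_sum, map_smul, map_star] using congrArg φ (h.invariant i j)

/-- The free unital *-algebra on the generators `u i j`. -/
abbrev Free (_P : BraidedDatum n) : Type := FreeStarAlgebra (Fin n × Fin n)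

/-- A C*-seminorm on the universal unital *-algebra with generators `u i j` and the relations of
`A_o(V, π, ω)`, viewed as a C*-seminorm on the free unital *-algebra: the relations hold in its
completion. -/
def Admissible (p : CStarSeminorm P.Free) : Prop :=
  P.Relations fun i k => CStarSeminorm.Completion.of p (FreeStarAlgebra.gen (i, k))

theorem admissible_iff (p : CStarSeminorm P.Free) : P.Admissible p ↔
    (∀ i j, p ((∑ k, star (FreeStarAlgebra.gen (k, i)) * FreeStarAlgebra.gen (k, j)) -
      if i = j then 1 else 0) = 0) ∧
    (∀ i j, p ((∑ k, FreeStarAlgebra.gen (i, k) * star (FreeStarAlgebra.gen (j, k))) -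
      if i = j then 1 else 0) = 0) ∧
    (∀ i j, p (P.ζpow (P.deg j * P.deg i) • ∑ k, P.ω i k • FreeStarAlgebra.gen (j, k) -
      P.ζpow (P.deg j * (P.d - P.deg j)) • ∑ k, P.ω k j • star (FreeStarAlgebra.gen (k, i)))
        = 0) := by
  simp only [← CStarSeminorm.of_eq_of_iff, map_sum, map_mul, map_star, map_smul,
    apply_ite (CStarSeminorm.Completion.of p), map_one, map_zero]
  exact ⟨fun h => ⟨h.isometry, h.coisometry, h.invariant⟩, fun h => ⟨h.1, h.2.1, h.2.2⟩⟩

/-- In a C*-algebra, the entries of a matrix satisfying the relations are contractions. -/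
theorem Relations.norm_le_one {P : BraidedDatum n} {D : Type*} [CStarAlgebra D]
    {u : Fin n → Fin n → D} (h : P.Relations u) (i j : Fin n) : ‖u i j‖ ≤ 1 := by
  let _ := CStarAlgebra.spectralOrder D
  let _ := CStarAlgebra.spectralOrderedRing D
  have h1 : star (u i j) * u i j ≤ 1 := by
    have := h.isometry j j
    rw [if_pos rfl] at this
    rw [← this]
    exact Finset.single_le_sum (f := fun k => star (u k j) * u k j)
      (fun k _ => star_mul_self_nonneg _) (Finset.mem_univ i)
  have h2 : ‖star (u i j) * u i j‖ ≤ 1 :=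
    (CStarAlgebra.norm_le_one_iff_of_nonneg _ (star_mul_self_nonneg _)).2 h1
  rw [CStarRing.norm_star_mul_self] at h2
  nlinarith [norm_nonneg (u i j)]

theorem Admissible.gen_le_one {P : BraidedDatum n} {p : CStarSeminorm P.Free}
    (h : P.Admissible p) (x : Fin n × Fin n) : p (FreeStarAlgebra.gen x) ≤ 1 := by
  rw [← CStarSeminorm.Completion.norm_of]
  exact h.norm_le_one x.1 x.2

/-- The C*-seminorms on the universal *-algebra are pointwise bounded. -/
theorem exists_bound (a : P.Free) : ∃ M, ∀ p : CStarSeminorm P.Free, P.Admissible p → p a ≤ M := by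
  induction a using FreeStarAlgebra.induction with
  | algebraMap c =>
    refine ⟨‖c‖, fun p _ => ?_⟩
    have h1 : p (1 : P.Free) ≤ 1 := by
      have := p.star_mul_self 1
      rw [star_one, one_mul] at this
      nlinarith [p.nonneg 1]
    rw [Algebra.algebraMap_eq_smul_one, map_smul_eq_mul p.toSeminorm]
    exact mul_le_of_le_one_right (norm_nonneg _) h1
  | gen x => exact ⟨1, fun p hp => hp.gen_le_one x⟩
  | genStar x =>
    exact ⟨1, fun p hp => by
      rw [← FreeStarAlgebra.star_gen, p.star_eq]; exact hp.gen_le_one x⟩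
  | mul a b ha hb =>
    obtain ⟨M, hM⟩ := ha
    obtain ⟨N, hN⟩ := hb
    exact ⟨M * N, fun p hp => (p.mul_le a b).trans (mul_le_mul (hM p hp) (hN p hp) (p.nonneg b)
      ((p.nonneg a).trans (hM p hp)))⟩
  | add a b ha hb =>
    obtain ⟨M, hM⟩ := ha
    obtain ⟨N, hN⟩ := hb
    exact ⟨M + N, fun p hp => (map_add_le_add p.toSeminorm a b).trans
      (add_le_add (hM p hp) (hN p hp))⟩

theorem bddAbove (a : P.Free) :
    BddAbove (Set.range fun p : {p : CStarSeminorm P.Free // P.Admissible p} => p.1 a) := by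
  obtain ⟨M, hM⟩ := P.exists_bound a
  exact ⟨M, by rintro _ ⟨p, rfl⟩; exact hM p.1 p.2⟩

instance : Nonempty {p : CStarSeminorm P.Free // P.Admissible p} := by
  refine ⟨⟨⟨0, fun x y => ?_, fun x => ?_⟩, ?_⟩⟩
  · change (0 : ℝ) ≤ 0 * 0; simp
  · change (0 : ℝ) = 0 * 0; simp
  · rw [admissible_iff]; exact ⟨fun _ _ => rfl, fun _ _ => rfl, fun _ _ => rfl⟩

/-- The largest C*-seminorm on the universal unital *-algebra. -/
noncomputable def maxSeminorm : CStarSeminorm P.Free where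
  toSeminorm := Seminorm.of
    (fun a => ⨆ p : {p : CStarSeminorm P.Free // P.Admissible p}, p.1 a)
    (fun a b => ciSup_le fun p => (map_add_le_add p.1.toSeminorm a b).trans
      (add_le_add (le_ciSup (P.bddAbove a) p) (le_ciSup (P.bddAbove b) p)))
    (fun c a => by
      simp only [map_smul_eq_mul]
      exact (Real.mul_iSup_of_nonneg (norm_nonneg c) _).symm)
  mul_le' a b := ciSup_le fun p => (p.1.mul_le a b).trans
    (mul_le_mul (le_ciSup (P.bddAbove a) p) (le_ciSup (P.bddAbove b) p) (p.1.nonneg b)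
      ((p.1.nonneg a).trans (le_ciSup (P.bddAbove a) p)))
  star_mul_self' a := by
    change (⨆ p : {p : CStarSeminorm P.Free // P.Admissible p}, p.1 (star a * a)) =
      (⨆ p : {p : CStarSeminorm P.Free // P.Admissible p}, p.1 a) *
      (⨆ p : {p : CStarSeminorm P.Free // P.Admissible p}, p.1 a)
    set S := ⨆ p : {p : CStarSeminorm P.Free // P.Admissible p}, p.1 a with hS
    have hS0 : 0 ≤ S := Real.iSup_nonneg fun p => p.1.nonneg a
    have hT0 : 0 ≤ ⨆ p : {p : CStarSeminorm P.Free // P.Admissible p}, p.1 (star a * a) :=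
      Real.iSup_nonneg fun p => p.1.nonneg _
    refine le_antisymm (ciSup_le fun p => ?_) ?_
    · rw [p.1.star_mul_self]
      exact mul_self_le_mul_self (p.1.nonneg a) (le_ciSup (P.bddAbove a) p)
    · have h1 : S ≤ Real.sqrt
          (⨆ p : {p : CStarSeminorm P.Free // P.Admissible p}, p.1 (star a * a)) := by
        refine ciSup_le fun p => Real.le_sqrt_of_sq_le ?_
        rw [sq, ← p.1.star_mul_self]
        exact le_ciSup (P.bddAbove (star a * a)) p
      calc S * S ≤ _ := mul_self_le_mul_self hS0 h1
        _ = _ := Real.mul_self_sqrt hT0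

theorem maxSeminorm_apply (a : P.Free) : P.maxSeminorm a =
    ⨆ p : {p : CStarSeminorm P.Free // P.Admissible p}, p.1 a := rfl

theorem le_maxSeminorm {p : CStarSeminorm P.Free} (hp : P.Admissible p) (a : P.Free) :
    p a ≤ P.maxSeminorm a :=
  le_ciSup (P.bddAbove a) ⟨p, hp⟩

theorem admissible_maxSeminorm : P.Admissible P.maxSeminorm := by
  rw [admissible_iff]
  simp only [maxSeminorm_apply]
  have key : ∀ a : P.Free, (∀ p, P.Admissible p → p a = 0) →
      (⨆ p : {p : CStarSeminorm P.Free // P.Admissible p}, p.1 a) = 0 := fun a h => by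
    exact (iSup_congr fun p : {p : CStarSeminorm P.Free // P.Admissible p} =>
      h p.1 p.2).trans ciSup_const
  exact ⟨fun i j => key _ fun p hp => ((P.admissible_iff p).1 hp).1 i j,
    fun i j => key _ fun p hp => ((P.admissible_iff p).1 hp).2.1 i j,
    fun i j => key _ fun p hp => ((P.admissible_iff p).1 hp).2.2 i j⟩

/-- The universal unital C*-algebra `A_o(V, π, ω)`: the completion of the universal unital
*-algebra with generators `u i j` and the defining relations in its largest C*-seminorm. -/
abbrev Ao : Type := P.maxSeminorm.Completion

/-- The generators of `A_o(V, π, ω)`. -/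
noncomputable def u (i k : Fin n) : P.Ao :=
  CStarSeminorm.Completion.of P.maxSeminorm (FreeStarAlgebra.gen (i, k))

theorem relations_u : P.Relations P.u := P.admissible_maxSeminorm

theorem norm_lift_le {D : Type*} [CStarAlgebra D] {f : Fin n → Fin n → D} (hf : P.Relations f)
    (a : P.Free) :
    ‖FreeStarAlgebra.lift (fun x : Fin n × Fin n => f x.1 x.2) a‖ ≤ P.maxSeminorm a := by
  refine P.le_maxSeminorm (p := CStarSeminorm.comap (FreeStarAlgebra.lift
    fun x : Fin n × Fin n => f x.1 x.2)) ?_ a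
  have hg : ∀ x : Fin n × Fin n, FreeStarAlgebra.lift (fun x : Fin n × Fin n => f x.1 x.2)
      (FreeStarAlgebra.gen x) = f x.1 x.2 := fun x => FreeStarAlgebra.lift_gen _ x
  rw [admissible_iff]
  simp only [CStarSeminorm.comap_apply, norm_eq_zero, map_sub, sub_eq_zero, map_sum, map_mul,
    map_star, map_smul, hg, apply_ite (FreeStarAlgebra.lift fun x : Fin n × Fin n => f x.1 x.2),
    map_one, map_zero]
  exact ⟨hf.isometry, hf.coisometry, hf.invariant⟩

/-- The universal property of `A_o(V, π, ω)`. -/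
noncomputable def lift {D : Type*} [CStarAlgebra D] {f : Fin n → Fin n → D}
    (hf : P.Relations f) : P.Ao →⋆ₐ[ℂ] D :=
  CStarSeminorm.Completion.lift P.maxSeminorm
    (FreeStarAlgebra.lift fun x : Fin n × Fin n => f x.1 x.2) (P.norm_lift_le hf)

@[simp] theorem lift_u {D : Type*} [CStarAlgebra D] {f : Fin n → Fin n → D}
    (hf : P.Relations f) (i k : Fin n) : P.lift hf (P.u i k) = f i k :=
  (CStarSeminorm.Completion.lift_of _ _ _ _).trans (FreeStarAlgebra.lift_gen _ _)

/-- The matrix `z ^ (deg k - deg i) • u i k` satisfies the defining relations. -/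
theorem relations_beta (z : Circle) :
    P.Relations fun i k => ((z ^ (P.deg k - P.deg i) : Circle) : ℂ) • P.u i k := by
  have hstar : ∀ m : ℤ, star ((z ^ m : Circle) : ℂ) = ((z ^ (-m) : Circle) : ℂ) := fun m => by
    rw [zpow_neg, Circle.coe_inv_eq_conj]; rfl
  have hmul : ∀ a b : ℤ, ((z ^ a : Circle) : ℂ) * ((z ^ b : Circle) : ℂ) =
      ((z ^ (a + b) : Circle) : ℂ) := fun a b => by rw [zpow_add, Circle.coe_mul]
  refine ⟨fun i j => ?_, fun i j => ?_, fun i j => ?_⟩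
  · have h : ∀ k, star (((z ^ (P.deg i - P.deg k) : Circle) : ℂ) • P.u k i) *
        (((z ^ (P.deg j - P.deg k) : Circle) : ℂ) • P.u k j) =
        ((z ^ (P.deg j - P.deg i) : Circle) : ℂ) • (star (P.u k i) * P.u k j) := fun k => by
      rw [star_smul, smul_mul_smul_comm, hstar, hmul]; congr 3; ring
    simp only [h, ← Finset.smul_sum, P.relations_u.isometry]
    split_ifs with hij
    · simp [hij]
    · simp
  · have h : ∀ k, (((z ^ (P.deg k - P.deg i) : Circle) : ℂ) • P.u i k) *
        star (((z ^ (P.deg k - P.deg j) : Circle) : ℂ) • P.u j k) =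
        ((z ^ (P.deg j - P.deg i) : Circle) : ℂ) • (P.u i k * star (P.u j k)) := fun k => by
      rw [star_smul, smul_mul_smul_comm, hstar, hmul]; congr 3; ring
    simp only [h, ← Finset.smul_sum, P.relations_u.coisometry]
    split_ifs with hij
    · simp [hij]
    · simp
  · have h1 : ∀ k, P.ω i k • ((z ^ (P.deg k - P.deg j) : Circle) : ℂ) • P.u j k =
        ((z ^ (P.d - P.deg i - P.deg j) : Circle) : ℂ) • (P.ω i k • P.u j k) := fun k => by
      by_cases h0 : P.ω i k = 0
      · simp [h0]
      · rw [smul_comm, ← P.homogeneous i k h0, add_sub_cancel_left]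
    have h2 : ∀ k, P.ω k j • star (((z ^ (P.deg i - P.deg k) : Circle) : ℂ) • P.u k i) =
        ((z ^ (P.d - P.deg i - P.deg j) : Circle) : ℂ) • (P.ω k j • star (P.u k i)) := fun k => by
      by_cases h0 : P.ω k j = 0
      · simp [h0]
      · rw [star_smul, smul_comm, hstar, ← P.homogeneous k j h0]; congr 3; ring
    simp only [h1, h2, ← Finset.smul_sum]
    rw [smul_comm, P.relations_u.invariant, smul_comm]

/-- The action of the circle on `A_o(V, π, ω)`: `β_z (u i k) = z ^ (deg k - deg i) • u i k`. -/
noncomputable def β (z : Circle) : P.Ao →⋆ₐ[ℂ] P.Ao := P.lift (P.relations_beta z)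

end BraidedDatum

/-! ## Operators on `ℓ²`-spaces -/

/-- The Hilbert space with orthonormal basis indexed by `ι`. The Hilbert space tensor product of
`L2 ι` and `L2 κ` is `L2 (ι × κ)`. -/
def L2 (ι : Type*) : Type _ := lp (fun _ : ι => ℂ) 2

namespace L2

variable {ι κ : Type*}

noncomputable instance : NormedAddCommGroup (L2 ι) :=
  inferInstanceAs (NormedAddCommGroup (lp (fun _ : ι => ℂ) 2))

noncomputable instance : InnerProductSpace ℂ (L2 ι) :=
  inferInstanceAs (InnerProductSpace ℂ (lp (fun _ : ι => ℂ) 2))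

instance : CompleteSpace (L2 ι) := inferInstanceAs (CompleteSpace (lp (fun _ : ι => ℂ) 2))

/-- The coordinates of a vector. -/
def toFun (f : L2 ι) : ι → ℂ := (show lp (fun _ : ι => ℂ) 2 from f)

instance : CoeFun (L2 ι) (fun _ => ι → ℂ) := ⟨toFun⟩

@[ext] theorem ext {f g : L2 ι} (h : ∀ i, f i = g i) : f = g := lp.ext (funext h)

@[simp] theorem add_apply (f g : L2 ι) (i : ι) : (f + g) i = f i + g i := rfl

@[simp] theorem zero_apply (i : ι) : (0 : L2 ι) i = 0 := rfl

@[simp] theorem smul_apply (c : ℂ) (f : L2 ι) (i : ι) : (c • f) i = c * f i := rfl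

theorem summable_sq (f : L2 ι) : Summable fun i => ‖f i‖ ^ 2 := by
  simpa using! (lp.memℓp (show lp (fun _ : ι => ℂ) 2 from f)).summable (by norm_num)

theorem norm_sq (f : L2 ι) : ‖f‖ ^ 2 = ∑' i, ‖f i‖ ^ 2 := by
  simpa using! lp.norm_rpow_eq_tsum (p := 2) (by norm_num) (show lp (fun _ : ι => ℂ) 2 from f)

theorem inner_eq_tsum (f g : L2 ι) : inner ℂ f g = ∑' i, inner ℂ (f i) (g i) :=
  lp.inner_eq_tsum (𝕜 := ℂ) (G := fun _ : ι => ℂ) f g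

theorem summable_inner (f g : L2 ι) : Summable fun i => inner ℂ (f i) (g i) :=
  lp.summable_inner (𝕜 := ℂ) (G := fun _ : ι => ℂ) f g

/-- A square-summable family as an element of `L2 ι`. -/
def mk (f : ι → ℂ) (hf : Summable fun i => ‖f i‖ ^ 2) : L2 ι :=
  (⟨f, memℓp_gen (by simpa using hf)⟩ : lp (fun _ : ι => ℂ) 2)

@[simp] theorem mk_apply (f : ι → ℂ) (hf : Summable fun i => ‖f i‖ ^ 2) (i : ι) :
    mk f hf i = f i := rfl

/-- The unitary that maps the basis vector `i` to `c i` times the basis vector `e i`. -/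
noncomputable def monomial (e : ι ≃ κ) (c : ι → Circle) : L2 ι ≃ₗᵢ[ℂ] L2 κ where
  toFun f := mk (fun k => (c (e.symm k) : ℂ) * f (e.symm k)) (by
    simpa [Function.comp_def, Circle.norm_coe] using (e.symm.summable_iff (f := fun i => ‖f i‖ ^ 2)).2 f.summable_sq)
  invFun g := mk (fun i => ((c i)⁻¹ : Circle) * g (e i)) (by
    simpa [Function.comp_def, Circle.norm_coe] using (e.summable_iff (f := fun i => ‖g i‖ ^ 2)).2 g.summable_sq)
  left_inv f := by ext i; simp
  right_inv g := by ext k; simp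
  map_add' f g := by ext k; simp [mul_add]
  map_smul' a f := by ext k; simp [mul_left_comm]
  norm_map' f := by
    refine (sq_eq_sq₀ (norm_nonneg _) (norm_nonneg _)).1 ?_
    rw [norm_sq, norm_sq]
    simpa [Circle.norm_coe] using e.symm.tsum_eq (fun i => ‖f i‖ ^ 2)

/-- The slice `f (·, k)`. -/
def slice (f : L2 (ι × κ)) (k : κ) : L2 ι :=
  mk (fun i => f (i, k))
    (f.summable_sq.comp_injective (i := fun i : ι => (i, k)) fun _ _ h => congrArg Prod.fst h)

@[simp] theorem slice_apply (f : L2 (ι × κ)) (k : κ) (i : ι) : slice f k i = f (i, k) := rfl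

theorem summable_swap (f : L2 (ι × κ)) : Summable fun q : κ × ι => ‖f (q.2, q.1)‖ ^ 2 :=
  ((Equiv.prodComm κ ι).summable_iff (f := fun q : ι × κ => ‖f q‖ ^ 2)).2 f.summable_sq

theorem summable_slice (f : L2 (ι × κ)) : Summable fun k => ‖slice f k‖ ^ 2 := by
  simpa only [norm_sq] using! f.summable_swap.prod

theorem norm_sq_eq_tsum_slice (f : L2 (ι × κ)) : ‖f‖ ^ 2 = ∑' k, ‖slice f k‖ ^ 2 := by
  simp only [norm_sq, slice_apply]
  rw [← (Equiv.prodComm κ ι).tsum_eq (fun q : ι × κ => ‖f q‖ ^ 2)]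
  exact f.summable_swap.tsum_prod

theorem inner_eq_tsum_slice (f g : L2 (ι × κ)) :
    inner ℂ f g = ∑' k, inner ℂ (slice f k) (slice g k) := by
  have hs : Summable fun q : κ × ι => inner ℂ (f (q.2, q.1)) (g (q.2, q.1)) :=
    ((Equiv.prodComm κ ι).summable_iff
      (f := fun q : ι × κ => (inner ℂ (f q) (g q) : ℂ))).2 (summable_inner f g)
  rw [inner_eq_tsum, ← (Equiv.prodComm κ ι).tsum_eq (fun q : ι × κ => inner ℂ (f q) (g q))]
  exact hs.tsum_prod.trans
    (tsum_congr fun k => (inner_eq_tsum (slice f k) (slice g k)).symm)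

/-- The vector with slices `g k`. -/
def ofSlices (g : κ → L2 ι) (hg : Summable fun k => ‖g k‖ ^ 2) : L2 (ι × κ) :=
  mk (fun q => g q.2 q.1) (by
    have h : Summable fun q : κ × ι => ‖g q.1 q.2‖ ^ 2 :=
      (summable_prod_of_nonneg fun _ => by positivity).2
        ⟨fun k => (g k).summable_sq, by simpa only [norm_sq] using hg⟩
    exact ((Equiv.prodComm ι κ).summable_iff (f := fun q : κ × ι => ‖g q.1 q.2‖ ^ 2)).2 h)

@[simp] theorem ofSlices_apply (g : κ → L2 ι) (hg : Summable fun k => ‖g k‖ ^ 2) (q : ι × κ) :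
    ofSlices g hg q = g q.2 q.1 := rfl

end L2

/-- The C*-algebra of bounded operators on `L2 ι`. -/
def Op (ι : Type*) : Type _ := L2 ι →L[ℂ] L2 ι

namespace Op

variable {ι κ : Type*}

noncomputable instance : CStarAlgebra (Op ι) :=
  inferInstanceAs (CStarAlgebra (L2 ι →L[ℂ] L2 ι))

/-- An operator as a continuous linear map. -/
noncomputable def toCLM (x : Op ι) : L2 ι →L[ℂ] L2 ι := x

noncomputable instance : CoeFun (Op ι) (fun _ => L2 ι → L2 ι) := ⟨fun x => x.toCLM⟩

@[ext] theorem ext {x y : Op ι} (h : ∀ f : L2 ι, x f = y f) : x = y := ContinuousLinearMap.ext h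

theorem le_opNorm (x : Op ι) (f : L2 ι) : ‖x f‖ ≤ ‖x‖ * ‖f‖ := x.toCLM.le_opNorm f

theorem inner_star_left (x : Op ι) (f g : L2 ι) : inner ℂ ((star x) f) g = inner ℂ f (x g) :=
  ContinuousLinearMap.adjoint_inner_left x.toCLM g f

theorem eq_star_of_inner (x y : Op ι) (h : ∀ f g : L2 ι, inner ℂ (y f) g = inner ℂ f (x g)) :
    y = star x :=
  (ContinuousLinearMap.eq_adjoint_iff y.toCLM x.toCLM).2 h

/-- Conjugation by a unitary, `x ↦ e x e⁻¹`. -/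
noncomputable def conj (e : L2 ι ≃ₗᵢ[ℂ] L2 κ) : Op ι →⋆ₐ[ℂ] Op κ where
  toFun x := (e : L2 ι →L[ℂ] L2 κ).comp (x.toCLM.comp (e.symm : L2 κ →L[ℂ] L2 ι))
  map_one' := by ext1 f; exact e.apply_symm_apply f
  map_mul' x y := by
    ext1 f
    exact congrArg (fun g => e (x g)) (e.symm_apply_apply (y (e.symm f))).symm
  map_zero' := by ext1 f; exact map_zero e
  map_add' x y := by ext1 f; exact map_add e (x (e.symm f)) (y (e.symm f))
  commutes' c := by
    ext1 f
    exact (map_smul e c (e.symm f)).trans (congrArg (c • ·) (e.apply_symm_apply f))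
  map_star' x := by
    refine eq_star_of_inner (ι := κ) _ _ fun f g => ?_
    have h1 : inner ℂ (e ((star x) (e.symm f))) g = inner ℂ ((star x) (e.symm f)) (e.symm g) := by
      rw [← e.inner_map_map, e.apply_symm_apply]
    have h2 : inner ℂ f (e (x (e.symm g))) = inner ℂ (e.symm f) (x (e.symm g)) := by
      rw [← e.inner_map_map, e.apply_symm_apply]
    exact h1.trans ((inner_star_left x _ _).trans h2.symm)

theorem conj_apply (e : L2 ι ≃ₗᵢ[ℂ] L2 κ) (x : Op ι) (f : L2 κ) :
    conj e x f = e (x (e.symm f)) := rfl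

theorem summable_apply_slice (x : Op ι) (f : L2 (ι × κ)) :
    Summable fun k => ‖x (f.slice k)‖ ^ 2 :=
  Summable.of_nonneg_of_le (fun _ => by positivity)
    (fun k => by
      rw [← mul_pow]
      exact pow_le_pow_left₀ (norm_nonneg _) (x.le_opNorm _) 2)
    (f.summable_slice.mul_left (‖x‖ ^ 2))

/-- The operator `x ⊗ 1` on `L2 ι ⊗ L2 κ`, as a linear map. -/
noncomputable def ampLin (x : Op ι) : L2 (ι × κ) →ₗ[ℂ] L2 (ι × κ) where
  toFun f := L2.ofSlices (fun k => x (f.slice k)) (summable_apply_slice x f)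
  map_add' f g := by
    ext q
    have h : (f + g).slice q.2 = f.slice q.2 + g.slice q.2 := rfl
    simp [h]
  map_smul' c f := by
    ext q
    have h : (c • f).slice q.2 = c • f.slice q.2 := rfl
    simp [h]

theorem slice_ampLin (x : Op ι) (f : L2 (ι × κ)) (k : κ) :
    (ampLin x f).slice k = x (f.slice k) := rfl

/-- The operator `x ⊗ 1` on `L2 ι ⊗ L2 κ`. -/
noncomputable def ampCLM (κ : Type*) (x : Op ι) : L2 (ι × κ) →L[ℂ] L2 (ι × κ) :=
  (ampLin x).mkContinuous ‖x‖ fun f => by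
    refine abs_le_of_sq_le_sq' ?_ (by positivity) |>.2
    rw [mul_pow, L2.norm_sq_eq_tsum_slice, L2.norm_sq_eq_tsum_slice f, ← tsum_mul_left]
    refine Summable.tsum_le_tsum (fun k => ?_) (L2.summable_slice _)
      (f.summable_slice.mul_left _)
    rw [slice_ampLin, ← mul_pow]
    exact pow_le_pow_left₀ (norm_nonneg _) (x.le_opNorm _) 2

/-- The *-homomorphism `x ↦ x ⊗ 1` from operators on `L2 ι` to operators on `L2 ι ⊗ L2 κ`. -/
noncomputable def amp (κ : Type*) : Op ι →⋆ₐ[ℂ] Op (ι × κ) where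
  toFun x := ampCLM κ x
  map_one' := by ext f q; rfl
  map_mul' x y := by ext f q; rfl
  map_zero' := by ext f q; rfl
  map_add' x y := by ext f q; rfl
  commutes' c := by ext f q; rfl
  map_star' x := by
    refine eq_star_of_inner (ι := ι × κ) (ampCLM κ x) (ampCLM κ (star x)) fun f g => ?_
    rw [L2.inner_eq_tsum_slice, L2.inner_eq_tsum_slice f]
    exact tsum_congr fun k => inner_star_left x (f.slice k) (g.slice k)

theorem amp_apply (x : Op ι) (f : L2 (ι × κ)) (q : ι × κ) :
    amp κ x f q = x (f.slice q.2) q.1 := rfl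

/-- The *-homomorphism `y ↦ 1 ⊗ y` from operators on `L2 κ` to operators on `L2 ι ⊗ L2 κ`. -/
noncomputable def ampRight (ι : Type*) : Op κ →⋆ₐ[ℂ] Op (ι × κ) :=
  (conj (L2.monomial (Equiv.prodComm κ ι) 1)).comp (amp ι)

end Op

/-! ## Braided and spatial tensor products of concrete C*-algebras -/

/-- The braiding unitary of `L2 ι ⊗ L2 κ`, where the basis vectors `i` and `k` are homogeneous of
degree `deg₁ i` and `deg₂ k`: it maps `i ⊗ k` to `ζ ^ (deg₁ i * deg₂ k)` times `k ⊗ i`. -/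
noncomputable def braiding {ι κ : Type*} (ζ : Circle) (deg₁ : ι → ℤ) (deg₂ : κ → ℤ) :
    L2 (ι × κ) ≃ₗᵢ[ℂ] L2 (κ × ι) :=
  L2.monomial (Equiv.prodComm ι κ) fun q => ζ ^ (deg₁ q.1 * deg₂ q.2)

/-- The unitary operator by which `z` in the circle acts on `L2 ι`, where the basis vector `i` is
homogeneous of degree `deg i`. -/
noncomputable def circleRep {ι : Type*} (deg : ι → ℤ) (z : Circle) : L2 ι ≃ₗᵢ[ℂ] L2 ι :=
  L2.monomial (Equiv.refl ι) fun i => z ^ deg i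

/-- The embedding of operators on the second factor of a braided tensor product:
`y ↦ B (y ⊗ 1) B⁻¹`, where `B : L2 κ ⊗ L2 ι → L2 ι ⊗ L2 κ` is the braiding unitary. -/
noncomputable def secondLeg {ι κ : Type*} (ζ : Circle) (deg₁ : ι → ℤ) (deg₂ : κ → ℤ) :
    Op κ →⋆ₐ[ℂ] Op (ι × κ) :=
  (Op.conj (braiding ζ deg₂ deg₁)).comp (Op.amp ι)

/-- The braided tensor product `X ⊠ Y` of concrete C*-algebras: the C*-algebra generated by the
images of `X` and `Y` on `L2 ι ⊗ L2 κ`. -/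
noncomputable def braidedTensor {ι κ : Type*} (ζ : Circle) (deg₁ : ι → ℤ) (deg₂ : κ → ℤ)
    (X : StarSubalgebra ℂ (Op ι)) (Y : StarSubalgebra ℂ (Op κ)) :
    StarSubalgebra ℂ (Op (ι × κ)) :=
  (StarAlgebra.adjoin ℂ
    (Op.amp κ '' (X : Set (Op ι)) ∪ secondLeg ζ deg₁ deg₂ '' (Y : Set (Op κ)))).topologicalClosure

/-- The canonical embedding of the first factor into `X ⊠ Y`. -/
noncomputable def j₁ {ι κ : Type*} {ζ : Circle} {deg₁ : ι → ℤ} {deg₂ : κ → ℤ}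
    {X : StarSubalgebra ℂ (Op ι)} {Y : StarSubalgebra ℂ (Op κ)} :
    X →⋆ₐ[ℂ] braidedTensor ζ deg₁ deg₂ X Y :=
  StarAlgHom.codRestrict ((Op.amp κ).comp X.subtype) _ fun x =>
    StarSubalgebra.le_topologicalClosure _
      (StarAlgebra.subset_adjoin ℂ _ (Or.inl ⟨x, x.2, rfl⟩))

/-- The canonical embedding of the second factor into `X ⊠ Y`. -/
noncomputable def j₂ {ι κ : Type*} {ζ : Circle} {deg₁ : ι → ℤ} {deg₂ : κ → ℤ}
    {X : StarSubalgebra ℂ (Op ι)} {Y : StarSubalgebra ℂ (Op κ)} :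
    Y →⋆ₐ[ℂ] braidedTensor ζ deg₁ deg₂ X Y :=
  StarAlgHom.codRestrict ((secondLeg ζ deg₁ deg₂).comp Y.subtype) _ fun y =>
    StarSubalgebra.le_topologicalClosure _
      (StarAlgebra.subset_adjoin ℂ _ (Or.inr ⟨y, y.2, rfl⟩))

/-- The spatial (minimal) tensor product `X ⊗ Y` of concrete C*-algebras on `L2 ι ⊗ L2 κ`. -/
noncomputable def spatialTensor {ι κ : Type*} (X : StarSubalgebra ℂ (Op ι))
    (Y : StarSubalgebra ℂ (Op κ)) : StarSubalgebra ℂ (Op (ι × κ)) :=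
  (StarAlgebra.adjoin ℂ
    (Op.amp κ '' (X : Set (Op ι)) ∪ Op.ampRight ι '' (Y : Set (Op κ)))).topologicalClosure

/-- The embedding `x ↦ x ⊗ 1`. -/
noncomputable def spatialLeft {ι κ : Type*} {X : StarSubalgebra ℂ (Op ι)}
    {Y : StarSubalgebra ℂ (Op κ)} : X →⋆ₐ[ℂ] spatialTensor X Y :=
  StarAlgHom.codRestrict ((Op.amp κ).comp X.subtype) _ fun x =>
    StarSubalgebra.le_topologicalClosure _
      (StarAlgebra.subset_adjoin ℂ _ (Or.inl ⟨x, x.2, rfl⟩))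

/-- The embedding `y ↦ 1 ⊗ y`. -/
noncomputable def spatialRight {ι κ : Type*} {X : StarSubalgebra ℂ (Op ι)}
    {Y : StarSubalgebra ℂ (Op κ)} : Y →⋆ₐ[ℂ] spatialTensor X Y :=
  StarAlgHom.codRestrict ((Op.ampRight ι).comp Y.subtype) _ fun y =>
    StarSubalgebra.le_topologicalClosure _
      (StarAlgebra.subset_adjoin ℂ _ (Or.inr ⟨y, y.2, rfl⟩))

/-- The elementary tensor `x ⊗ y` in the spatial tensor product. -/
noncomputable def tmul {ι κ : Type*} {X : StarSubalgebra ℂ (Op ι)} {Y : StarSubalgebra ℂ (Op κ)}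
    (x : X) (y : Y) : spatialTensor X Y :=
  spatialLeft x * spatialRight y

/-! ## Compact matrix quantum groups -/

/-- The *-subalgebra generated by the entries of a matrix. -/
noncomputable def coeffAlgebra {D m : Type*} [Ring D] [StarRing D] [Algebra ℂ D]
    [StarModule ℂ D] (w : Matrix m m D) : StarSubalgebra ℂ D :=
  StarAlgebra.adjoin ℂ (Set.range fun q : m × m => w q.1 q.2)

/-- The entries of a matrix, as elements of the *-subalgebra that they generate. -/
noncomputable def coeff {D m : Type*} [Ring D] [StarRing D] [Algebra ℂ D] [StarModule ℂ D]
    (w : Matrix m m D) (k l : m) : coeffAlgebra w :=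
  ⟨w k l, StarAlgebra.subset_adjoin ℂ _ ⟨(k, l), rfl⟩⟩

/-- `(C, w)` is a compact matrix quantum group with comultiplication `Δ`, in the sense of
Woronowicz: `C` is a unital C*-algebra, the *-subalgebra generated by the entries of `w` is dense,
`Δ : C → C ⊗ C` is a *-homomorphism with `Δ (w k l) = ∑ r, w k r ⊗ w r l`, and there is a linear
antimultiplicative coinverse `S` on this *-subalgebra with `S (S (a*)*) = a` that maps the entries
of `w` to those of the inverse of `w`. -/
structure IsCompactMatrixQuantumGroup {ι m : Type*} [Fintype m] [DecidableEq m]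
    (C : StarSubalgebra ℂ (Op ι)) (w : Matrix m m C) (Δ : C →⋆ₐ[ℂ] spatialTensor C C) : Prop where
  isClosed : IsClosed (C : Set (Op ι))
  dense : (coeffAlgebra w).topologicalClosure = ⊤
  comul : ∀ k l, Δ (w k l) = ∑ r, tmul (w k r) (w r l)
  coinverse : ∃ S : coeffAlgebra w →ₗ[ℂ] coeffAlgebra w,
    (∀ a b, S (a * b) = S b * S a) ∧ (∀ a, S (star (S (star a))) = a) ∧
    (∀ k l, ∑ r, S (coeff w k r) * coeff w r l = if k = l then 1 else 0) ∧
    (∀ k l, ∑ r, coeff w k r * S (coeff w r l) = if k = l then 1 else 0)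

/-! ## The bosonisation -/

/-- The generator of `C(𝕋)`. We identify `L²(𝕋)` with `L2 ℤ` so that the function `z ^ k` becomes
the basis vector `k`; then pointwise multiplication by `z` becomes the shift `k ↦ k + 1`. -/
noncomputable def shift : unitary (Op ℤ) :=
  (Unitary.linearIsometryEquiv.symm (L2.monomial (Equiv.addRight (1 : ℤ)) 1) :
    unitary (L2 ℤ →L[ℂ] L2 ℤ))

/-- The C*-algebra `C(𝕋)`, acting on `L²(𝕋)` by pointwise multiplication. -/
noncomputable def circleAlgebra : StarSubalgebra ℂ (Op ℤ) :=
  (StarAlgebra.adjoin ℂ {(shift : Op ℤ)}).topologicalClosure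

theorem shift_mem : (shift : Op ℤ) ∈ circleAlgebra :=
  StarSubalgebra.le_topologicalClosure _ (StarAlgebra.subset_adjoin ℂ _ rfl)

/-- The unitary generator `z` of `C(𝕋)`. -/
noncomputable def circleGen : unitary circleAlgebra :=
  ⟨⟨shift, shift_mem⟩, Unitary.mem_iff.2
    ⟨Subtype.ext (Unitary.coe_star_mul_self shift), Subtype.ext (Unitary.coe_mul_star_self shift)⟩⟩

namespace BraidedDatum

variable {n : ℕ} (P : BraidedDatum n)

/-- A faithful `𝕋`-equivariant representation of `A_o(V, π, ω)` on a Hilbert space with an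
orthonormal basis indexed by `ι` that consists of homogeneous vectors. -/
structure FaithfulRep (ι : Type*) where
  deg : ι → ℤ
  σ : P.Ao →⋆ₐ[ℂ] Op ι
  injective : Function.Injective σ
  equivariant : ∀ (z : Circle) (b : P.Ao), σ (P.β z b) = Op.conj (circleRep deg z) (σ b)

namespace FaithfulRep

variable {P} {ι : Type*} (R : P.FaithfulRep ι)

/-- `A_o(V, π, ω)` as a concrete C*-algebra. -/
noncomputable def algebra : StarSubalgebra ℂ (Op ι) := R.σ.range

/-- The map of `A_o(V, π, ω)` onto the concrete C*-algebra. -/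
noncomputable def incl : P.Ao →⋆ₐ[ℂ] R.algebra := R.σ.rangeRestrict

/-- The underlying C*-algebra `C = C(𝕋) ⊠ A_o(V, π, ω)` of the bosonisation. -/
noncomputable def bosonisation : StarSubalgebra ℂ (Op (ℤ × ι)) :=
  braidedTensor P.ζ (fun k : ℤ => k) R.deg circleAlgebra R.algebra

/-- The braided tensor product `A_o(V, π, ω) ⊠ A_o(V, π, ω)`. -/
noncomputable def square : StarSubalgebra ℂ (Op (ι × ι)) :=
  braidedTensor P.ζ R.deg R.deg R.algebra R.algebra

/-- The braided tensor product `C(𝕋) ⊠ (A_o(V, π, ω) ⊠ A_o(V, π, ω))`. -/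
noncomputable def triple : StarSubalgebra ℂ (Op (ℤ × (ι × ι))) :=
  braidedTensor P.ζ (fun k : ℤ => k) (fun q : ι × ι => R.deg q.1 + R.deg q.2)
    circleAlgebra R.square

/-- The embedding `j₁ : C(𝕋) → C`. -/
noncomputable def fromCircle : circleAlgebra →⋆ₐ[ℂ] R.bosonisation := j₁

/-- The embedding `j₂ : A_o(V, π, ω) → C`. -/
noncomputable def fromAo : P.Ao →⋆ₐ[ℂ] R.bosonisation := StarAlgHom.comp j₂ R.incl

/-- The three embeddings into `C(𝕋) ⊠ A_o(V, π, ω) ⊠ A_o(V, π, ω)`: the first one. -/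
noncomputable def leg₁ : circleAlgebra →⋆ₐ[ℂ] R.triple := j₁

/-- The embedding of `A_o(V, π, ω) ⊠ A_o(V, π, ω)` as the last two factors. -/
noncomputable def leg₂₃ : R.square →⋆ₐ[ℂ] R.triple := j₂

/-- The embeddings `j₁` of `A_o(V, π, ω)` into `A_o(V, π, ω) ⊠ A_o(V, π, ω)`. -/
noncomputable def sq₁ : P.Ao →⋆ₐ[ℂ] R.square := StarAlgHom.comp j₁ R.incl

/-- The embedding `j₂` of `A_o(V, π, ω)` into `A_o(V, π, ω) ⊠ A_o(V, π, ω)`. -/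
noncomputable def sq₂ : P.Ao →⋆ₐ[ℂ] R.square := StarAlgHom.comp j₂ R.incl

/-- `Δ` is the comultiplication of the bosonisation. That is, `Δ` is the composite of
`id ⊠ ΔB : C(𝕋) ⊠ B → C(𝕋) ⊠ B ⊠ B` and `ψ : C(𝕋) ⊠ B ⊠ B → (C(𝕋) ⊠ B) ⊗ (C(𝕋) ⊠ B)`, where
`B = A_o(V, π, ω)`, the braided comultiplication `ΔB` is given by
`ΔB (u i k) = ∑ l, j₁ (u i l) * j₂ (u l k)`, and `ψ (j₁ z) = j₁ z ⊗ j₁ z`,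
`ψ (j₂ b) = (j₂ ⊗ j₁) (β b)`, `ψ (j₃ b) = 1 ⊗ j₂ b`; here `β b = b ⊗ z ^ m` if `b` is homogeneous
of degree `m`. -/
def IsComul (Δ : R.bosonisation →⋆ₐ[ℂ] spatialTensor R.bosonisation R.bosonisation) : Prop :=
  ∃ (ΔB : P.Ao →⋆ₐ[ℂ] R.square) (Θ : R.bosonisation →⋆ₐ[ℂ] R.triple)
    (ψ : R.triple →⋆ₐ[ℂ] spatialTensor R.bosonisation R.bosonisation),
    (∀ i k, ΔB (P.u i k) = ∑ l, R.sq₁ (P.u i l) * R.sq₂ (P.u l k)) ∧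
    (∀ a, Θ (R.fromCircle a) = R.leg₁ a) ∧
    (∀ b, Θ (R.fromAo b) = R.leg₂₃ (ΔB b)) ∧
    ψ (R.leg₁ circleGen) = tmul (R.fromCircle circleGen) (R.fromCircle circleGen) ∧
    (∀ (b : P.Ao) (m : ℤ), (∀ z : Circle, P.β z b = ((z ^ m : Circle) : ℂ) • b) →
      ψ (R.leg₂₃ (R.sq₁ b)) =
        tmul (R.fromAo b) (R.fromCircle ((circleGen ^ m : unitary circleAlgebra)))) ∧
    (∀ b : P.Ao, ψ (R.leg₂₃ (R.sq₂ b)) = tmul 1 (R.fromAo b)) ∧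
    Δ = ψ.comp Θ

/-- The power `z ^ k` in the bosonisation. -/
noncomputable def zpow (k : ℤ) : R.bosonisation :=
  R.fromCircle ((circleGen ^ k : unitary circleAlgebra))

/-- The matrix `t` over the bosonisation with entries `t h i = z ^ deg h * u h i`. -/
noncomputable def t : Matrix (Fin n) (Fin n) R.bosonisation :=
  Matrix.of fun h i => R.zpow (P.deg h) * R.fromAo (P.u h i)

/-- The direct sum `z ⊕ t`. -/
noncomputable def zt : Matrix (Unit ⊕ Fin n) (Unit ⊕ Fin n) R.bosonisation :=
  Matrix.fromBlocks (Matrix.of fun _ _ => R.zpow 1) 0 0 R.t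

end FaithfulRep

/-- The matrix `F` with entries `F i j = ζ ^ (d * deg j) * ω j i`. -/
noncomputable def F : Matrix (Fin n) (Fin n) ℂ :=
  Matrix.of fun i j => P.ζpow (P.d * P.deg j) * P.ω j i

end BraidedDatum

/-! In the Fourier basis of `L²(𝕋)`, an element of `C = C(𝕋) ⊠ B` is a block matrix over `B`: `z`
shifts the blocks, and `b` is block diagonal with entries `β_{ζ^k}(b)`. Hence `b z^l = z^l
β_{ζ^l}(b)`, and `z` together with the `u i k` generates `C`. Since `u h i = z^{-deg h} t h i`, so
do the coefficients of `z ⊕ t`.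

The comultiplication needs three maps. The universal property of `B` gives `ΔB`, because homogeneity
of `ω` lets all braiding phases in the invariance relation cancel (`relations_comul`). The map `id ⊠
ΔB` exists by a norm comparison: the norm of a block matrix is the supremum over its finite blocks,
the given faithful representation is isometric on matrices over `B`, and any other representation is
contractive (`norm_le_norm_of_blocks`, `exists_id_braided_comul`). Finally, `ψ` is an amplification
followed by conjugation with an explicit monomial unitary (`unfoldUnitary`). Uniqueness holds
because the defining conditions fix `Δ` on generators.

Unitarity of `t` is unitarity of `u`, and `t F = z^d F t̄` is the invariance of `ω` after powers of
`z` are moved past `u*`. The hypothesis on `ω` makes `F` invertible, so `t̄ = F⁻¹ z^{-d} t F` is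
invertible too.

The hard part is the coinverse, which should send `u h i` to `(t i h)* z^{deg h}`. It need not be
bounded or *-preserving, so the universal property does not give it directly. Put `N = Fᵀ F̄` and
`A(s) = N^{-(1/2 + i s)}`. The hypothesis on `ω` makes `F F*` a positive multiple of `N⁻¹`
(`exists_mul_conjTranspose_F`). Then, for real `s`, the matrix `A(s) t* A(s)⁻¹`, with row `h`
multiplied on the right by `z^{deg h}`, satisfies the relations of `B` in the opposite algebra
(`relations_twist`). This gives *-homomorphisms `ρ_s : B → Cᵒᵖ`. On polynomials in the generators,
`s ↦ ρ_s(b)` extends to an entire function. Its value at `s = i/2`, where `A(s) = 1`, is the wanted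
element. By the identity theorem this value depends on `b` only, not on the polynomial that
represents it (`Continues.unique`). With `z^k ↦ z^{-k}` this gives an antimultiplicative map on the
algebra of coefficients; the coefficients `b_k` in `∑ z^k b_k` are unique, because they can be read
off from one block column. -/

/-! ## Basis vectors, rows and elementary tensors -/

namespace L2

variable {ι κ : Type*}

open scoped Classical in
/-- The basis vector `i`. -/
noncomputable def single (i : ι) : L2 ι :=
  mk (fun j => if j = i then 1 else 0)
    (summable_of_ne_finset_zero (s := {i}) fun j hj => by simp [Finset.mem_singleton.not.1 hj])

theorem single_apply [DecidableEq ι] (i j : ι) : single i j = if j = i then 1 else 0 := by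
  rw [single, mk_apply]
  congr

theorem hasSum_single (f : L2 ι) : HasSum (fun i => f i • single i) f := by
  classical
  have h := lp.hasSum_single (p := 2) (by norm_num) (show lp (fun _ : ι => ℂ) 2 from f)
  have h2 : (fun i => f i • single i) = fun i => (lp.single 2 i (f i) : lp (fun _ : ι => ℂ) 2) := by
    funext i
    refine L2.ext fun j => Eq.trans ?_ (lp.single_apply (E := fun _ : ι => ℂ) 2 i (f i) j).symm
    rw [smul_apply, single_apply, Pi.single_apply]
    split_ifs with hj
    · subst hj; exact mul_one _
    · rw [mul_zero]
  rw [h2]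
  exact h

theorem inner_single (i : ι) (f : L2 ι) : inner ℂ (single i) f = f i := by
  classical
  rw [inner_eq_tsum, tsum_eq_single i fun j hj => by simp [single_apply, hj]]
  simp [single_apply]

/-- The row `f (i, ·)`. -/
def row (f : L2 (ι × κ)) (i : ι) : L2 κ :=
  mk (fun k => f (i, k))
    (f.summable_sq.comp_injective (i := fun k : κ => (i, k)) fun _ _ h => congrArg Prod.snd h)

@[simp] theorem row_apply (f : L2 (ι × κ)) (i : ι) (k : κ) : row f i k = f (i, k) := rfl

theorem summable_tens (ξ : L2 ι) (η : L2 κ) : Summable fun k => ‖η k • ξ‖ ^ 2 := by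
  simpa only [norm_smul, mul_pow] using η.summable_sq.mul_right (‖ξ‖ ^ 2)

/-- The elementary tensor of two vectors. -/
noncomputable def tens (ξ : L2 ι) (η : L2 κ) : L2 (ι × κ) := ofSlices (fun k => η k • ξ) (summable_tens ξ η)

@[simp] theorem tens_apply (ξ : L2 ι) (η : L2 κ) (q : ι × κ) : tens ξ η q = ξ q.1 * η q.2 :=
  mul_comm _ _

theorem slice_tens (ξ : L2 ι) (η : L2 κ) (k : κ) : (tens ξ η).slice k = η k • ξ := rfl

theorem row_tens (ξ : L2 ι) (η : L2 κ) (i : ι) : (tens ξ η).row i = ξ i • η := by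
  ext k; simp

theorem single_prod (q : ι × κ) : single q = tens (single q.1) (single q.2) := by
  classical
  ext r
  simp only [tens_apply, single_apply, Prod.ext_iff]
  split_ifs <;> simp_all

theorem monomial_apply (e : ι ≃ κ) (c : ι → Circle) (f : L2 ι) (k : κ) :
    monomial e c f k = (c (e.symm k) : ℂ) * f (e.symm k) := rfl

theorem monomial_symm_apply (e : ι ≃ κ) (c : ι → Circle) (g : L2 κ) (i : ι) :
    (monomial e c).symm g i = ((c i)⁻¹ : Circle) * g (e i) := rfl

end L2

namespace Op

variable {ι κ : Type*}

@[simp] theorem mul_apply (x y : Op ι) (f : L2 ι) : (x * y) f = x (y f) := rfl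

@[simp] theorem one_apply (f : L2 ι) : (1 : Op ι) f = f := rfl

@[simp] theorem smul_apply (c : ℂ) (x : Op ι) (f : L2 ι) : (c • x) f = c • x f := rfl

theorem map_smul' (x : Op ι) (c : ℂ) (f : L2 ι) : x (c • f) = c • x f := x.toCLM.map_smul c f

theorem continuous_apply (x : Op ι) : Continuous fun f : L2 ι => x f := x.toCLM.continuous

theorem ext_single {x y : Op ι} (h : ∀ i, x (L2.single i) = y (L2.single i)) : x = y := by
  ext1 f
  have hx := (L2.hasSum_single f).mapL x.toCLM
  have hy := (L2.hasSum_single f).mapL y.toCLM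
  have h2 : (fun i => x.toCLM (f i • L2.single i)) = fun i => y.toCLM (f i • L2.single i) :=
    funext fun i => (map_smul' x _ _).trans ((congrArg _ (h i)).trans (map_smul' y _ _).symm)
  rw [h2] at hx
  exact hx.unique hy

theorem ext_tens {x y : Op (ι × κ)} (h : ∀ ξ η, x (L2.tens ξ η) = y (L2.tens ξ η)) : x = y :=
  ext_single fun q => by rw [L2.single_prod, h]

theorem amp_tens (x : Op ι) (ξ : L2 ι) (η : L2 κ) :
    amp κ x (L2.tens ξ η) = L2.tens (x ξ) η := by
  ext q
  rw [amp_apply, L2.slice_tens, map_smul', L2.tens_apply, L2.smul_apply, mul_comm]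

theorem ampRight_apply (y : Op κ) (f : L2 (ι × κ)) (q : ι × κ) :
    ampRight ι y f q = y (f.row q.1) q.2 := by
  change L2.monomial (Equiv.prodComm κ ι) 1
    (amp ι y ((L2.monomial (Equiv.prodComm κ ι) 1).symm f)) q = _
  rw [L2.monomial_apply, amp_apply, Pi.one_apply, Circle.coe_one, one_mul]
  congr 2
  ext k
  rw [L2.slice_apply, L2.monomial_symm_apply, Pi.one_apply, inv_one, Circle.coe_one, one_mul]
  rfl

theorem ampRight_tens (y : Op κ) (ξ : L2 ι) (η : L2 κ) :
    ampRight ι y (L2.tens ξ η) = L2.tens ξ (y η) := by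
  ext q
  rw [ampRight_apply, L2.row_tens, map_smul', L2.tens_apply, L2.smul_apply]

theorem commute_amp_ampRight (x : Op ι) (y : Op κ) : Commute (amp κ x) (ampRight ι y) :=
  ext_tens fun ξ η => by simp only [mul_apply, ampRight_tens, amp_tens]

/-- On row `i` the braiding multiplies the basis vector `k` by `(ζ^{deg₁ i})^{deg₂ k}`. So the
braided copy of `y` acts there as `y` rotated by the circle element `ζ^{deg₁ i}`. -/
theorem secondLeg_apply (ζ : Circle) (deg₁ : ι → ℤ) (deg₂ : κ → ℤ) (y : Op κ) (f : L2 (ι × κ))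
    (q : ι × κ) : secondLeg ζ deg₁ deg₂ y f q =
      conj (circleRep deg₂ (ζ ^ deg₁ q.1)) y (f.row q.1) q.2 := by
  change L2.monomial (Equiv.prodComm κ ι) (fun q => ζ ^ (deg₂ q.1 * deg₁ q.2))
      (amp ι y ((L2.monomial (Equiv.prodComm κ ι) fun q => ζ ^ (deg₂ q.1 * deg₁ q.2)).symm f)) q =
    L2.monomial (Equiv.refl κ) (fun k => (ζ ^ deg₁ q.1) ^ deg₂ k)
      (y ((L2.monomial (Equiv.refl κ) fun k => (ζ ^ deg₁ q.1) ^ deg₂ k).symm (f.row q.1))) q.2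
  rw [L2.monomial_apply, L2.monomial_apply, amp_apply]
  have h : ∀ k, ζ ^ (deg₂ k * deg₁ q.1) = (ζ ^ deg₁ q.1) ^ deg₂ k := fun k => by
    rw [← zpow_mul, mul_comm]
  congr 1
  · exact congrArg _ (h q.2)
  · congr 2
    ext k
    rw [L2.slice_apply, L2.monomial_symm_apply, L2.monomial_symm_apply, ← h]
    rfl

/-! ### Homogeneous operators and the braided second leg -/

/-- The operator `x` is homogeneous of degree `m`. -/
def Homog (deg : ι → ℤ) (m : ℤ) (x : Op ι) : Prop :=
  ∀ z : Circle, conj (circleRep deg z) x = ((z ^ m : Circle) : ℂ) • x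

/-- The unitary `circleRep deg z` as an element of the C*-algebra of operators. -/
noncomputable def circleOp (deg : ι → ℤ) (z : Circle) : Op ι :=
  (circleRep deg z : L2 ι →L[ℂ] L2 ι)

theorem circleOp_apply (deg : ι → ℤ) (z : Circle) (f : L2 ι) (i : ι) :
    circleOp deg z f i = ((z ^ deg i : Circle) : ℂ) * f i := rfl

theorem conj_circleRep_mul_circleOp (deg : ι → ℤ) (z : Circle) (x : Op ι) :
    conj (circleRep deg z) x * circleOp deg z = circleOp deg z * x := by
  ext1 f
  exact congrArg (fun g => circleRep deg z (x g)) ((circleRep deg z).symm_apply_apply f)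

theorem Homog.circleOp_mul {deg : ι → ℤ} {m : ℤ} {x : Op ι} (h : Homog deg m x) (z : Circle) :
    circleOp deg z * x = ((z ^ m : Circle) : ℂ) • (x * circleOp deg z) := by
  rw [← conj_circleRep_mul_circleOp, h, smul_mul_assoc]

theorem Homog.secondLeg_apply {deg₁ : ι → ℤ} {deg₂ : κ → ℤ} {m : ℤ} {y : Op κ}
    (h : Homog deg₂ m y) (ζ : Circle) (f : L2 (ι × κ)) (q : ι × κ) :
    secondLeg ζ deg₁ deg₂ y f q = ((ζ ^ (m * deg₁ q.1) : Circle) : ℂ) * y (f.row q.1) q.2 := by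
  rw [Op.secondLeg_apply, h, smul_apply, L2.smul_apply, ← zpow_mul, mul_comm m]

/-- For homogeneous `y` the rotation in each row is a scalar, so the braided leg is an ordinary
elementary tensor with a diagonal unitary in the first factor. The braided commutation relations
follow from this form. -/
theorem Homog.secondLeg_eq {deg₁ : ι → ℤ} {deg₂ : κ → ℤ} {m : ℤ} {y : Op κ}
    (h : Homog deg₂ m y) (ζ : Circle) :
    secondLeg ζ deg₁ deg₂ y = amp κ (circleOp deg₁ (ζ ^ m)) * ampRight ι y := by
  ext f q
  rw [h.secondLeg_apply, mul_apply, amp_apply, circleOp_apply, L2.slice_apply, ampRight_apply,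
    zpow_mul]

theorem Homog.secondLeg_mul_amp {deg₁ : ι → ℤ} {deg₂ : κ → ℤ} {m m' : ℤ} {x : Op ι} {y : Op κ}
    (hx : Homog deg₁ m x) (hy : Homog deg₂ m' y) (ζ : Circle) :
    secondLeg ζ deg₁ deg₂ y * amp κ x =
      ((ζ ^ (m' * m) : Circle) : ℂ) • (amp κ x * secondLeg ζ deg₁ deg₂ y) := by
  rw [hy.secondLeg_eq, mul_assoc, ← (commute_amp_ampRight x y).eq, ← mul_assoc, ← map_mul,
    hx.circleOp_mul, map_smul, map_mul, smul_mul_assoc, mul_assoc, zpow_mul]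

theorem Homog.star {deg : ι → ℤ} {m : ℤ} {x : Op ι} (h : Homog deg m x) :
    Homog deg (-m) (star x) := fun z => by
  rw [map_star, h, star_smul, zpow_neg, Circle.coe_inv_eq_conj]
  rfl

/-- A homogeneous operator of degree `m` maps vectors of degree `l` to vectors of degree
`l + m`. -/
theorem Homog.apply_congr {deg : ι → ℤ} {m : ℤ} {x : Op ι} (h : Homog deg m x) {f g : L2 ι}
    {i : ι} (hfg : ∀ j, deg j = deg i - m → f j = g j) : x f i = x g i := by
  -- The coordinate `x f i` is the inner product of `x* e_i` with `f`, and `x* e_i` is supported in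
  -- degree `deg i - m`.
  have hv : ∀ j, deg j ≠ deg i - m → (Star.star x) (L2.single i) j = 0 := fun j hj => by
    classical
    -- With `k ≠ 0` the difference of the two exponents, `z = exp(iπ/k)` has `z ^ k = -1`, which
    -- separates the two degrees.
    obtain ⟨z, hz⟩ : ∃ z : Circle, z ^ (deg j) ≠ z ^ (deg i - m) := by
      have h0 : ((deg j - (deg i - m) : ℤ) : ℝ) ≠ 0 := Int.cast_ne_zero.2 (sub_ne_zero.2 hj)
      refine ⟨Circle.exp (Real.pi / (deg j - (deg i - m) : ℤ)), fun he => ?_⟩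
      rw [← mul_inv_eq_one, ← zpow_sub, ← Circle.exp_intCast_mul, mul_div_cancel₀ _ h0] at he
      have := congrArg (fun z : Circle => (z : ℂ)) he
      norm_num [Circle.coe_exp] at this
    have h1 := congrArg (fun y : Op ι => y (L2.single i) j) (h.star.circleOp_mul z)
    have h2 : circleOp deg z (L2.single i) = ((z ^ deg i : Circle) : ℂ) • L2.single i := by
      ext k
      rw [circleOp_apply, L2.smul_apply, L2.single_apply]
      split_ifs with hk
      · rw [hk]
      · simp
    simp only [mul_apply, smul_apply, L2.smul_apply, circleOp_apply, h2, map_smul'] at h1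
    rw [← mul_assoc, ← Circle.coe_mul, ← zpow_add, neg_add_eq_sub] at h1
    by_contra h0
    exact hz (Circle.ext (mul_right_cancel₀ h0 h1))
  rw [← L2.inner_single, ← L2.inner_single i (x g), ← inner_star_left, ← inner_star_left,
    L2.inner_eq_tsum, L2.inner_eq_tsum]
  refine tsum_congr fun j => ?_
  by_cases hj : deg j = deg i - m
  · rw [hfg j hj]
  · rw [hv j hj, inner_zero_left, inner_zero_left]

end Op

/-! ## Block matrices of operators -/

namespace Op

variable {ι κ μ : Type*}

/-- The matrix unit that maps the basis vector `q` to the basis vector `p`. -/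
noncomputable def unit (p q : ι) : Op ι :=
  InnerProductSpace.rankOne ℂ (L2.single p) (L2.single q)

theorem unit_apply (p q : ι) (f : L2 ι) : unit p q f = f q • L2.single p :=
  congrArg (· • L2.single p) (L2.inner_single q f)

theorem unit_mul_unit [DecidableEq ι] (p q r s : ι) :
    unit p q * unit r s = if q = r then unit p s else 0 := by
  ext1 f
  rw [mul_apply, unit_apply, unit_apply, L2.smul_apply, L2.single_apply]
  split_ifs
  · rw [mul_one, unit_apply]
  · rw [mul_zero, zero_smul]; rfl

theorem star_unit (p q : ι) : star (unit p q) = unit q p :=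
  InnerProductSpace.adjoint_rankOne (𝕜 := ℂ) (L2.single p) (L2.single q)

/-- The operator with block `a` at the position `(p, q)`. -/
noncomputable def block (p q : ι) (a : Op κ) : Op (ι × κ) := amp κ (unit p q) * ampRight ι a

theorem block_mul_block [DecidableEq ι] (p q r s : ι) (a b : Op κ) :
    block p q a * block r s b = if q = r then block p s (a * b) else 0 := by
  unfold block
  rw [mul_assoc, ← mul_assoc (ampRight ι a), ← (commute_amp_ampRight (unit r s) a).eq,
    mul_assoc, ← mul_assoc, ← map_mul, ← map_mul, unit_mul_unit]
  split_ifs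
  · rfl
  · rw [map_zero, zero_mul]

theorem star_block (p q : ι) (a : Op κ) : star (block p q a) = block q p (star a) := by
  unfold block
  rw [star_mul, ← map_star, ← map_star, star_unit, (commute_amp_ampRight _ _).eq]

theorem block_add (p q : ι) (a b : Op κ) : block p q (a + b) = block p q a + block p q b := by
  unfold block; rw [map_add, mul_add]

theorem block_smul (p q : ι) (c : ℂ) (a : Op κ) : block p q (c • a) = c • block p q a := by
  unfold block; rw [map_smul, mul_smul_comm]

theorem block_zero (p q : ι) : block p q (0 : Op κ) = 0 := by
  unfold block; rw [map_zero, mul_zero]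

theorem block_sum {ν : Type*} (p q : ι) (s : Finset ν) (a : ν → Op κ) :
    block p q (∑ i ∈ s, a i) = ∑ i ∈ s, block p q (a i) := by
  unfold block; rw [map_sum, Finset.mul_sum]

theorem block_tens (p q : ι) (a : Op κ) (ξ : L2 ι) (η : L2 κ) :
    block p q a (L2.tens ξ η) = L2.tens (ξ q • L2.single p) (a η) := by
  rw [block, mul_apply, ampRight_tens, amp_tens, unit_apply]

theorem block_injective (p q : ι) : Function.Injective (block p q : Op κ → Op (ι × κ)) := by
  intro a b h
  ext η k
  classical
  have := congrArg (fun x : Op (ι × κ) => x (L2.tens (L2.single q) η) (p, k)) h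
  simpa [block_tens, L2.single_apply] using this

/-- Finite block matrices of operators, as operators. -/
noncomputable def ofBlocks [DecidableEq ι] (s : Finset ι) :
    CStarMatrix s s (Op κ) →⋆ₙₐ[ℂ] Op (ι × κ) where
  toFun M := ∑ p : s, ∑ q : s, block (p : ι) (q : ι) (M p q)
  map_smul' c M := by
    simp only [CStarMatrix.smul_apply, block_smul, Finset.smul_sum, MonoidHom.id_apply]
  map_zero' := by
    simp only [CStarMatrix.zero_apply, block_zero, Finset.sum_const_zero]
  map_add' M N := by
    simp only [CStarMatrix.add_apply, block_add, Finset.sum_add_distrib]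
  map_mul' M N := by
    simp only [CStarMatrix.mul_apply, block_sum, Finset.sum_mul]
    simp only [Finset.mul_sum, block_mul_block, Subtype.coe_inj]
    refine Finset.sum_congr rfl fun p _ => Finset.sum_comm.trans (Finset.sum_congr rfl fun r _ => ?_)
    rw [Finset.sum_comm]
    refine Finset.sum_congr rfl fun q _ => ?_
    rw [Finset.sum_ite_eq, if_pos (Finset.mem_univ r)]
  map_star' M := by
    simp only [star_sum, star_block, CStarMatrix.star_apply]
    exact Finset.sum_comm

theorem block_one_mul_ofBlocks_mul [DecidableEq ι] (s : Finset ι) (M : CStarMatrix s s (Op κ))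
    (p q : s) : block (p : ι) p 1 * ofBlocks s M * block (q : ι) q 1 = block (p : ι) (q : ι) (M p q) := by
  change block (p : ι) p 1 * (∑ p : s, ∑ q : s, block (p : ι) (q : ι) (M p q)) *
    block (q : ι) q 1 = block (p : ι) (q : ι) (M p q)
  simp only [Finset.sum_mul, Finset.mul_sum, block_mul_block, ite_mul, zero_mul, Subtype.coe_inj,
    mul_one, one_mul]
  rw [Finset.sum_eq_single p (fun r _ hr => by simp [hr.symm]) (by simp)]
  simp

theorem ofBlocks_injective [DecidableEq ι] (s : Finset ι) :
    Function.Injective (ofBlocks s : CStarMatrix s s (Op κ) →⋆ₙₐ[ℂ] Op (ι × κ)) := by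
  intro M N h
  refine CStarMatrix.ext fun p q => ?_
  apply block_injective (p : ι) (q : ι)
  rw [← block_one_mul_ofBlocks_mul, h, block_one_mul_ofBlocks_mul]

/-! ### Norms through finite blocks -/

/-- The projection onto the rows with index in `s`. -/
noncomputable def rowProj (κ : Type*) (s : Finset ι) : Op (ι × κ) := ∑ p ∈ s, block p p 1

/-- From `p* p = p` and the C*-identity, `‖p‖² = ‖p‖`. -/
theorem norm_rowProj_le [DecidableEq ι] (s : Finset ι) : ‖rowProj κ s‖ ≤ 1 := by
  have h1 : star (rowProj κ s) * rowProj κ s = rowProj κ s := by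
    simp only [rowProj, star_sum, star_block, star_one, Finset.sum_mul, Finset.mul_sum,
      block_mul_block, one_mul, Finset.sum_ite_eq']
    exact Finset.sum_congr rfl fun p hp => if_pos hp
  have h2 := CStarRing.norm_star_mul_self (x := rowProj κ s)
  rw [h1] at h2
  nlinarith [norm_nonneg (rowProj κ s)]

theorem rowProj_single [DecidableEq ι] {s : Finset ι} {q : ι × κ} (hq : q.1 ∈ s) :
    rowProj κ s (L2.single q) = L2.single q := by
  have : ∀ t : Finset ι, rowProj κ t (L2.single q) =
      ∑ p ∈ t, (if p = q.1 then L2.single q else 0) := fun t => by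
    induction t using Finset.induction_on with
    | empty => rfl
    | insert p t hp ih =>
      rw [Finset.sum_insert hp, ← ih, rowProj, Finset.sum_insert hp]
      change block p p 1 (L2.single q) + _ = _
      congr 1
      rw [L2.single_prod, block_tens, L2.single_apply]
      split_ifs with h
      · rw [one_smul, h]; rfl
      · ext; simp
  rw [this, Finset.sum_ite_eq', if_pos hq]

theorem norm_le_of_forall_inner_le {x : Op ι} {C : ℝ} (hC : 0 ≤ C)
    (h : ∀ f g : L2 ι, ‖(inner ℂ g (x f) : ℂ)‖ ≤ C * ‖g‖ * ‖f‖) : ‖x‖ ≤ C := by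
  refine ContinuousLinearMap.opNorm_le_bound x.toCLM hC fun f => ?_
  have h1 := h f (x f)
  rw [inner_self_eq_norm_sq_to_K] at h1
  rcases (norm_nonneg (x f)).eq_or_lt with h0 | h0
  · exact h0.symm.le.trans (by positivity)
  · refine le_of_mul_le_mul_right ?_ h0
    norm_num at h1
    change ‖x f‖ * ‖x f‖ ≤ _
    nlinarith

/-- The norm of an operator is the supremum of the norms of its finite blocks. -/
theorem norm_le_of_forall_rowProj [DecidableEq ι] {x : Op (ι × κ)} {C : ℝ} (hC : 0 ≤ C)
    (h : ∀ s : Finset ι, ‖rowProj κ s * x * rowProj κ s‖ ≤ C) : ‖x‖ ≤ C := by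
  refine norm_le_of_forall_inner_le hC fun f g => ?_
  -- Finite truncations of a vector are fixed by the projection onto the rows they meet. One common
  -- index set `t` for both vectors makes the same projection serve on both sides of `x`.
  let F : L2 (ι × κ) → Finset (ι × κ) → L2 (ι × κ) := fun f t => ∑ q ∈ t, f q • L2.single q
  have hF : ∀ f, Filter.Tendsto (F f) Filter.atTop (nhds f) := fun f => L2.hasSum_single f
  have hP : ∀ f t, rowProj κ (t.image Prod.fst) (F f t) = F f t := fun f t => by
    change (rowProj κ (t.image Prod.fst)).toCLM (F f t) = F f t
    rw [map_sum]
    refine Finset.sum_congr rfl fun q hq => ?_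
    rw [map_smul]
    exact congrArg _ (rowProj_single (Finset.mem_image_of_mem _ hq))
  have hs : ∀ s : Finset ι, star (rowProj κ s) = rowProj κ s := fun s => by
    simp only [rowProj, star_sum, star_block, star_one]
  have hb : ∀ t, ‖(inner ℂ (F g t) (x (F f t)) : ℂ)‖ ≤ C * ‖F g t‖ * ‖F f t‖ := fun t => by
    have : (inner ℂ (F g t) (x (F f t)) : ℂ) = inner ℂ (F g t)
        ((rowProj κ (t.image Prod.fst) * x * rowProj κ (t.image Prod.fst)) (F f t)) := by
      rw [mul_apply, mul_apply, hP, ← inner_star_left (rowProj κ _), hs, hP]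
    rw [this]
    refine (norm_inner_le_norm _ _).trans ?_
    rw [mul_comm C, mul_assoc ‖F g t‖]
    exact mul_le_mul_of_nonneg_left ((le_opNorm _ _).trans
      (mul_le_mul_of_nonneg_right (h _) (norm_nonneg _))) (norm_nonneg _)
  refine le_of_tendsto_of_tendsto' (((hF g).inner (((continuous_apply x).tendsto f).comp (hF f)))).norm
    (((hF g).norm.const_mul C).mul (hF f).norm) hb

theorem rowProj_mul_mul_rowProj [DecidableEq ι] (s : Finset ι) (x : Op (ι × κ)) :
    rowProj κ s * x * rowProj κ s =
      ∑ p : s, ∑ q : s, block (p : ι) (p : ι) 1 * x * block (q : ι) (q : ι) 1 := by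
  rw [rowProj, ← Finset.sum_coe_sort, Finset.sum_mul, Finset.sum_mul]
  simp only [Finset.mul_sum]

/-- If the blocks of `x` and `y` are the images of the same elements under an injective
*-homomorphism and a *-homomorphism, then `y` is dominated by `x`. -/
theorem norm_le_norm_of_blocks {B : Type*} [CStarAlgebra B] {σ : B →⋆ₐ[ℂ] Op κ}
    (hσ : Function.Injective σ) (φ : B →⋆ₐ[ℂ] Op μ) {x : Op (ι × κ)} {y : Op (ι × μ)}
    (h : ∀ p q : ι, ∃ b : B, block p p 1 * x * block q q 1 = block p q (σ b) ∧
      block p p 1 * y * block q q 1 = block p q (φ b)) : ‖y‖ ≤ ‖x‖ := by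
  classical
  choose c hx hy using h
  refine norm_le_of_forall_rowProj (norm_nonneg x) fun s => ?_
  let _ := CStarAlgebra.spectralOrder B
  let _ := CStarAlgebra.spectralOrderedRing B
  let _ := CStarAlgebra.spectralOrder (Op κ)
  let _ := CStarAlgebra.spectralOrderedRing (Op κ)
  let _ := CStarAlgebra.spectralOrder (Op μ)
  let _ := CStarAlgebra.spectralOrderedRing (Op μ)
  let M : CStarMatrix s s B := CStarMatrix.ofMatrix fun p q => c p q
  have h1 : ‖rowProj κ s * x * rowProj κ s‖ ≤ ‖x‖ := by
    refine (norm_mul_le _ _).trans ((mul_le_of_le_one_right (norm_nonneg _)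
      (norm_rowProj_le s)).trans ((norm_mul_le _ _).trans
      (mul_le_of_le_one_left (norm_nonneg _) (norm_rowProj_le s))))
  refine le_trans ?_ h1
  have hσM : rowProj κ s * x * rowProj κ s =
      ((ofBlocks s).comp (CStarMatrix.mapₙₐ (σ : B →⋆ₙₐ[ℂ] Op κ))) M := by
    rw [rowProj_mul_mul_rowProj]
    simp only [hx]
    rfl
  have hφM : rowProj μ s * y * rowProj μ s =
      ((ofBlocks s).comp (CStarMatrix.mapₙₐ (φ : B →⋆ₙₐ[ℂ] Op μ))) M := by
    rw [rowProj_mul_mul_rowProj]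
    simp only [hy]
    rfl
  -- Both compressions are images of the same matrix over `B`. The map built from `σ` is an
  -- injective *-homomorphism, hence isometric; the one built from `φ` is contractive.
  rw [hσM, hφM, NonUnitalStarAlgHom.norm_map ((ofBlocks s).comp
    (CStarMatrix.mapₙₐ (σ : B →⋆ₙₐ[ℂ] Op κ)))
    ((ofBlocks_injective s).comp fun M N h => CStarMatrix.ext fun p q =>
      hσ (CStarMatrix.ext_iff.2 h p q))]
  exact NonUnitalStarAlgHom.norm_apply_le _ _

end Op

/-! ## *-homomorphisms of C*-algebras -/

theorem StarAlgHom.continuous_of_cstarAlgebra {A D : Type*} [CStarAlgebra A] [CStarAlgebra D]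
    (φ : A →⋆ₐ[ℂ] D) : Continuous φ :=
  AddMonoidHomClass.continuous_of_bound φ 1 fun x => by
    rw [one_mul]; exact NonUnitalStarAlgHom.norm_apply_le φ x

/-- A norm-decreasing relation between two C*-algebras extends to a *-homomorphism. -/
theorem StarSubalgebra.exists_starAlgHom_of_graph {A D : Type*} [CStarAlgebra A] [CStarAlgebra D]
    (T : StarSubalgebra ℂ (A × D)) (hT : ∀ p ∈ T, ‖p.2‖ ≤ ‖p.1‖) (X : StarSubalgebra ℂ A)
    (hX : X ≤ (T.map (StarAlgHom.fst ℂ A D)).topologicalClosure) :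
    ∃ φ : X →⋆ₐ[ℂ] D, ∀ p ∈ T, ∀ h : p.1 ∈ X, φ ⟨p.1, h⟩ = p.2 := by
  have hc : ∀ p ∈ T.topologicalClosure, ‖p.2‖ ≤ ‖p.1‖ := fun p hp =>
    closure_minimal (s := (T : Set (A × D))) (t := {p | ‖p.2‖ ≤ ‖p.1‖}) hT
      (isClosed_le (by fun_prop) (by fun_prop)) hp
  have huniq : ∀ a b₁ b₂, (a, b₁) ∈ T.topologicalClosure → (a, b₂) ∈ T.topologicalClosure →
      b₁ = b₂ := fun a b₁ b₂ h₁ h₂ => by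
    have := hc _ (sub_mem h₁ h₂)
    rw [Prod.mk_sub_mk, sub_self, norm_zero] at this
    exact sub_eq_zero.1 (norm_le_zero_iff.1 this)
  -- Domination of the second component makes the first projection an isometry on the closed graph,
  -- so its image is complete and therefore closed. The closed graph is thus defined on all of `X`.
  have hcl : IsClosed (Prod.fst '' (T.topologicalClosure : Set (A × D))) := by
    have : CompleteSpace T.topologicalClosure :=
      T.isClosed_topologicalClosure.completeSpace_coe
    have hanti : AntilipschitzWith 1 fun p : T.topologicalClosure => (p : A × D).1 :=
      AntilipschitzWith.of_le_mul_dist fun p q => by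
        have := hc _ (sub_mem p.2 q.2)
        rw [NNReal.coe_one, one_mul, Subtype.dist_eq, dist_eq_norm, dist_eq_norm, Prod.norm_def]
        exact max_le le_rfl this
    have huc : UniformContinuous fun p : T.topologicalClosure => (p : A × D).1 :=
      uniformContinuous_fst.comp uniformContinuous_subtype_val
    have := hanti.isClosed_range huc
    convert this using 1
    ext a
    simp [← SetLike.mem_coe]
  have hex : ∀ x : X, ∃ b, ((x : A), b) ∈ T.topologicalClosure := fun x => by
    have h1 : (x : A) ∈ closure (Prod.fst '' (T : Set (A × D))) := hX x.2
    have h2 := closure_minimal (Set.image_mono (subset_closure (s := (T : Set (A × D))))) hcl h1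
    obtain ⟨⟨a, b⟩, hab, rfl⟩ := h2
    exact ⟨b, hab⟩
  choose f hf using hex
  let φ : X →⋆ₐ[ℂ] D :=
    { toFun := f
      map_one' := huniq _ _ _ (hf 1) (one_mem _)
      map_mul' := fun x y => huniq _ _ _ (hf (x * y)) (mul_mem (hf x) (hf y))
      map_zero' := huniq _ _ _ (hf 0) (zero_mem _)
      map_add' := fun x y => huniq _ _ _ (hf (x + y)) (add_mem (hf x) (hf y))
      commutes' := fun c => huniq _ _ _ (hf (algebraMap ℂ X c)) (algebraMap_mem _ c)
      map_star' := fun x => huniq _ _ _ (hf (star x)) (star_mem (hf x)) }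
  exact ⟨φ, fun p hp h => huniq _ _ _ (hf ⟨p.1, h⟩) (T.le_topologicalClosure hp)⟩

noncomputable instance {ι κ : Type*} {ζ : Circle} {deg₁ : ι → ℤ} {deg₂ : κ → ℤ}
    {X : StarSubalgebra ℂ (Op ι)} {Y : StarSubalgebra ℂ (Op κ)} :
    CStarAlgebra (braidedTensor ζ deg₁ deg₂ X Y) :=
  StarSubalgebra.cstarAlgebra _ (h_closed := StarSubalgebra.isClosed_topologicalClosure _)

noncomputable instance {ι κ : Type*} {X : StarSubalgebra ℂ (Op ι)} {Y : StarSubalgebra ℂ (Op κ)} :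
    CStarAlgebra (spatialTensor X Y) :=
  StarSubalgebra.cstarAlgebra _ (h_closed := StarSubalgebra.isClosed_topologicalClosure _)

noncomputable instance : CStarAlgebra circleAlgebra :=
  StarSubalgebra.cstarAlgebra _ (h_closed := StarSubalgebra.isClosed_topologicalClosure _)

/-! ## Homogeneous operators -/

namespace Op

variable {ι κ : Type*}

theorem circleOp_mul_circleOp (deg : ι → ℤ) (z w : Circle) :
    circleOp deg z * circleOp deg w = circleOp deg (z * w) := by
  ext f i
  rw [mul_apply, circleOp_apply, circleOp_apply, circleOp_apply, mul_zpow, Circle.coe_mul,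
    mul_assoc]

theorem circleOp_one (deg : ι → ℤ) : circleOp deg 1 = 1 := by
  ext f i
  rw [circleOp_apply, one_zpow, Circle.coe_one, one_mul, one_apply]

theorem conj_circleRep (deg : ι → ℤ) (z : Circle) (x : Op ι) :
    conj (circleRep deg z) x = circleOp deg z * x * circleOp deg z⁻¹ := by
  rw [← conj_circleRep_mul_circleOp, mul_assoc, circleOp_mul_circleOp, mul_inv_cancel,
    circleOp_one, mul_one]

theorem circleOp_prod (deg₁ : ι → ℤ) (deg₂ : κ → ℤ) (z : Circle) :
    circleOp (fun q : ι × κ => deg₁ q.1 + deg₂ q.2) z =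
      amp κ (circleOp deg₁ z) * ampRight ι (circleOp deg₂ z) := by
  ext f q
  rw [mul_apply, amp_apply, circleOp_apply, circleOp_apply, L2.slice_apply, ampRight_apply,
    circleOp_apply, zpow_add, Circle.coe_mul, mul_assoc]
  rfl

theorem amp_mul_ampRight_mul (x x' : Op ι) (y y' : Op κ) :
    amp κ x * ampRight ι y * (amp κ x' * ampRight ι y') =
      amp κ (x * x') * ampRight ι (y * y') := by
  rw [map_mul, map_mul, (commute_amp_ampRight x' y).symm.mul_mul_mul_comm]

theorem conj_circleRep_mul_amp_ampRight (deg₁ : ι → ℤ) (deg₂ : κ → ℤ) (z : Circle) (x : Op ι)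
    (y : Op κ) : conj (circleRep (fun q : ι × κ => deg₁ q.1 + deg₂ q.2) z)
      (amp κ x * ampRight ι y) =
        amp κ (conj (circleRep deg₁ z) x) * ampRight ι (conj (circleRep deg₂ z) y) := by
  rw [conj_circleRep, conj_circleRep, conj_circleRep, circleOp_prod, circleOp_prod,
    amp_mul_ampRight_mul, amp_mul_ampRight_mul]

theorem Homog.mul {deg : ι → ℤ} {m l : ℤ} {x y : Op ι} (hx : Homog deg m x)
    (hy : Homog deg l y) : Homog deg (m + l) (x * y) := fun z => by
  rw [map_mul, hx, hy, smul_mul_smul_comm, zpow_add, Circle.coe_mul]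

theorem Homog.sum {α : Type*} {deg : ι → ℤ} {m : ℤ} {s : Finset α} {x : α → Op ι}
    (hx : ∀ a ∈ s, Homog deg m (x a)) : Homog deg m (∑ a ∈ s, x a) := fun z => by
  rw [map_sum, Finset.smul_sum]
  exact Finset.sum_congr rfl fun a ha => hx a ha z

theorem homog_circleOp (deg : ι → ℤ) (w : Circle) : Homog deg 0 (circleOp deg w) := fun z => by
  rw [conj_circleRep, circleOp_mul_circleOp, circleOp_mul_circleOp, mul_comm z,
    mul_inv_cancel_right, zpow_zero, Circle.coe_one, one_smul]

theorem Homog.amp {deg₁ : ι → ℤ} {m : ℤ} {x : Op ι} (hx : Homog deg₁ m x) (deg₂ : κ → ℤ) :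
    Homog (fun q : ι × κ => deg₁ q.1 + deg₂ q.2) m (amp κ x) := fun z => by
  have h := conj_circleRep_mul_amp_ampRight deg₁ deg₂ z x 1
  rw [map_one (conj _), map_one (ampRight ι), mul_one, mul_one] at h
  rw [h, hx, map_smul]

theorem Homog.secondLeg {deg₂ : κ → ℤ} {m : ℤ} {y : Op κ} (hy : Homog deg₂ m y) (ζ : Circle)
    (deg₁ : ι → ℤ) :
    Homog (fun q : ι × κ => deg₁ q.1 + deg₂ q.2) m (secondLeg ζ deg₁ deg₂ y) := fun z => by
  rw [hy.secondLeg_eq, conj_circleRep_mul_amp_ampRight, homog_circleOp, hy, zpow_zero,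
    Circle.coe_one, one_smul, map_smul, mul_smul_comm]

end Op

/-! ## The generators of `A_o(V, π, ω)` -/

namespace BraidedDatum

variable {n : ℕ} (P : BraidedDatum n)

theorem ζpow_add (k l : ℤ) : P.ζpow (k + l) = P.ζpow k * P.ζpow l := by
  rw [ζpow, zpow_add, Circle.coe_mul]; rfl

@[simp] theorem ζpow_zero : P.ζpow 0 = 1 := by rw [ζpow, zpow_zero, Circle.coe_one]

theorem ζpow_ne_zero (k : ℤ) : P.ζpow k ≠ 0 := Circle.coe_ne_zero _

theorem star_ζpow (k : ℤ) : star (P.ζpow k) = P.ζpow (-k) := by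
  rw [ζpow, ζpow, zpow_neg, Circle.coe_inv_eq_conj]; rfl

theorem ζpow_smul_ζpow_smul {D : Type*} [AddCommGroup D] [Module ℂ D] (k l : ℤ) (x : D) :
    P.ζpow k • P.ζpow l • x = P.ζpow (k + l) • x := by
  rw [smul_smul, ζpow_add]

/-- Two *-homomorphisms on `A_o(V, π, ω)` agree if they agree on the generators. -/
theorem hom_ext {D : Type*} [CStarAlgebra D] {φ ψ : P.Ao →⋆ₐ[ℂ] D}
    (h : ∀ i k, φ (P.u i k) = ψ (P.u i k)) : φ = ψ := by
  have h1 : φ.comp (CStarSeminorm.Completion.of P.maxSeminorm) =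
      ψ.comp (CStarSeminorm.Completion.of P.maxSeminorm) :=
    FreeStarAlgebra.hom_ext fun x => h x.1 x.2
  ext b
  refine CStarSeminorm.Completion.induction P.maxSeminorm b
    (isClosed_eq φ.continuous_of_cstarAlgebra ψ.continuous_of_cstarAlgebra) fun a => ?_
  exact congrArg (fun χ : P.Free →⋆ₐ[ℂ] D => χ a) h1

/-- A closed *-subalgebra of `A_o(V, π, ω)` that contains the generators is everything. -/
theorem mem_of_forall_u_mem {S : StarSubalgebra ℂ P.Ao} (hS : IsClosed (S : Set P.Ao))
    (h : ∀ i k, P.u i k ∈ S) (b : P.Ao) : b ∈ S := by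
  refine CStarSeminorm.Completion.induction P.maxSeminorm b hS fun a => ?_
  change CStarSeminorm.Completion.of P.maxSeminorm a ∈ S
  induction a using FreeStarAlgebra.induction with
  | algebraMap c => rw [AlgHomClass.commutes]; exact algebraMap_mem S c
  | gen x => exact h x.1 x.2
  | genStar x => rw [← FreeStarAlgebra.star_gen, map_star]; exact star_mem (h x.1 x.2)
  | mul a b ha hb => rw [map_mul]; exact mul_mem ha hb
  | add a b ha hb => rw [map_add]; exact add_mem ha hb

theorem β_u (z : Circle) (i k : Fin n) :
    P.β z (P.u i k) = ((z ^ (P.deg k - P.deg i) : Circle) : ℂ) • P.u i k :=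
  P.lift_u _ i k

theorem sum_ω_smul_u (i j : Fin n) : ∑ k, P.ω i k • P.u j k =
    P.ζpow (P.deg j * (P.d - P.deg j) - P.deg j * P.deg i) • ∑ k, P.ω k j • star (P.u k i) := by
  rw [sub_eq_neg_add, ζpow_add, mul_smul, ← P.relations_u.invariant, ζpow_smul_ζpow_smul,
    neg_add_cancel, ζpow_zero, one_smul]

theorem sum_ω_smul_star_u (i j : Fin n) : ∑ k, P.ω k j • star (P.u k i) =
    P.ζpow (P.deg j * P.deg i - P.deg j * (P.d - P.deg j)) • ∑ k, P.ω i k • P.u j k := by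
  rw [sum_ω_smul_u, ζpow_smul_ζpow_smul, sub_add_sub_cancel, sub_self, ζpow_zero, one_smul]

/-- The braided comultiplication preserves the relations of `A_o(V, π, ω)`. -/
theorem relations_comul {D : Type*} [Ring D] [StarRing D] [Algebra ℂ D] [StarModule ℂ D]
    (φ ψ : P.Ao →⋆ₐ[ℂ] D)
    (h : ∀ i j k l, ψ (star (P.u k l)) * φ (star (P.u i j)) =
      P.ζpow ((P.deg k - P.deg l) * (P.deg i - P.deg j)) •
        (φ (star (P.u i j)) * ψ (star (P.u k l)))) :
    P.Relations fun i k => ∑ l, φ (P.u i l) * ψ (P.u l k) where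
  isometry i j := by
    have h1 : ∀ l m, ∑ k, star (φ (P.u k l)) * φ (P.u k m) = if l = m then 1 else 0 :=
      (P.relations_u.map φ).isometry
    have h2 : ∑ l, star (ψ (P.u l i)) * ψ (P.u l j) = if i = j then 1 else 0 :=
      (P.relations_u.map ψ).isometry i j
    calc ∑ k, star (∑ l, φ (P.u k l) * ψ (P.u l i)) * ∑ m, φ (P.u k m) * ψ (P.u m j)
        = ∑ l, ∑ m, star (ψ (P.u l i)) * (∑ k, star (φ (P.u k l)) * φ (P.u k m)) *
            ψ (P.u m j) := by
          simp only [star_sum, star_mul, Finset.sum_mul_sum]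
          refine Finset.sum_comm.trans (Finset.sum_congr rfl fun l _ =>
            Finset.sum_comm.trans (Finset.sum_congr rfl fun m _ => ?_))
          simp only [Finset.mul_sum, Finset.sum_mul, mul_assoc]
      _ = if i = j then 1 else 0 := by
          simp only [h1, mul_ite, mul_one, mul_zero, ite_mul, zero_mul, Finset.sum_ite_eq,
            Finset.mem_univ, if_true, h2]
  coisometry i j := by
    have h1 : ∀ l m, ∑ k, ψ (P.u l k) * star (ψ (P.u m k)) = if l = m then 1 else 0 :=
      (P.relations_u.map ψ).coisometry
    have h2 : ∑ l, φ (P.u i l) * star (φ (P.u j l)) = if i = j then 1 else 0 :=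
      (P.relations_u.map φ).coisometry i j
    calc ∑ k, (∑ l, φ (P.u i l) * ψ (P.u l k)) * star (∑ m, φ (P.u j m) * ψ (P.u m k))
        = ∑ l, ∑ m, φ (P.u i l) * (∑ k, ψ (P.u l k) * star (ψ (P.u m k))) *
            star (φ (P.u j m)) := by
          simp only [star_sum, star_mul, Finset.sum_mul_sum]
          refine Finset.sum_comm.trans (Finset.sum_congr rfl fun l _ =>
            Finset.sum_comm.trans (Finset.sum_congr rfl fun m _ => ?_))
          simp only [Finset.mul_sum, Finset.sum_mul, mul_assoc]
      _ = if i = j then 1 else 0 := by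
          simp only [h1, mul_ite, mul_one, mul_zero, ite_mul, zero_mul, Finset.sum_ite_eq,
            Finset.mem_univ, if_true, h2]
  -- Invariance of the `ψ`-factor rewrites the left side, invariance of the `φ`-factor the right
  -- side. Both become combinations of the same products `φ(u) ψ(u*)` with the same entries of `ω`,
  -- and only powers of `ζ` remain to be compared.
  invariant i j := by
    simp only [star_sum, star_mul]
    have hL : ∀ l, φ (P.u j l) * ψ (∑ k, P.ω i k • P.u l k) =
        P.ζpow (P.deg l * (P.d - P.deg l) - P.deg l * P.deg i) •
          ∑ k, P.ω k l • (φ (P.u j l) * ψ (star (P.u k i))) := fun l => by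
      rw [P.sum_ω_smul_u, map_smul, map_sum, mul_smul_comm, Finset.mul_sum]
      simp only [map_smul, mul_smul_comm]
    have hR : ∀ l, φ (∑ k, P.ω k j • star (P.u k l)) * ψ (star (P.u l i)) =
        P.ζpow (P.deg j * P.deg l - P.deg j * (P.d - P.deg j)) •
          ∑ k, P.ω l k • (φ (P.u j k) * ψ (star (P.u l i))) := fun l => by
      rw [P.sum_ω_smul_star_u, map_smul, map_sum, smul_mul_assoc, Finset.sum_mul]
      simp only [map_smul, smul_mul_assoc]
    have hL' : ∑ k, P.ω i k • ∑ l, φ (P.u j l) * ψ (P.u l k) =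
        ∑ l, φ (P.u j l) * ψ (∑ k, P.ω i k • P.u l k) := by
      simp only [map_sum, map_smul, Finset.mul_sum, mul_smul_comm, Finset.smul_sum]
      exact Finset.sum_comm
    -- Taking adjoints puts the factors in the wrong order. The exchange costs a phase that involves
    -- `deg k`, but `ω k j ≠ 0` forces `deg k = d - deg j`, so the phase does not depend on `k`.
    have hR' : ∑ k, P.ω k j • ∑ l, star (ψ (P.u l i)) * star (φ (P.u k l)) =
        ∑ l, P.ζpow ((P.deg l - P.deg i) * (P.d - P.deg j - P.deg l)) •
          (φ (∑ k, P.ω k j • star (P.u k l)) * ψ (star (P.u l i))) := by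
      simp only [map_sum, map_smul, Finset.sum_mul, smul_mul_assoc, Finset.smul_sum]
      rw [Finset.sum_comm]
      refine Finset.sum_congr rfl fun l _ => Finset.sum_congr rfl fun k _ => ?_
      by_cases h0 : P.ω k j = 0
      · simp [h0]
      · rw [← map_star, ← map_star, h, smul_comm, ← P.homogeneous k j h0, add_sub_cancel_right]
    rw [hL', hR']
    simp only [hL, hR, Finset.smul_sum]
    rw [Finset.sum_comm]
    refine Finset.sum_congr rfl fun l _ => Finset.sum_congr rfl fun k _ => ?_
    by_cases h0 : P.ω l k = 0
    · simp [h0]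
    · simp only [ζpow_smul_ζpow_smul]
      congr 2
      rw [← P.homogeneous l k h0]
      ring

end BraidedDatum

/-! ## Generators of the concrete C*-algebras -/

/-- A closed *-subalgebra of a C*-algebra generated by `s` that contains `s` is everything. -/
theorem StarSubalgebra.mem_of_closure_adjoin {A : Type*} [CStarAlgebra A] {s : Set A}
    {S : StarSubalgebra ℂ (StarAlgebra.adjoin ℂ s).topologicalClosure}
    (hS : IsClosed (S : Set (StarAlgebra.adjoin ℂ s).topologicalClosure))
    (h : ∀ x (hx : x ∈ s), ⟨x, StarSubalgebra.le_topologicalClosure _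
      (StarAlgebra.subset_adjoin ℂ s hx)⟩ ∈ S) (y : (StarAlgebra.adjoin ℂ s).topologicalClosure) :
    y ∈ S := by
  have hc : IsClosed ((S.map (StarSubalgebra.subtype _) : StarSubalgebra ℂ A) : Set A) := by
    rw [StarSubalgebra.coe_map]
    exact (StarSubalgebra.isClosed_topologicalClosure
      (StarAlgebra.adjoin ℂ s)).isClosedEmbedding_subtypeVal.isClosedMap _ hS
  have hle := StarSubalgebra.topologicalClosure_minimal (s := StarAlgebra.adjoin ℂ s)
    (StarAlgebra.adjoin_le fun x hx =>
      (⟨_, h x hx, rfl⟩ : x ∈ S.map (StarSubalgebra.subtype _))) hc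
  obtain ⟨z, hz, hzy⟩ := hle y.2
  exact (Subtype.ext hzy : z = y) ▸ hz

theorem mem_of_circleGen_mem {S : StarSubalgebra ℂ circleAlgebra}
    (hS : IsClosed (S : Set circleAlgebra)) (h : (circleGen : circleAlgebra) ∈ S)
    (a : circleAlgebra) : a ∈ S :=
  StarSubalgebra.mem_of_closure_adjoin (s := {(shift : Op ℤ)}) hS
    (fun x hx => by subst hx; exact h) a

theorem braidedTensor_mem {ι κ : Type*} {ζ : Circle} {deg₁ : ι → ℤ} {deg₂ : κ → ℤ}
    {X : StarSubalgebra ℂ (Op ι)} {Y : StarSubalgebra ℂ (Op κ)}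
    {S : StarSubalgebra ℂ (braidedTensor ζ deg₁ deg₂ X Y)}
    (hS : IsClosed (S : Set (braidedTensor ζ deg₁ deg₂ X Y))) (h₁ : ∀ x : X, j₁ x ∈ S)
    (h₂ : ∀ y : Y, j₂ y ∈ S) (w : braidedTensor ζ deg₁ deg₂ X Y) : w ∈ S := by
  refine StarSubalgebra.mem_of_closure_adjoin (s := (Op.amp κ '' (X : Set (Op ι)) ∪
    secondLeg ζ deg₁ deg₂ '' (Y : Set (Op κ)))) hS (fun x hx => ?_) w
  obtain ⟨a, ha, rfl⟩ | ⟨b, hb, rfl⟩ := hx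
  exacts [h₁ ⟨a, ha⟩, h₂ ⟨b, hb⟩]

theorem StarSubalgebra.isClosed_comap {A D : Type*} [CStarAlgebra A] [CStarAlgebra D]
    (φ : A →⋆ₐ[ℂ] D) {S : StarSubalgebra ℂ D} (hS : IsClosed (S : Set D)) :
    IsClosed ((S.comap φ : StarSubalgebra ℂ A) : Set A) :=
  hS.preimage φ.continuous_of_cstarAlgebra

theorem circleAlgebra_hom_ext {D : Type*} [CStarAlgebra D] {φ ψ : circleAlgebra →⋆ₐ[ℂ] D}
    (h : φ circleGen = ψ circleGen) : φ = ψ :=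
  StarAlgHom.ext fun a => mem_of_circleGen_mem (S := StarAlgHom.equalizer φ ψ)
    (isClosed_eq φ.continuous_of_cstarAlgebra ψ.continuous_of_cstarAlgebra) h a

/-! ## Powers of the shift -/

theorem shift_apply (f : L2 ℤ) (k : ℤ) : (shift : Op ℤ) f k = f (k - 1) := by
  change L2.monomial (Equiv.addRight (1 : ℤ)) 1 f k = _
  rw [L2.monomial_apply, Pi.one_apply, Circle.coe_one, one_mul]
  rfl

theorem star_shift_apply (f : L2 ℤ) (k : ℤ) : (star (shift : Op ℤ)) f k = f (k + 1) := by
  have h := congrArg (fun x : Op ℤ => x f (k + 1)) (Unitary.coe_mul_star_self shift)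
  simp only [Op.mul_apply, shift_apply, add_sub_cancel_right] at h
  exact h

theorem shift_zpow_apply (m : ℤ) (f : L2 ℤ) (k : ℤ) :
    ((shift ^ m : unitary (Op ℤ)) : Op ℤ) f k = f (k - m) := by
  induction m generalizing f k with
  | zero => rw [zpow_zero, sub_zero]; rfl
  | succ m ih =>
    rw [zpow_add_one]
    change ((shift ^ (m : ℤ) : unitary (Op ℤ)) : Op ℤ) ((shift : Op ℤ) f) k = _
    rw [ih, shift_apply, sub_sub]
  | pred m ih =>
    rw [zpow_sub_one]
    change ((shift ^ (-m : ℤ) : unitary (Op ℤ)) : Op ℤ) ((star (shift : Op ℤ)) f) k = _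
    rw [ih, star_shift_apply, sub_add, sub_sub_eq_add_sub]

/-- A *-homomorphism maps unitary elements to unitary elements. -/
def StarAlgHom.mapUnitary {A D : Type*} [Ring A] [StarRing A] [Algebra ℂ A] [Ring D] [StarRing D]
    [Algebra ℂ D] (φ : A →⋆ₐ[ℂ] D) : unitary A →* unitary D where
  toFun u := ⟨φ u, Unitary.mem_iff.2
    ⟨by rw [← map_star, ← map_mul, Unitary.star_mul_self_of_mem u.2, map_one],
      by rw [← map_star, ← map_mul, Unitary.mul_star_self_of_mem u.2, map_one]⟩⟩
  map_one' := Subtype.ext (map_one φ)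
  map_mul' u v := Subtype.ext (map_mul φ (u : A) v)

theorem StarAlgHom.map_unitary_zpow {A D : Type*} [Ring A] [StarRing A] [Algebra ℂ A] [Ring D]
    [StarRing D] [Algebra ℂ D] (φ : A →⋆ₐ[ℂ] D) (u : unitary A) (m : ℤ) :
    φ ((u ^ m : unitary A) : A) = ((φ.mapUnitary u ^ m : unitary D) : D) :=
  congrArg Subtype.val (map_zpow φ.mapUnitary u m)

theorem coe_circleGen_zpow (m : ℤ) :
    (((circleGen ^ m : unitary circleAlgebra) : circleAlgebra) : Op ℤ) =
      ((shift ^ m : unitary (Op ℤ)) : Op ℤ) :=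
  (StarSubalgebra.subtype circleAlgebra).map_unitary_zpow circleGen m

theorem homog_shift_zpow (m : ℤ) :
    Op.Homog (fun k : ℤ => k) m ((shift ^ m : unitary (Op ℤ)) : Op ℤ) := fun z => by
  ext f k
  rw [Op.conj_circleRep, Op.mul_apply, Op.mul_apply, Op.circleOp_apply, shift_zpow_apply,
    Op.circleOp_apply, Op.smul_apply, L2.smul_apply, shift_zpow_apply,
    ← mul_assoc, ← Circle.coe_mul, inv_zpow, ← zpow_neg, ← zpow_add]
  congr 4
  ring

/-! ### Generators of the bosonisation and of the iterated braided products -/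

namespace BraidedDatum

variable {n : ℕ} {P : BraidedDatum n}

namespace FaithfulRep

variable {ι : Type*} (R : P.FaithfulRep ι)

@[reducible]
noncomputable def cstarAlgebraBosonisation : CStarAlgebra R.bosonisation :=
  inferInstanceAs (CStarAlgebra (braidedTensor _ _ _ _ _))

@[reducible]
noncomputable def cstarAlgebraSquare : CStarAlgebra R.square :=
  inferInstanceAs (CStarAlgebra (braidedTensor _ _ _ _ _))

@[reducible]
noncomputable def cstarAlgebraTriple : CStarAlgebra R.triple :=
  inferInstanceAs (CStarAlgebra (braidedTensor _ _ _ _ _))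

attribute [local instance] cstarAlgebraBosonisation cstarAlgebraSquare cstarAlgebraTriple

theorem homog_σ {b : P.Ao} {m : ℤ} (h : ∀ z : Circle, P.β z b = ((z ^ m : Circle) : ℂ) • b) :
    Op.Homog R.deg m (R.σ b) := fun z => by
  rw [← R.equivariant, h, map_smul]

theorem homog_σ_u (i k : Fin n) : Op.Homog R.deg (P.deg k - P.deg i) (R.σ (P.u i k)) :=
  R.homog_σ fun z => P.β_u z i k

@[simp] theorem coe_fromCircle (a : circleAlgebra) :
    (R.fromCircle a : Op (ℤ × ι)) = Op.amp ι (a : Op ℤ) := rfl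

theorem incl_surjective (y : R.algebra) : ∃ b, R.incl b = y := by
  obtain ⟨b, hb⟩ := y.2
  exact ⟨b, Subtype.ext hb⟩

theorem square_mem {S : StarSubalgebra ℂ R.square} (hS : IsClosed (S : Set R.square))
    (h₁ : ∀ i k, R.sq₁ (P.u i k) ∈ S) (h₂ : ∀ i k, R.sq₂ (P.u i k) ∈ S) (w : R.square) :
    w ∈ S := by
  refine braidedTensor_mem hS (fun x => ?_) (fun y => ?_) w
  · obtain ⟨b, rfl⟩ := R.incl_surjective x
    exact P.mem_of_forall_u_mem (StarSubalgebra.isClosed_comap R.sq₁ hS) h₁ b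
  · obtain ⟨b, rfl⟩ := R.incl_surjective y
    exact P.mem_of_forall_u_mem (StarSubalgebra.isClosed_comap R.sq₂ hS) h₂ b

theorem triple_mem {S : StarSubalgebra ℂ R.triple} (hS : IsClosed (S : Set R.triple))
    (h₁ : R.leg₁ circleGen ∈ S) (h₂ : ∀ i k, R.leg₂₃ (R.sq₁ (P.u i k)) ∈ S)
    (h₃ : ∀ i k, R.leg₂₃ (R.sq₂ (P.u i k)) ∈ S) (w : R.triple) : w ∈ S :=
  braidedTensor_mem hS
    (mem_of_circleGen_mem (StarSubalgebra.isClosed_comap R.leg₁ hS) h₁)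
    (R.square_mem (StarSubalgebra.isClosed_comap R.leg₂₃ hS) h₂ h₃) w

/-- A closed *-subalgebra of the bosonisation that contains `z` and the generators `u i k` is
everything. -/
theorem bosonisation_mem {S : StarSubalgebra ℂ R.bosonisation}
    (hS : IsClosed (S : Set R.bosonisation)) (h₁ : R.fromCircle circleGen ∈ S)
    (h₂ : ∀ i k, R.fromAo (P.u i k) ∈ S) (w : R.bosonisation) : w ∈ S := by
  refine braidedTensor_mem hS
    (mem_of_circleGen_mem (StarSubalgebra.isClosed_comap R.fromCircle hS) h₁) (fun y => ?_) w
  obtain ⟨b, rfl⟩ := R.incl_surjective y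
  exact P.mem_of_forall_u_mem (StarSubalgebra.isClosed_comap R.fromAo hS) h₂ b

/-! ## The braided comultiplication -/

theorem sq₂_mul_sq₁ {a b : P.Ao} {k l : ℤ} (ha : Op.Homog R.deg k (R.σ a))
    (hb : Op.Homog R.deg l (R.σ b)) : R.sq₂ b * R.sq₁ a =
      P.ζpow (l * k) • (R.sq₁ a * R.sq₂ b) :=
  Subtype.ext (ha.secondLeg_mul_amp hb P.ζ)

/-- The braided comultiplication of `A_o(V, π, ω)`. -/
noncomputable def comulAo : P.Ao →⋆ₐ[ℂ] R.square :=
  P.lift (P.relations_comul R.sq₁ R.sq₂ fun i j k l => by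
    have h : ∀ i k, Op.Homog R.deg (-(P.deg k - P.deg i)) (R.σ (star (P.u i k))) :=
      fun i k => by rw [map_star]; exact (R.homog_σ_u i k).star
    rw [R.sq₂_mul_sq₁ (h i j) (h k l), neg_sub, neg_sub])

theorem comulAo_u (i k : Fin n) :
    R.comulAo (P.u i k) = ∑ l, R.sq₁ (P.u i l) * R.sq₂ (P.u l k) :=
  P.lift_u _ i k

/-- The braided comultiplication, as a representation. -/
noncomputable def comulOp : P.Ao →⋆ₐ[ℂ] Op (ι × ι) :=
  (StarSubalgebra.subtype R.square).comp R.comulAo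

/-- The block comparison that produces `id ⊠ ΔB` requires an equivariant second representation. On a
generator each summand has degree `(deg l - deg i) + (deg k - deg l)`, which is independent of `l`.
-/
theorem comulOp_equivariant (z : Circle) (b : P.Ao) : R.comulOp (P.β z b) =
    Op.conj (circleRep (fun q : ι × ι => R.deg q.1 + R.deg q.2) z) (R.comulOp b) := by
  refine congrArg (fun φ : P.Ao →⋆ₐ[ℂ] Op (ι × ι) => φ b)
    (P.hom_ext (φ := R.comulOp.comp (P.β z)) (ψ := (Op.conj (circleRep
      (fun q : ι × ι => R.deg q.1 + R.deg q.2) z)).comp R.comulOp) fun i k => ?_)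
  have h : R.comulOp (P.u i k) =
      ∑ l, Op.amp ι (R.σ (P.u i l)) * secondLeg P.ζ R.deg R.deg (R.σ (P.u l k)) := by
    change ((R.comulAo (P.u i k) : R.square) : Op (ι × ι)) = _
    rw [comulAo_u, AddSubmonoidClass.coe_finsetSum]
    rfl
  have hh : Op.Homog (fun q : ι × ι => R.deg q.1 + R.deg q.2) (P.deg k - P.deg i)
      (R.comulOp (P.u i k)) := by
    rw [h]
    refine Op.Homog.sum fun l _ => ?_
    rw [← sub_add_sub_cancel' (P.deg l) (P.deg i) (P.deg k)]
    exact ((R.homog_σ_u i l).amp R.deg).mul ((R.homog_σ_u l k).secondLeg P.ζ R.deg)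
  rw [StarAlgHom.comp_apply, StarAlgHom.comp_apply, hh, β_u, map_smul]

end FaithfulRep

end BraidedDatum

/-! ## Functoriality of the braided tensor product with `C(𝕋)` -/

namespace Op

variable {ι κ μ : Type*}

theorem secondLeg_tens_single (ζ : Circle) (deg₁ : ι → ℤ) (deg₂ : κ → ℤ) (y : Op κ) (i : ι)
    (η : L2 κ) : secondLeg ζ deg₁ deg₂ y (L2.tens (L2.single i) η) =
      L2.tens (L2.single i) (conj (circleRep deg₂ (ζ ^ deg₁ i)) y η) := by
  classical
  ext q
  rw [secondLeg_apply, L2.row_tens, map_smul', L2.smul_apply, L2.tens_apply, L2.single_apply]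
  split_ifs with h
  · rw [h]
  · rw [zero_mul, zero_mul]

/-- Thus the second leg is block diagonal, and its block at `i` is a rotated copy of `y`. -/
theorem secondLeg_mul_block_one (ζ : Circle) (deg₁ : ι → ℤ) (deg₂ : κ → ℤ) (y : Op κ) (i : ι) :
    secondLeg ζ deg₁ deg₂ y * block i i 1 =
      block i i (conj (circleRep deg₂ (ζ ^ deg₁ i)) y) := by
  refine ext_tens fun ξ η => ?_
  have h : ∀ ξ' : L2 κ, L2.tens (ξ i • L2.single i) ξ' = ξ i • L2.tens (L2.single i) ξ' :=
    fun ξ' => by ext q; simp [mul_assoc]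
  rw [mul_apply, block_tens, block_tens, h, h, map_smul', secondLeg_tens_single]
  rfl

theorem amp_mul_block (x : Op ι) (p q : ι) (a : Op κ) :
    amp κ x * block p q a = amp κ (x * unit p q) * ampRight ι a := by
  rw [block, ← mul_assoc, ← map_mul]

theorem shift_mul_unit (p q : ℤ) : (shift : Op ℤ) * unit p q = unit (p + 1) q := by
  ext f k
  rw [mul_apply, unit_apply, map_smul', unit_apply, L2.smul_apply, L2.smul_apply, shift_apply,
    L2.single_apply, L2.single_apply]
  simp only [sub_eq_iff_eq_add]

theorem star_shift_mul_unit (p q : ℤ) : star (shift : Op ℤ) * unit p q = unit (p - 1) q := by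
  ext f k
  rw [mul_apply, unit_apply, map_smul', unit_apply, L2.smul_apply, L2.smul_apply,
    star_shift_apply, L2.single_apply, L2.single_apply]
  simp only [eq_sub_iff_add_eq]

/-- Pairs of block columns with finitely many nonzero blocks, which are the images of the same
elements under `σ` and `φ`. -/
noncomputable def columns {B : Type*} [CStarAlgebra B] (σ : B →⋆ₐ[ℂ] Op κ) (φ : B →⋆ₐ[ℂ] Op μ) (q : ι) :
    Submodule ℂ (Op (ι × κ) × Op (ι × μ)) :=
  Submodule.span ℂ (Set.range fun r : ι × B => (block r.1 q (σ r.2), block r.1 q (φ r.2)))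

section columns

variable {B : Type*} [CStarAlgebra B] (σ : B →⋆ₐ[ℂ] Op κ) (φ : B →⋆ₐ[ℂ] Op μ)

theorem block_mem_columns (p q : ι) (b : B) : (block p q (σ b), block p q (φ b)) ∈ columns σ φ q :=
  Submodule.subset_span ⟨(p, b), rfl⟩

/-- Since `σ` and `φ` are linear, blocks in the same row add up inside `B`, so one element of `B`
accounts for row `p` in both components. -/
theorem exists_of_mem_columns (p q : ι) {w : Op (ι × κ) × Op (ι × μ)} (hw : w ∈ columns σ φ q) :
    ∃ b, block p p 1 * w.1 = block p q (σ b) ∧ block p p 1 * w.2 = block p q (φ b) := by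
  classical
  induction hw using Submodule.span_induction with
  | mem w hw =>
    obtain ⟨⟨r, b⟩, rfl⟩ := hw
    simp only [block_mul_block, one_mul]
    by_cases h : p = r
    · exact ⟨b, by rw [if_pos h], by rw [if_pos h]⟩
    · exact ⟨0, by rw [if_neg h, map_zero, block_zero], by rw [if_neg h, map_zero, block_zero]⟩
  | zero =>
    exact ⟨0, by rw [Prod.fst_zero, mul_zero, map_zero, block_zero],
      by rw [Prod.snd_zero, mul_zero, map_zero, block_zero]⟩
  | add v w _ _ hv hw =>
    obtain ⟨a, ha₁, ha₂⟩ := hv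
    obtain ⟨b, hb₁, hb₂⟩ := hw
    exact ⟨a + b, by rw [Prod.fst_add, mul_add, ha₁, hb₁, map_add, block_add],
      by rw [Prod.snd_add, mul_add, ha₂, hb₂, map_add, block_add]⟩
  | smul c w _ hw =>
    obtain ⟨b, hb₁, hb₂⟩ := hw
    exact ⟨c • b, by rw [Prod.smul_fst, mul_smul_comm, hb₁, map_smul, block_smul],
      by rw [Prod.smul_snd, mul_smul_comm, hb₂, map_smul, block_smul]⟩

theorem mul_block_mem_columns {p q : ι} (b : B) {w : Op (ι × κ) × Op (ι × μ)}
    (hw : w ∈ columns σ φ p) :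
    w * (block p q (σ b), block p q (φ b)) ∈ columns σ φ q := by
  classical
  induction hw using Submodule.span_induction with
  | mem w hw =>
    obtain ⟨⟨r, a⟩, rfl⟩ := hw
    simp only [Prod.mk_mul_mk, block_mul_block, if_true, ← map_mul]
    exact block_mem_columns σ φ r q (a * b)
  | zero => rw [zero_mul]; exact zero_mem _
  | add v w _ _ hv hw => rw [add_mul]; exact add_mem hv hw
  | smul c w _ hw => rw [smul_mul_assoc]; exact Submodule.smul_mem _ c hw

/-- The pair `w` has finite block columns in `columns σ φ`. -/
def HasColumns (w : Op (ι × κ) × Op (ι × μ)) : Prop :=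
  ∀ q : ι, w * (block q q 1, block q q 1) ∈ columns σ φ q

variable {σ φ}

/-- A block in row `p` absorbs the identity block at `(p, p)` on its left, so only column `p` of `w`
matters. Finiteness of the columns keeps the product of block matrices a finite sum in `B`. -/
theorem HasColumns.mul_mem {w : Op (ι × κ) × Op (ι × μ)} (hw : HasColumns σ φ w) {q : ι}
    {v : Op (ι × κ) × Op (ι × μ)} (hv : v ∈ columns σ φ q) : w * v ∈ columns σ φ q := by
  classical
  induction hv using Submodule.span_induction with
  | mem v hv =>
    obtain ⟨⟨p, b⟩, rfl⟩ := hv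
    have h := mul_block_mem_columns σ φ (q := q) b (hw p)
    have h1 : ((block p p 1, block p p 1) : Op (ι × κ) × Op (ι × μ)) *
        (block p q (σ b), block p q (φ b)) = (block p q (σ b), block p q (φ b)) := by
      rw [Prod.mk_mul_mk, block_mul_block, block_mul_block, if_pos rfl, if_pos rfl,
        one_mul, one_mul]
    rw [mul_assoc, h1] at h
    exact h
  | zero => rw [mul_zero]; exact zero_mem _
  | add u v _ _ hu hv => rw [mul_add]; exact add_mem hu hv
  | smul c v _ hv => rw [mul_smul_comm]; exact Submodule.smul_mem _ c hv

theorem HasColumns.mul {v w : Op (ι × κ) × Op (ι × μ)} (hv : HasColumns σ φ v)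
    (hw : HasColumns σ φ w) : HasColumns σ φ (v * w) := fun q => by
  rw [mul_assoc]
  exact hv.mul_mem (hw q)

theorem HasColumns.add {v w : Op (ι × κ) × Op (ι × μ)} (hv : HasColumns σ φ v)
    (hw : HasColumns σ φ w) : HasColumns σ φ (v + w) := fun q => by
  rw [add_mul]
  exact add_mem (hv q) (hw q)

theorem hasColumns_algebraMap (c : ℂ) :
    HasColumns (ι := ι) σ φ (algebraMap ℂ _ c) := fun q => by
  have h := block_mem_columns σ φ q q 1
  rw [map_one, map_one] at h
  rw [← Algebra.smul_def]
  exact Submodule.smul_mem _ c h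

/-- The column condition supplies, for every position, the common element of `B` that
`norm_le_norm_of_blocks` asks for. -/
theorem HasColumns.norm_le (hσ : Function.Injective σ) {w : Op (ι × κ) × Op (ι × μ)}
    (hw : HasColumns σ φ w) : ‖w.2‖ ≤ ‖w.1‖ :=
  norm_le_norm_of_blocks hσ φ fun p q => by
    obtain ⟨b, h₁, h₂⟩ := exists_of_mem_columns σ φ p q (hw q)
    exact ⟨b, by rw [mul_assoc]; exact h₁, by rw [mul_assoc]; exact h₂⟩

theorem hasColumns_amp_shift : HasColumns σ φ (amp κ (shift : Op ℤ), amp μ (shift : Op ℤ)) :=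
  fun q => by
    have h := block_mem_columns σ φ (q + 1) q 1
    rw [map_one, map_one] at h
    rw [Prod.mk_mul_mk, amp_mul_block, amp_mul_block, shift_mul_unit]
    exact h

theorem hasColumns_star_amp_shift :
    HasColumns σ φ (star (amp κ (shift : Op ℤ), amp μ (shift : Op ℤ))) := fun q => by
  have h := block_mem_columns σ φ (q - 1) q 1
  rw [map_one, map_one] at h
  rw [Prod.star_def, Prod.mk_mul_mk, ← map_star, ← map_star, amp_mul_block, amp_mul_block,
    star_shift_mul_unit]
  exact h

/-- By equivariance of both representations, the diagonal blocks at `q` are the images under `σ` and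
`φ` of the single element `β_{ζ^{deg₁ q}}(b)`. -/
theorem hasColumns_secondLeg {ζ : Circle} {deg₁ : ι → ℤ} {deg : κ → ℤ} {deg' : μ → ℤ}
    {β : Circle → B → B} (hσ : ∀ z b, σ (β z b) = conj (circleRep deg z) (σ b))
    (hφ : ∀ z b, φ (β z b) = conj (circleRep deg' z) (φ b)) (b : B) :
    HasColumns σ φ (secondLeg ζ deg₁ deg (σ b), secondLeg ζ deg₁ deg' (φ b)) := fun q => by
  rw [Prod.mk_mul_mk, secondLeg_mul_block_one, secondLeg_mul_block_one, ← hσ, ← hφ]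
  exact block_mem_columns σ φ q q _

end columns

end Op

namespace BraidedDatum

namespace FaithfulRep

attribute [local instance] cstarAlgebraBosonisation cstarAlgebraSquare cstarAlgebraTriple

variable {n : ℕ} {P : BraidedDatum n} {ι : Type*} (R : P.FaithfulRep ι)

/-- The graph of `id ⊠ ΔB` on generators. -/
def comulGenerators :
    Set (Op (ℤ × ι) × R.triple) :=
  insert ((R.fromCircle circleGen : Op (ℤ × ι)), R.leg₁ circleGen)
    (Set.range fun b : P.Ao => ((R.fromAo b : Op (ℤ × ι)), R.leg₂₃ (R.comulAo b)))

/-- Finiteness of columns says nothing about rows, so the induction carries the adjoint of `w` along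
with `w`. -/
theorem hasColumns_of_mem {w : Op (ℤ × ι) × R.triple}
    (hw : w ∈ StarAlgebra.adjoin ℂ R.comulGenerators) :
    Op.HasColumns R.σ R.comulOp (w.1, (w.2 : Op (ℤ × (ι × ι)))) ∧
      Op.HasColumns R.σ R.comulOp (star (w.1, (w.2 : Op (ℤ × (ι × ι))))) := by
  induction hw using StarAlgebra.adjoin_induction with
  | mem w hw =>
    obtain rfl | ⟨b, rfl⟩ := hw
    · exact ⟨Op.hasColumns_amp_shift, Op.hasColumns_star_amp_shift⟩
    · have h : ∀ b, Op.HasColumns R.σ R.comulOp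
          (secondLeg P.ζ (fun k : ℤ => k) R.deg (R.σ b),
            secondLeg P.ζ (fun k : ℤ => k) (fun q : ι × ι => R.deg q.1 + R.deg q.2)
              (R.comulOp b)) :=
        Op.hasColumns_secondLeg (β := fun z => P.β z) R.equivariant R.comulOp_equivariant
      refine ⟨h b, ?_⟩
      have h2 := h (star b)
      rw [map_star, map_star, map_star, map_star] at h2
      exact h2
  | algebraMap c =>
    refine ⟨Op.hasColumns_algebraMap c, ?_⟩
    have h := Op.hasColumns_algebraMap (ι := ℤ) (σ := R.σ) (φ := R.comulOp) (star c)
    rw [algebraMap_star_comm] at h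
    exact h
  | add v w _ _ hv hw =>
    refine ⟨hv.1.add hw.1, ?_⟩
    have h := hv.2.add hw.2
    rw [← star_add] at h
    exact h
  | mul v w _ _ hv hw =>
    refine ⟨hv.1.mul hw.1, ?_⟩
    have h := hw.2.mul hv.2
    rw [← star_mul] at h
    exact h
  | star w _ hw =>
    refine ⟨hw.2, ?_⟩
    have h := hw.1
    rw [← star_star (w.1, (w.2 : Op (ℤ × (ι × ι))))] at h
    exact h

/-- Since `C(𝕋) ⊠ B` is defined as a concrete algebra of operators, the map is obtained by closing
its graph on generators. The norm estimate comes from the block columns, with `R.σ` injective and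
`R.comulOp` as the second representation. -/
theorem exists_id_braided_comul : ∃ Θ : R.bosonisation →⋆ₐ[ℂ] R.triple,
    (∀ a, Θ (R.fromCircle a) = R.leg₁ a) ∧ ∀ b, Θ (R.fromAo b) = R.leg₂₃ (R.comulAo b) := by
  have h₁ : ((R.fromCircle circleGen : Op (ℤ × ι)), R.leg₁ circleGen) ∈
      StarAlgebra.adjoin ℂ R.comulGenerators := StarAlgebra.subset_adjoin ℂ _ (Set.mem_insert _ _)
  have h₂ : ∀ b, ((R.fromAo b : Op (ℤ × ι)), R.leg₂₃ (R.comulAo b)) ∈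
      StarAlgebra.adjoin ℂ R.comulGenerators := fun b =>
    StarAlgebra.subset_adjoin ℂ _ (Set.mem_insert_of_mem _ ⟨b, rfl⟩)
  have hX : R.bosonisation ≤ ((StarAlgebra.adjoin ℂ R.comulGenerators).map
      (StarAlgHom.fst ℂ (Op (ℤ × ι)) R.triple)).topologicalClosure := fun x hx =>
    R.bosonisation_mem (S := StarSubalgebra.comap (StarSubalgebra.subtype R.bosonisation)
      (StarSubalgebra.topologicalClosure ((StarAlgebra.adjoin ℂ R.comulGenerators).map
        (StarAlgHom.fst ℂ (Op (ℤ × ι)) R.triple))))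
      (StarSubalgebra.isClosed_comap _ (StarSubalgebra.isClosed_topologicalClosure _))
      (StarSubalgebra.le_topologicalClosure _ ⟨_, h₁, rfl⟩)
      (fun i k => StarSubalgebra.le_topologicalClosure _ ⟨_, h₂ (P.u i k), rfl⟩) ⟨x, hx⟩
  obtain ⟨Θ, hΘ⟩ := (StarAlgebra.adjoin ℂ R.comulGenerators).exists_starAlgHom_of_graph
    (fun w hw => (R.hasColumns_of_mem hw).1.norm_le R.injective) R.bosonisation hX
  refine ⟨Θ, fun a => ?_, fun b => hΘ _ (h₂ b) (R.fromAo b).2⟩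
  exact congrArg (fun φ : circleAlgebra →⋆ₐ[ℂ] R.triple => φ a)
    (circleAlgebra_hom_ext (φ := Θ.comp R.fromCircle) (ψ := R.leg₁)
      (hΘ _ h₁ (R.fromCircle circleGen).2))

end FaithfulRep

end BraidedDatum

/-! ## The map `ψ : C(𝕋) ⊠ B ⊠ B → C ⊗ C` -/

namespace BraidedDatum

namespace FaithfulRep

attribute [local instance] cstarAlgebraBosonisation cstarAlgebraSquare cstarAlgebraTriple

variable {n : ℕ} {P : BraidedDatum n} {ι : Type*} (R : P.FaithfulRep ι)

/-- The bijection of basis vectors that underlies the decomposition of `C ⊗ C` into copies of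
`C(𝕋) ⊠ B ⊠ B`. -/
def unfoldEquiv : (ℤ × (ι × ι)) × ℤ ≃ (ℤ × ι) × (ℤ × ι) where
  -- The extra coordinate is `r = l - k - deg i`. It is unchanged by `z ⊗ z`, which raises `k` and
  -- `l` by one, and by `b ⊗ z^m` with `b` of degree `m`, which raises `deg i` and `l` by `m`. So
  -- `r` labels the copies.
  toFun q := ((q.1.1, q.1.2.1), (q.2 + q.1.1 + R.deg q.1.2.1, q.1.2.2))
  invFun q := ((q.1.1, (q.1.2, q.2.2)), q.2.1 - q.1.1 - R.deg q.1.2)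
  left_inv q := by ext <;> simp [add_sub_right_comm]
  right_inv q := by ext <;> simp; ring

/-- The unitary that decomposes `C ⊗ C` into copies of `C(𝕋) ⊠ B ⊠ B`. -/
noncomputable def unfoldUnitary : L2 ((ℤ × (ι × ι)) × ℤ) ≃ₗᵢ[ℂ] L2 ((ℤ × ι) × (ℤ × ι)) :=
  -- On the third leg an element of degree `m` carries `ζ^{m(k + deg i)}` in the triple product but
  -- `ζ^{m l}` in `C ⊗ C`. The phase `ζ^{r deg j}` makes up for the difference `ζ^{m r}`.
  L2.monomial R.unfoldEquiv fun q => P.ζ ^ (q.2 * R.deg q.1.2.2)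

theorem unfoldUnitary_apply (f : L2 ((ℤ × (ι × ι)) × ℤ)) (k l : ℤ) (i j : ι) :
    R.unfoldUnitary f ((k, i), (l, j)) = P.ζpow ((l - k - R.deg i) * R.deg j) *
      f ((k, (i, j)), l - k - R.deg i) := rfl

/-- The representation of `C(𝕋) ⊠ B ⊠ B` on the Hilbert space of `C ⊗ C`. -/
noncomputable def unfold : Op (ℤ × (ι × ι)) →⋆ₐ[ℂ] Op ((ℤ × ι) × (ℤ × ι)) :=
  (Op.conj R.unfoldUnitary).comp (Op.amp ℤ)

theorem unfold_eq {x : Op (ℤ × (ι × ι))} {y : Op ((ℤ × ι) × (ℤ × ι))}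
    (h : ∀ f q, R.unfoldUnitary (Op.amp ℤ x f) q = y (R.unfoldUnitary f) q) : R.unfold x = y := by
  ext f q
  have h1 := h (R.unfoldUnitary.symm f) q
  rw [LinearIsometryEquiv.apply_symm_apply] at h1
  exact h1

theorem unfold_leg₁ : R.unfold (Op.amp (ι × ι) (shift : Op ℤ)) =
    Op.amp (ℤ × ι) (Op.amp ι (shift : Op ℤ)) * Op.ampRight (ℤ × ι) (Op.amp ι (shift : Op ℤ)) := by
  refine R.unfold_eq fun f ⟨⟨k, i⟩, ⟨l, j⟩⟩ => ?_
  rw [unfoldUnitary_apply, Op.mul_apply, Op.amp_apply, Op.amp_apply, shift_apply, Op.amp_apply,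
    Op.amp_apply, shift_apply, L2.slice_apply, L2.slice_apply, L2.slice_apply, L2.slice_apply,
    Op.ampRight_apply, Op.amp_apply, shift_apply, L2.slice_apply, L2.row_apply,
    unfoldUnitary_apply]
  simp only [sub_sub_sub_cancel_right]

theorem unfold_leg₂ {x : Op ι} {m : ℤ} (hx : Op.Homog R.deg m x) :
    R.unfold (secondLeg P.ζ (fun k : ℤ => k) (fun q : ι × ι => R.deg q.1 + R.deg q.2)
        (Op.amp ι x)) =
      Op.amp (ℤ × ι) (secondLeg P.ζ (fun k : ℤ => k) R.deg x) *
        Op.ampRight (ℤ × ι) (Op.amp ι ((shift ^ m : unitary (Op ℤ)) : Op ℤ)) := by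
  refine R.unfold_eq fun f ⟨⟨k, i⟩, ⟨l, j⟩⟩ => ?_
  rw [unfoldUnitary_apply, Op.mul_apply, Op.amp_apply, (hx.amp R.deg).secondLeg_apply,
    Op.amp_apply, Op.amp_apply, hx.secondLeg_apply, mul_left_comm]
  congr 1
  have h : P.ζpow ((l - k - R.deg i) * R.deg j) * x (((f.slice (l - k - R.deg i)).row k).slice j) i =
      x (P.ζpow ((l - k - R.deg i) * R.deg j) •
        (((f.slice (l - k - R.deg i)).row k).slice j)) i := by
    rw [Op.map_smul', L2.smul_apply]
  -- Only `i'` with `deg i' = deg i - m` contribute. For these, lowering `l` by `m` leaves `l - k -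
  -- deg i'` equal to `l - k - deg i`.
  refine h.trans (hx.apply_congr fun i' hi' => ?_)
  rw [L2.smul_apply, L2.slice_apply, L2.row_apply, L2.slice_apply, L2.row_apply, L2.slice_apply,
    Op.ampRight_apply, Op.amp_apply, shift_zpow_apply, L2.slice_apply, L2.row_apply,
    unfoldUnitary_apply, hi']
  have : l - m - k - (R.deg i - m) = l - k - R.deg i := by ring
  rw [this]

theorem unfold_leg₃ {x : Op ι} {m : ℤ} (hx : Op.Homog R.deg m x) :
    R.unfold (secondLeg P.ζ (fun k : ℤ => k) (fun q : ι × ι => R.deg q.1 + R.deg q.2)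
        (secondLeg P.ζ R.deg R.deg x)) =
      Op.ampRight (ℤ × ι) (secondLeg P.ζ (fun k : ℤ => k) R.deg x) := by
  refine R.unfold_eq fun f ⟨⟨k, i⟩, ⟨l, j⟩⟩ => ?_
  rw [unfoldUnitary_apply, Op.amp_apply, (hx.secondLeg P.ζ R.deg).secondLeg_apply,
    hx.secondLeg_apply, Op.ampRight_apply, hx.secondLeg_apply]
  change P.ζpow _ * (P.ζpow (m * k) * (P.ζpow (m * R.deg i) * _)) = P.ζpow (m * l) * _
  rw [← mul_assoc, ← mul_assoc, ← P.ζpow_add, ← P.ζpow_add]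
  have h : ∀ (c : ℂ) (g : L2 ι), c * x g j = x (c • g) j := fun c g => by
    rw [Op.map_smul', L2.smul_apply]
  rw [h, h]
  -- Contributing `j'` have degree `deg j - m`. With `r = l - k - deg i` the phases agree because `r
  -- deg j + m k + m deg i = m l + r (deg j - m)`.
  refine hx.apply_congr fun j' hj' => ?_
  rw [L2.smul_apply, L2.smul_apply, L2.row_apply, L2.row_apply, L2.row_apply, L2.slice_apply,
    L2.row_apply, unfoldUnitary_apply, hj', ← mul_assoc, ← P.ζpow_add]
  congr 2
  ring

@[simp] theorem coe_tmul (x y : R.bosonisation) :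
    (tmul x y : Op ((ℤ × ι) × (ℤ × ι))) =
      Op.amp (ℤ × ι) (x : Op (ℤ × ι)) * Op.ampRight (ℤ × ι) (y : Op (ℤ × ι)) := rfl

theorem unfold_coe_leg₁ : R.unfold (R.leg₁ circleGen : Op (ℤ × (ι × ι))) =
    (tmul (R.fromCircle circleGen) (R.fromCircle circleGen) :
      spatialTensor R.bosonisation R.bosonisation) :=
  R.unfold_leg₁

theorem unfold_coe_leg₂ {b : P.Ao} {m : ℤ}
    (hb : ∀ z : Circle, P.β z b = ((z ^ m : Circle) : ℂ) • b) :
    R.unfold (R.leg₂₃ (R.sq₁ b) : Op (ℤ × (ι × ι))) =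
      (tmul (R.fromAo b) (R.fromCircle ((circleGen ^ m : unitary circleAlgebra))) :
        spatialTensor R.bosonisation R.bosonisation) := by
  rw [coe_tmul, coe_fromCircle, coe_circleGen_zpow]
  exact R.unfold_leg₂ (R.homog_σ hb)

theorem unfold_coe_leg₃_u (i k : Fin n) :
    R.unfold (R.leg₂₃ (R.sq₂ (P.u i k)) : Op (ℤ × (ι × ι))) =
      (tmul 1 (R.fromAo (P.u i k)) : spatialTensor R.bosonisation R.bosonisation) := by
  rw [coe_tmul, OneMemClass.coe_one, map_one, one_mul]
  exact R.unfold_leg₃ (R.homog_σ_u i k)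

theorem unfold_mem (w : R.triple) :
    R.unfold (w : Op (ℤ × (ι × ι))) ∈ spatialTensor R.bosonisation R.bosonisation := by
  have key : ∀ {v : R.triple} {t : spatialTensor R.bosonisation R.bosonisation},
      R.unfold (v : Op (ℤ × (ι × ι))) = t → v ∈ StarSubalgebra.comap
        (R.unfold.comp (StarSubalgebra.subtype R.triple))
          (spatialTensor R.bosonisation R.bosonisation) := fun {v t} h => by
    change R.unfold (v : Op (ℤ × (ι × ι))) ∈ spatialTensor R.bosonisation R.bosonisation
    rw [h]
    exact t.2
  refine R.triple_mem (S := StarSubalgebra.comap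
    (R.unfold.comp (StarSubalgebra.subtype R.triple))
      (spatialTensor R.bosonisation R.bosonisation))
    (StarSubalgebra.isClosed_comap _ (StarSubalgebra.isClosed_topologicalClosure _))
    ?_ (fun i k => ?_) (fun i k => ?_) w
  · exact key (R.unfold_coe_leg₁)
  · exact key (R.unfold_coe_leg₂ (fun z => P.β_u z i k))
  · exact key (R.unfold_coe_leg₃_u i k)

/-- The *-homomorphism `ψ : C(𝕋) ⊠ B ⊠ B → C ⊗ C`. -/
noncomputable def psi : R.triple →⋆ₐ[ℂ] spatialTensor R.bosonisation R.bosonisation :=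
  StarAlgHom.codRestrict (R.unfold.comp (StarSubalgebra.subtype R.triple)) _ R.unfold_mem

/-- Both sides are *-homomorphisms in `b`, so agreement on the homogeneous generators extends to all
`b`. -/
theorem psi_leg₃ (b : P.Ao) : R.psi (R.leg₂₃ (R.sq₂ b)) = tmul 1 (R.fromAo b) := by
  have h := congrArg (fun φ : P.Ao →⋆ₐ[ℂ] spatialTensor R.bosonisation R.bosonisation => φ b)
    (P.hom_ext (φ := R.psi.comp (R.leg₂₃.comp R.sq₂)) (ψ := spatialRight.comp R.fromAo)
      fun i k => (Subtype.ext (R.unfold_coe_leg₃_u i k)).trans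
        ((congrArg (· * _) (map_one spatialLeft)).trans (one_mul _)))
  exact h.trans ((congrArg (· * _) (map_one spatialLeft)).trans (one_mul _)).symm

theorem exists_isComul : ∃ Δ : R.bosonisation →⋆ₐ[ℂ] spatialTensor R.bosonisation R.bosonisation,
    R.IsComul Δ := by
  obtain ⟨Θ, h₁, h₂⟩ := R.exists_id_braided_comul
  exact ⟨R.psi.comp Θ, R.comulAo, Θ, R.psi, R.comulAo_u, h₁, h₂, Subtype.ext R.unfold_coe_leg₁,
    fun b m hb => Subtype.ext (R.unfold_coe_leg₂ hb), R.psi_leg₃, rfl⟩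

end FaithfulRep

end BraidedDatum

/-! ## The matrix `z ⊕ t` over the bosonisation -/

namespace BraidedDatum

variable {n : ℕ} {P : BraidedDatum n}

/-- The vector `ω` is invertible as a matrix. -/
theorem isUnit_F (hω : ∃ c : ℂ, c ≠ 0 ∧
    P.ω.map star * P.ω = c • Matrix.diagonal fun i => P.ζpow (P.d * P.deg i)) : IsUnit P.F := by
  obtain ⟨c, hc, h⟩ := hω
  have hF : P.F = P.ω.transpose * Matrix.diagonal fun i => P.ζpow (P.d * P.deg i) := by
    ext i j
    rw [Matrix.mul_diagonal, Matrix.transpose_apply, mul_comm]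
    rfl
  have hdiag : IsUnit (Matrix.diagonal fun i => P.ζpow (P.d * P.deg i)) := by
    rw [Matrix.isUnit_diagonal, Pi.isUnit_iff]
    exact fun i => (P.ζpow_ne_zero _).isUnit
  have hω' : IsUnit P.ω := by
    have h1 : IsUnit (P.ω.map star * P.ω) := by
      rw [h]
      exact (hdiag.smul (Units.mk0 c hc) : _)
    rw [Matrix.isUnit_iff_isUnit_det, Matrix.det_mul] at h1
    exact (Matrix.isUnit_iff_isUnit_det _).2 (isUnit_of_mul_isUnit_right h1)
  rw [hF]
  exact ((Matrix.isUnit_transpose _).2 hω').mul hdiag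

theorem F_apply (i j : Fin n) : P.F i j = P.ζpow (P.d * P.deg j) * P.ω j i := rfl

namespace FaithfulRep

attribute [local instance] cstarAlgebraBosonisation cstarAlgebraSquare cstarAlgebraTriple

variable {ι : Type*} (R : P.FaithfulRep ι)

theorem zpow_eq (k : ℤ) : R.zpow k =
    ((R.fromCircle.mapUnitary circleGen ^ k : unitary R.bosonisation) : R.bosonisation) :=
  R.fromCircle.map_unitary_zpow circleGen k

theorem zpow_add (k l : ℤ) : R.zpow (k + l) = R.zpow k * R.zpow l := by
  simp only [zpow_eq, _root_.zpow_add]; rfl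

theorem zpow_zero : R.zpow 0 = 1 := by
  rw [zpow_eq, _root_.zpow_zero]; rfl

theorem zpow_one : R.zpow 1 = R.fromCircle circleGen := by
  rw [zpow_eq, _root_.zpow_one]; rfl

theorem star_zpow (k : ℤ) : star (R.zpow k) = R.zpow (-k) := by
  rw [zpow_eq, zpow_eq, zpow_neg]; rfl

theorem zpow_mul_zpow_neg (k : ℤ) : R.zpow k * R.zpow (-k) = 1 := by
  rw [← zpow_add, add_neg_cancel, zpow_zero]

theorem zpow_neg_mul_zpow (k : ℤ) : R.zpow (-k) * R.zpow k = 1 := by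
  rw [← zpow_add, neg_add_cancel, zpow_zero]

/-- The element `x` of the bosonisation satisfies `x z = ζ ^ m z x`. -/
def HasDeg (m : ℤ) (x : R.bosonisation) : Prop :=
  ∀ k, x * R.zpow k = P.ζpow (m * k) • (R.zpow k * x)

variable {R}

theorem HasDeg.sum {α : Type*} {m : ℤ} {s : Finset α} {x : α → R.bosonisation}
    (hx : ∀ a ∈ s, R.HasDeg m (x a)) : R.HasDeg m (∑ a ∈ s, x a) := fun k => by
  rw [Finset.sum_mul, Finset.mul_sum, Finset.smul_sum]
  exact Finset.sum_congr rfl fun a ha => hx a ha k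

theorem HasDeg.smul {m : ℤ} {x : R.bosonisation} (hx : R.HasDeg m x) (c : ℂ) :
    R.HasDeg m (c • x) := fun k => by
  rw [smul_mul_assoc, hx, mul_smul_comm, smul_comm]

theorem HasDeg.star {m : ℤ} {x : R.bosonisation} (hx : R.HasDeg m x) :
    R.HasDeg (-m) (star x) := fun k => by
  have h := congrArg Star.star (hx (-k))
  rw [star_mul, star_smul, star_mul, star_zpow, star_ζpow, neg_neg] at h
  rw [h, P.ζpow_smul_ζpow_smul, mul_neg, neg_neg, neg_mul, neg_add_cancel, ζpow_zero, one_smul]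

theorem HasDeg.zpow_mul {m : ℤ} {x : R.bosonisation} (hx : R.HasDeg m x) (l : ℤ) :
    R.HasDeg m (R.zpow l * x) := fun k => by
  rw [mul_assoc, hx, mul_smul_comm, ← mul_assoc, ← mul_assoc, ← zpow_add, ← zpow_add, add_comm]

theorem HasDeg.mul_zpow {m : ℤ} {x : R.bosonisation} (hx : R.HasDeg m x) (l : ℤ) :
    R.HasDeg m (x * R.zpow l) := fun k => by
  rw [mul_assoc, ← zpow_add, add_comm, zpow_add, ← mul_assoc, hx, smul_mul_assoc, mul_assoc]

variable (R)

theorem hasDeg_fromAo {b : P.Ao} {m : ℤ} (hb : Op.Homog R.deg m (R.σ b)) :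
    R.HasDeg m (R.fromAo b) := fun k => by
  refine Subtype.ext ?_
  have h := (homog_shift_zpow k).secondLeg_mul_amp hb P.ζ
  rw [← coe_circleGen_zpow] at h
  exact h

theorem t_apply (h i : Fin n) : R.t h i = R.zpow (P.deg h) * R.fromAo (P.u h i) := rfl

theorem fromAo_u (h i : Fin n) : R.fromAo (P.u h i) = R.zpow (-P.deg h) * R.t h i := by
  rw [t_apply, ← mul_assoc, zpow_neg_mul_zpow, one_mul]

theorem star_t_apply (h i : Fin n) :
    star (R.t h i) = star (R.fromAo (P.u h i)) * R.zpow (-P.deg h) := by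
  rw [t_apply, star_mul, star_zpow]

theorem hasDeg_t (h i : Fin n) : R.HasDeg (P.deg i - P.deg h) (R.t h i) :=
  (R.hasDeg_fromAo (R.homog_σ_u h i)).zpow_mul _

theorem relations_fromAo : P.Relations fun i k => R.fromAo (P.u i k) :=
  P.relations_u.map R.fromAo

theorem star_t_mul_t : star R.t * R.t = 1 := by
  refine Matrix.ext fun i j => ?_
  rw [Matrix.mul_apply, Matrix.one_apply, ← R.relations_fromAo.isometry]
  refine Finset.sum_congr rfl fun k _ => ?_
  rw [Matrix.star_apply, star_t_apply, t_apply, mul_assoc, ← mul_assoc (R.zpow _),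
    zpow_neg_mul_zpow, one_mul]

theorem t_mul_star_t : R.t * star R.t = 1 := by
  refine Matrix.ext fun i j => ?_
  rw [Matrix.mul_apply, Matrix.one_apply]
  have h : ∀ k, R.t i k * (star R.t) k j = R.zpow (P.deg i) *
      (R.fromAo (P.u i k) * star (R.fromAo (P.u j k))) * R.zpow (-P.deg j) := fun k => by
    rw [Matrix.star_apply, star_t_apply, t_apply]
    simp only [mul_assoc]
  simp only [h, ← Finset.sum_mul, ← Finset.mul_sum, R.relations_fromAo.coisometry]
  split_ifs with hij
  · rw [mul_one, hij, zpow_mul_zpow_neg]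
  · rw [mul_zero, zero_mul]

/-- This is the invariance relation multiplied by `z^{deg j}`. The weights `ζ^{d deg i}` in `F` are
what remains of the phases once powers of `z` have been moved past the adjoints `u*`. -/
theorem t_mul_F : R.t * P.F.map (algebraMap ℂ R.bosonisation) =
    R.zpow P.d • (P.F.map (algebraMap ℂ R.bosonisation) * R.t.map star) := by
  refine Matrix.ext fun j i => ?_
  have hinv : ∑ k, P.ω i k • R.fromAo (P.u j k) =
      P.ζpow (P.deg j * (P.d - P.deg j) - P.deg j * P.deg i) •
        ∑ k, P.ω k j • star (R.fromAo (P.u k i)) := by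
    simpa only [map_sum, map_smul, map_star] using congrArg R.fromAo (P.sum_ω_smul_u i j)
  have hL : (R.t * P.F.map (algebraMap ℂ R.bosonisation)) j i = P.ζpow (P.d * P.deg i) •
      (R.zpow (P.deg j) * ∑ k, P.ω i k • R.fromAo (P.u j k)) := by
    rw [Matrix.mul_apply, Finset.mul_sum, Finset.smul_sum]
    refine Finset.sum_congr rfl fun k _ => ?_
    rw [Matrix.map_apply, ← Algebra.commutes, ← Algebra.smul_def, F_apply, mul_smul, t_apply,
      mul_smul_comm]
  rw [hL, hinv, Matrix.smul_apply, Matrix.mul_apply, smul_eq_mul]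
  simp only [Finset.smul_sum, Finset.mul_sum, mul_smul_comm]
  refine Finset.sum_congr rfl fun k _ => ?_
  rw [Matrix.map_apply, Matrix.map_apply, ← Algebra.smul_def, F_apply, mul_smul, mul_smul_comm,
    mul_smul_comm]
  by_cases h0 : P.ω k j = 0
  · rw [h0]; simp
  -- A nonzero `ω k j` gives `d = deg k + deg j`, so moving `z^{-deg k}` to the left turns `z^d`
  -- into `z^{deg j}`.
  · have h1 := (R.hasDeg_fromAo (R.homog_σ_u k i)).star (-P.deg k)
    rw [star_t_apply, h1, mul_smul_comm, ← mul_assoc, ← zpow_add, smul_smul, smul_smul, smul_smul,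
      smul_smul, ← P.homogeneous k j h0]
    have e1 : P.deg k + P.deg j + -P.deg k = P.deg j := by ring
    rw [e1, mul_right_comm (P.ζpow ((P.deg k + P.deg j) * P.deg k)), ← ζpow_add,
      ← ζpow_add]
    congr 3
    ring

/-! ## Generators and density -/

theorem zpow_mem {S : StarSubalgebra ℂ R.bosonisation} (h : R.zpow 1 ∈ S) (k : ℤ) :
    R.zpow k ∈ S := by
  induction k with
  | zero => rw [zpow_zero]; exact one_mem S
  | succ m ih => rw [zpow_add]; exact mul_mem ih h
  | pred m ih =>
    rw [sub_eq_add_neg, zpow_add, ← R.star_zpow 1]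
    exact mul_mem ih (star_mem h)

theorem zt_mem (k l : Unit ⊕ Fin n) : R.zt k l ∈ coeffAlgebra R.zt :=
  StarAlgebra.subset_adjoin ℂ _ ⟨(k, l), rfl⟩

theorem zpow_mem_coeffAlgebra (k : ℤ) : R.zpow k ∈ coeffAlgebra R.zt :=
  R.zpow_mem (R.zt_mem (Sum.inl ()) (Sum.inl ())) k

theorem t_mem_coeffAlgebra (i j : Fin n) : R.t i j ∈ coeffAlgebra R.zt :=
  R.zt_mem (Sum.inr i) (Sum.inr j)

theorem fromAo_u_mem_coeffAlgebra (i j : Fin n) : R.fromAo (P.u i j) ∈ coeffAlgebra R.zt := by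
  rw [fromAo_u]
  exact mul_mem (R.zpow_mem_coeffAlgebra _) (R.t_mem_coeffAlgebra i j)

theorem topologicalClosure_coeffAlgebra : (coeffAlgebra R.zt).topologicalClosure = ⊤ := by
  refine top_unique fun w _ => R.bosonisation_mem (StarSubalgebra.isClosed_topologicalClosure _)
    ?_ (fun i k => ?_) w
  · rw [← zpow_one]
    exact StarSubalgebra.le_topologicalClosure _ (R.zpow_mem_coeffAlgebra 1)
  · exact StarSubalgebra.le_topologicalClosure _ (R.fromAo_u_mem_coeffAlgebra i k)

/-! ## The comultiplication -/

theorem tmul_mul_tmul (x x' y y' : R.bosonisation) :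
    (tmul x y * tmul x' y' : spatialTensor R.bosonisation R.bosonisation) =
      tmul (x * x') (y * y') :=
  Subtype.ext (Op.amp_mul_ampRight_mul _ _ _ _)

theorem star_tmul (x y : R.bosonisation) :
    (star (tmul x y) : spatialTensor R.bosonisation R.bosonisation) =
      tmul (star x) (star y) := by
  have h : (spatialRight (star y) * spatialLeft (star x) :
      spatialTensor R.bosonisation R.bosonisation) = spatialLeft (star x) * spatialRight (star y) :=
    Subtype.ext (Op.commute_amp_ampRight _ _).symm
  rw [tmul, star_mul, ← map_star, ← map_star, h]
  rfl

variable {R}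

theorem IsComul.zpow {Δ : R.bosonisation →⋆ₐ[ℂ] spatialTensor R.bosonisation R.bosonisation}
    (hΔ : R.IsComul Δ) (k : ℤ) : Δ (R.zpow k) = tmul (R.zpow k) (R.zpow k) := by
  have h1 : Δ (R.zpow 1) = tmul (R.zpow 1) (R.zpow 1) := by
    obtain ⟨ΔB, Θ, ψ, -, hΘ, -, hψ, -, -, rfl⟩ := hΔ
    rw [zpow_one, StarAlgHom.comp_apply, hΘ, hψ]
  induction k with
  | zero =>
    rw [FaithfulRep.zpow_zero, map_one, tmul, map_one, map_one, one_mul]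
  | succ m ih => rw [FaithfulRep.zpow_add, map_mul, ih, h1, tmul_mul_tmul]
  | pred m ih =>
    rw [sub_eq_add_neg, FaithfulRep.zpow_add, map_mul, ih, ← R.star_zpow 1, map_star, h1, star_tmul,
      tmul_mul_tmul]

theorem IsComul.fromAo_u
    {Δ : R.bosonisation →⋆ₐ[ℂ] spatialTensor R.bosonisation R.bosonisation}
    (hΔ : R.IsComul Δ) (i k : Fin n) : Δ (R.fromAo (P.u i k)) =
      ∑ l, tmul (R.fromAo (P.u i l)) (R.zpow (P.deg l - P.deg i) * R.fromAo (P.u l k)) := by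
  obtain ⟨ΔB, Θ, ψ, hB, -, hΘ, -, hψ₂, hψ₃, rfl⟩ := hΔ
  rw [StarAlgHom.comp_apply, hΘ, hB, map_sum, map_sum]
  refine Finset.sum_congr rfl fun l _ => ?_
  rw [map_mul, map_mul, hψ₂ _ _ fun z => P.β_u z i l, hψ₃, tmul_mul_tmul, mul_one]
  rfl

/-- The factor `z^{deg i}` in `t` merges with the `z^{deg l - deg i}` that the coaction puts into
the second leg of `Δ(u i k)`. The result is `z^{deg l}`, exactly the factor in `t l k`. -/
theorem IsComul.t {Δ : R.bosonisation →⋆ₐ[ℂ] spatialTensor R.bosonisation R.bosonisation}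
    (hΔ : R.IsComul Δ) (i k : Fin n) : Δ (R.t i k) = ∑ l, tmul (R.t i l) (R.t l k) := by
  rw [t_apply, map_mul, hΔ.zpow, hΔ.fromAo_u, Finset.mul_sum]
  refine Finset.sum_congr rfl fun l _ => ?_
  rw [tmul_mul_tmul, ← mul_assoc, ← FaithfulRep.zpow_add, add_sub_cancel, t_apply, t_apply]

theorem IsComul.zt {Δ : R.bosonisation →⋆ₐ[ℂ] spatialTensor R.bosonisation R.bosonisation}
    (hΔ : R.IsComul Δ) (k l : Unit ⊕ Fin n) :
    Δ (R.zt k l) = ∑ r, tmul (R.zt k r) (R.zt r l) := by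
  have h0 : ∀ x : R.bosonisation,
      (tmul 0 x : spatialTensor R.bosonisation R.bosonisation) = 0 := fun x => by
    rw [tmul, map_zero, zero_mul]
  have h0' : ∀ x : R.bosonisation,
      (tmul x 0 : spatialTensor R.bosonisation R.bosonisation) = 0 := fun x => by
    rw [tmul, map_zero, mul_zero]
  rcases k with k | k <;> rcases l with l | l
  all_goals
    simp only [FaithfulRep.zt, Fintype.sum_sum_type, Matrix.fromBlocks_apply₁₁,
      Matrix.fromBlocks_apply₁₂, Matrix.fromBlocks_apply₂₁, Matrix.fromBlocks_apply₂₂,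
      Matrix.of_apply, Matrix.zero_apply, h0, h0', map_zero, Finset.sum_const_zero, add_zero,
      zero_add, hΔ.zpow, hΔ.t, Finset.univ_unique, Finset.sum_singleton]

/-- The values on `z` and `u i k` were computed from the defining conditions alone, and these
elements generate. -/
theorem IsComul.unique
    {Δ Δ' : R.bosonisation →⋆ₐ[ℂ] spatialTensor R.bosonisation R.bosonisation}
    (hΔ : R.IsComul Δ) (hΔ' : R.IsComul Δ') : Δ = Δ' := by
  refine StarAlgHom.ext fun w => R.bosonisation_mem (S := StarAlgHom.equalizer Δ Δ')
    (isClosed_eq Δ.continuous_of_cstarAlgebra Δ'.continuous_of_cstarAlgebra) ?_ (fun i k => ?_) w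
  · rw [StarAlgHom.mem_equalizer, ← zpow_one, hΔ.zpow, hΔ'.zpow]
  · rw [StarAlgHom.mem_equalizer, hΔ.fromAo_u, hΔ'.fromAo_u]

variable (R)

/-! ## Unitarity -/

theorem zt_mem_unitary :
    R.zt ∈ unitary (Matrix (Unit ⊕ Fin n) (Unit ⊕ Fin n) R.bosonisation) := by
  have h1 : star R.zt = Matrix.fromBlocks (Matrix.of fun _ _ => R.zpow (-1)) 0 0 (star R.t) := by
    rw [Matrix.star_eq_conjTranspose, zt, Matrix.fromBlocks_conjTranspose,
      Matrix.conjTranspose_zero, Matrix.conjTranspose_zero, ← Matrix.star_eq_conjTranspose]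
    congr 1
    exact Matrix.ext fun _ _ => R.star_zpow 1
  have h2 : ∀ k, (Matrix.of fun _ _ => R.zpow k : Matrix Unit Unit R.bosonisation) *
      (Matrix.of fun _ _ => R.zpow (-k)) = 1 := fun k => by
    refine Matrix.ext fun _ _ => ?_
    simp [Matrix.mul_apply, zpow_mul_zpow_neg]
  have h3 := h2 (-1)
  rw [neg_neg] at h3
  rw [Unitary.mem_iff, h1, zt, Matrix.fromBlocks_multiply, Matrix.fromBlocks_multiply]
  simp only [Matrix.mul_zero, Matrix.zero_mul, add_zero, zero_add, star_t_mul_t, t_mul_star_t,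
    h2 1, h3, Matrix.fromBlocks_one, and_self]

theorem isUnit_F_map (hF : IsUnit P.F) : IsUnit (P.F.map (algebraMap ℂ R.bosonisation)) :=
  hF.map (algebraMap ℂ R.bosonisation).mapMatrix

/-- In `t F = z^d F t̄` every factor other than `t̄` is invertible. -/
theorem isUnit_t_map_star (hF : IsUnit P.F) : IsUnit (R.t.map star) := by
  have ht : IsUnit R.t := ⟨⟨R.t, star R.t, R.t_mul_star_t, R.star_t_mul_t⟩, rfl⟩
  have hz : IsUnit (R.zpow P.d • (1 : Matrix (Fin n) (Fin n) R.bosonisation)) := by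
    refine ⟨⟨_, R.zpow (-P.d) • 1, ?_, ?_⟩, rfl⟩
    · rw [Matrix.smul_mul, Matrix.one_mul, smul_smul, zpow_mul_zpow_neg, one_smul]
    · rw [Matrix.smul_mul, Matrix.one_mul, smul_smul, zpow_neg_mul_zpow, one_smul]
  have h := R.t_mul_F
  have h1 : R.zpow P.d • (P.F.map (algebraMap ℂ R.bosonisation) * R.t.map star) =
      (R.zpow P.d • 1) * (P.F.map (algebraMap ℂ R.bosonisation) * R.t.map star) := by
    rw [Matrix.smul_mul, Matrix.one_mul]
  rw [h1] at h
  have h2 := ht.mul (R.isUnit_F_map hF)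
  rw [h, hz.mul_left_iff, (R.isUnit_F_map hF).mul_left_iff] at h2
  exact h2

theorem isUnit_zt_map_star (hF : IsUnit P.F) : IsUnit (R.zt.map star) := by
  obtain ⟨⟨a, b, hab, hba⟩, ha : a = R.t.map star⟩ := R.isUnit_t_map_star hF
  have h1 : R.zt.map star = Matrix.fromBlocks (Matrix.of fun _ _ => R.zpow (-1)) 0 0 a := by
    rw [zt, Matrix.fromBlocks_map, Matrix.map_zero _ (star_zero _), Matrix.map_zero _ (star_zero _),
      ha]
    congr 1
    exact Matrix.ext fun _ _ => R.star_zpow 1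
  have h2 : ∀ k, (Matrix.of fun _ _ => R.zpow k : Matrix Unit Unit R.bosonisation) *
      (Matrix.of fun _ _ => R.zpow (-k)) = 1 := fun k => by
    refine Matrix.ext fun _ _ => ?_
    simp [Matrix.mul_apply, zpow_mul_zpow_neg]
  have h3 := h2 1
  have h4 := h2 (-1)
  rw [neg_neg] at h4
  refine ⟨⟨Matrix.fromBlocks (Matrix.of fun _ _ => R.zpow (-1)) 0 0 a,
    Matrix.fromBlocks (Matrix.of fun _ _ => R.zpow 1) 0 0 b, ?_, ?_⟩, h1.symm⟩
  · rw [Matrix.fromBlocks_multiply]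
    simp only [Matrix.mul_zero, Matrix.zero_mul, add_zero, zero_add, h4, hab, Matrix.fromBlocks_one]
  · rw [Matrix.fromBlocks_multiply]
    simp only [Matrix.mul_zero, Matrix.zero_mul, add_zero, zero_add, h3, hba, Matrix.fromBlocks_one]

end FaithfulRep

end BraidedDatum

/-! ## Complex powers of positive matrices -/

open Matrix in
/-- An intertwiner of two diagonalised matrices intertwines all functions of them. -/
theorem Matrix.mul_conj_diagonal_comp {m : Type*} [Fintype m] [DecidableEq m]
    {X U U' V V' : Matrix m m ℂ} (hU : V * U = 1) (hU' : U' * V' = 1) (hV : V' * U' = 1)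
    (hV' : U * V = 1) {a a' : m → ℂ}
    (h : X * (U * diagonal a * V) = U' * diagonal a' * V' * X) (f : ℂ → ℂ) :
    X * (U * diagonal (f ∘ a) * V) = U' * diagonal (f ∘ a') * V' * X := by
  have h1 : V' * X * U * diagonal a = diagonal a' * (V' * X * U) := by
    calc V' * X * U * diagonal a = V' * (X * (U * diagonal a * V)) * U := by
          simp only [mul_assoc, hU, mul_one]
      _ = (V' * U') * diagonal a' * (V' * X * U) := by rw [h]; simp only [mul_assoc]
      _ = _ := by rw [hV, one_mul]
  have h2 : V' * X * U * diagonal (f ∘ a) = diagonal (f ∘ a') * (V' * X * U) := by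
    -- In the eigenbases a nonzero entry `(i, j)` of the intertwiner forces `a j = a' i`, hence `f
    -- (a j) = f (a' i)`.
    ext i j
    have h3 := congrFun (congrFun h1 i) j
    rw [mul_diagonal, diagonal_mul] at h3 ⊢
    by_cases h0 : (V' * X * U) i j = 0
    · rw [h0, zero_mul, mul_zero]
    · rw [mul_comm] at h3
      rw [Function.comp_apply, Function.comp_apply, mul_right_cancel₀ h0 h3, mul_comm]
  calc X * (U * diagonal (f ∘ a) * V) = U' * V' * X * (U * diagonal (f ∘ a) * V) := by
        rw [hU', one_mul]
    _ = U' * (V' * X * U * diagonal (f ∘ a)) * V := by simp only [mul_assoc]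
    _ = U' * diagonal (f ∘ a') * V' * X * (U * V) := by rw [h2]; simp only [mul_assoc]
    _ = _ := by rw [hV', mul_one]

open Matrix ComplexOrder in
theorem Matrix.PosDef.exists_eq_mul_diagonal_mul {m : Type*} [Fintype m] [DecidableEq m]
    {N : Matrix m m ℂ} (hN : N.PosDef) : ∃ (U V : Matrix m m ℂ) (a : m → ℝ),
      (∀ i, 0 < a i) ∧ U * V = 1 ∧ Uᴴ = V ∧ N = U * diagonal (fun i => (a i : ℂ)) * V := by
  have h := hN.1.spectral_theorem
  rw [Unitary.conjStarAlgAut_apply] at h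
  exact ⟨_, _, _, hN.eigenvalues_pos, Unitary.mul_star_self_of_mem hN.1.eigenvectorUnitary.2,
    rfl, h⟩

/-! ### The positive matrix `Fᵀ F̄` and its powers -/

namespace BraidedDatum

variable {n : ℕ} {P : BraidedDatum n}

theorem F_homogeneous {i j : Fin n} (h : P.F i j ≠ 0) : P.deg i + P.deg j = P.d := by
  rw [add_comm]
  exact P.homogeneous j i (right_ne_zero_of_mul h)

/-- With `D = diag(ζ^{d deg i})`, the hypothesis on `ω` becomes `F̄ F = c' D`. Hence `F D⁻¹ F̄ = c'`
and, taking adjoints, `F* Fᵀ = c̄' D⁻¹`. The product collapses to `|c'|²`. -/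
theorem exists_mul_conjTranspose_F (hω : ∃ c : ℂ, c ≠ 0 ∧
    P.ω.map star * P.ω = c • Matrix.diagonal fun i => P.ζpow (P.d * P.deg i)) :
    ∃ κ : ℝ, 0 < κ ∧ P.F * P.F.conjTranspose * (P.F.transpose * P.F.map star) =
      (κ : ℂ) • (1 : Matrix (Fin n) (Fin n) ℂ) := by
  have hFu := isUnit_F hω
  obtain ⟨c, hc, h⟩ := hω
  set D : Matrix (Fin n) (Fin n) ℂ := Matrix.diagonal fun i => P.ζpow (P.d * P.deg i) with hD
  set D' : Matrix (Fin n) (Fin n) ℂ := Matrix.diagonal fun i => P.ζpow (-(P.d * P.deg i)) with hD'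
  have hDs : D.map star = D' := by
    rw [hD, hD', Matrix.diagonal_map (star_zero _)]
    congr 1
    exact funext fun i => P.star_ζpow _
  have hDD' : D * D' = 1 := by
    rw [hD, hD', Matrix.diagonal_mul_diagonal, ← Matrix.diagonal_one]
    congr 1
    funext i
    rw [← ζpow_add, add_neg_cancel, ζpow_zero]
  have hD'D : D' * D = 1 := mul_eq_one_comm.1 hDD'
  have hF : P.F = P.ω.transpose * D := by
    ext i j
    rw [hD, Matrix.mul_diagonal, Matrix.transpose_apply, mul_comm, F_apply]
  -- Where `ω` is nonzero the two degrees add up to `d`, so `D⁻¹` passes through `ωᵀ` as `D`, up to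
  -- the constant `ζ^{-d²}`.
  have hDω : D' * P.ω.transpose = P.ζpow (-(P.d * P.d)) • (P.ω.transpose * D) := by
    ext i j
    rw [hD, hD', Matrix.smul_apply, Matrix.diagonal_mul, Matrix.mul_diagonal,
      Matrix.transpose_apply, smul_eq_mul]
    by_cases h0 : P.ω j i = 0
    · rw [h0]; simp
    · rw [mul_left_comm, ← ζpow_add, mul_comm]
      congr 2
      rw [← P.homogeneous j i h0]
      ring
  have map_mul : ∀ X Y : Matrix (Fin n) (Fin n) ℂ, (X * Y).map star = X.map star * Y.map star :=
    fun X Y => Matrix.map_mul (f := starRingEnd ℂ)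
  have map_map : ∀ X : Matrix (Fin n) (Fin n) ℂ, (X.map star).map star = X := fun X => by
    ext; simp
  have hωω : P.ω * P.ω.map star = star c • D' := by
    have := congrArg (fun X : Matrix (Fin n) (Fin n) ℂ => X.map star) h
    simp only [map_mul, map_map] at this
    rw [this, ← hDs]
    ext i j
    simp
  set c' : ℂ := star c * P.ζpow (-(P.d * P.d)) with hc'
  have hFF : P.F.map star * P.F = c' • D := by
    have h1 : P.F.map star = (P.ω.map star).transpose * D' := by
      rw [hF, map_mul, hDs]; rfl
    rw [h1, hF, mul_assoc, ← mul_assoc D', hDω, Matrix.smul_mul, Matrix.mul_smul,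
      ← mul_assoc, ← mul_assoc, ← Matrix.transpose_mul, hωω, Matrix.transpose_smul, hD',
      Matrix.diagonal_transpose, ← hD', Matrix.smul_mul, hD'D, Matrix.smul_mul, one_mul, smul_smul,
      mul_comm]
  have hc0 : c' ≠ 0 := mul_ne_zero (star_ne_zero.2 hc) (P.ζpow_ne_zero _)
  have hFs : IsUnit (P.F.map star) := by
    have := hFu.map (starRingEnd ℂ).mapMatrix
    exact this
  have h2 : P.F * D' * P.F.map star = c' • 1 := by
    refine hFs.mul_left_cancel ?_
    rw [← mul_assoc, ← mul_assoc, hFF, Matrix.smul_mul, hDD', Matrix.smul_mul, one_mul,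
      Matrix.mul_smul, mul_one]
  have h3 : P.F.conjTranspose * P.F.transpose = star c' • D' := by
    have := congrArg (fun X : Matrix (Fin n) (Fin n) ℂ => X.conjTranspose) hFF
    simp only [Matrix.conjTranspose_mul, Matrix.conjTranspose_smul] at this
    have e1 : (P.F.map star).conjTranspose = P.F.transpose := by ext; simp
    have e2 : D.conjTranspose = D' := by
      rw [← hDs, hD, Matrix.diagonal_conjTranspose, Matrix.diagonal_map (star_zero _)]; rfl
    rw [e1, e2] at this
    exact this
  refine ⟨Complex.normSq c', Complex.normSq_pos.2 hc0, ?_⟩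
  rw [mul_assoc, ← mul_assoc P.F.conjTranspose, h3, Matrix.smul_mul, Matrix.mul_smul,
    ← mul_assoc, h2, smul_smul, Complex.normSq_eq_conj_mul_self]
  rfl

open Matrix ComplexOrder in
-- The family is `A(s) = N^{-(1/2 + i s)}` with `N = Fᵀ F̄`. The real part `-1/2` at real `s` yields
-- the last two identities, and the exponent vanishes at `s = i/2`.
theorem exists_powers (hω : ∃ c : ℂ, c ≠ 0 ∧
    P.ω.map star * P.ω = c • Matrix.diagonal fun i => P.ζpow (P.d * P.deg i)) :
    ∃ A A' : ℂ → Matrix (Fin n) (Fin n) ℂ,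
      (∀ i j, Differentiable ℂ fun s => A s i j) ∧ (∀ i j, Differentiable ℂ fun s => A' s i j) ∧
      (∀ s, A s * A' s = 1) ∧ A (Complex.I / 2) = 1 ∧
      (∀ s i j, A s i j ≠ 0 → P.deg i = P.deg j) ∧ (∀ s i j, A' s i j ≠ 0 → P.deg i = P.deg j) ∧
      (∀ s : ℝ, (A s)ᵀ * (A s).map star * (P.Fᴴ * P.F) = 1) ∧
      ∀ s : ℝ, ∃ μ : ℂ, μ ≠ 0 ∧ P.F * (A s).map star * P.Fᴴ = μ • A s := by
  have hFu := isUnit_F hω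
  obtain ⟨κ, hκ, hN⟩ := exists_mul_conjTranspose_F hω
  have map_mul : ∀ X Y : Matrix (Fin n) (Fin n) ℂ, (X * Y).map star = X.map star * Y.map star :=
    fun X Y => Matrix.map_mul (f := starRingEnd ℂ)
  set N := P.Fᵀ * P.F.map star with hNdef
  have hpos : N.PosDef := by
    have h1 : N = (P.F.map star)ᴴ * P.F.map star := by
      rw [hNdef]; congr 1; ext; simp
    rw [h1]
    refine Matrix.PosDef.conjTranspose_mul_self _ ?_
    rw [Matrix.mulVec_injective_iff_isUnit]
    exact hFu.map (starRingEnd ℂ).mapMatrix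
  obtain ⟨U, V, m, hm, hUV, hUs, hspec⟩ := hpos.exists_eq_mul_diagonal_mul
  have hVU : V * U = 1 := mul_eq_one_comm.1 hUV
  have hVs : Vᴴ = U := by rw [← hUs, conjTranspose_conjTranspose]
  let Φ : (Fin n → ℂ) → Matrix (Fin n) (Fin n) ℂ := fun a => U * diagonal a * V
  have hΦ : ∀ a b, Φ a * Φ b = Φ (a * b) := fun a b => by
    calc U * diagonal a * V * (U * diagonal b * V) = U * diagonal a * (V * U) * diagonal b * V := by
          simp only [mul_assoc]
      _ = _ := by rw [hVU, mul_one, mul_assoc U, diagonal_mul_diagonal]; rfl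
  have hΦ1 : Φ 1 = 1 := by
    change U * diagonal 1 * V = 1
    rw [diagonal_one', mul_one, hUV]
  have hΦs : ∀ a, (Φ a)ᴴ = Φ (star a) := fun a => by
    change (U * diagonal a * V)ᴴ = U * diagonal (star a) * V
    rw [conjTranspose_mul, conjTranspose_mul, hVs, hUs, diagonal_conjTranspose, mul_assoc]
  have hm0 : ∀ i, (m i : ℂ) ≠ 0 := fun i => Complex.ofReal_ne_zero.2 (hm i).ne'
  let a : ℂ → Fin n → ℂ := fun w i => (m i : ℂ) ^ w
  have hdiff : ∀ (w : ℂ → ℂ), Differentiable ℂ w → ∀ i j,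
      Differentiable ℂ fun s => Φ (a (w s)) i j := fun w hw i j => by
    have : (fun s => Φ (a (w s)) i j) = fun s => ∑ k, U i k * (m k : ℂ) ^ (w s) * V k j := by
      funext s
      change (U * diagonal (a (w s)) * V) i j = _
      rw [Matrix.mul_apply]
      simp only [Matrix.mul_diagonal, a]
    rw [this]
    refine Differentiable.fun_sum fun k _ => ((Differentiable.const_mul ?_ _).mul_const _)
    exact hw.const_cpow (Or.inl (hm0 k))
  have hdeg : ∀ w i j, Φ (a w) i j ≠ 0 → P.deg i = P.deg j := fun w i j h => by
    -- `F` sends degree `k` to degree `d - k`, so `N` preserves degrees, that is, commutes with the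
    -- diagonal matrix of degrees. All powers of `N` inherit this.
    have hc : diagonal (fun i => (P.deg i : ℂ)) * (U * diagonal (fun i => (m i : ℂ)) * V) =
        U * diagonal (fun i => (m i : ℂ)) * V * diagonal (fun i => (P.deg i : ℂ)) := by
      rw [← hspec]
      ext k l
      rw [diagonal_mul, mul_diagonal, mul_comm]
      by_cases h0 : N k l = 0
      · rw [h0, zero_mul, zero_mul]
      · have : P.deg k = P.deg l := by
          obtain ⟨p, -, hp⟩ := Finset.exists_ne_zero_of_sum_ne_zero (s := Finset.univ)
            (f := fun p => P.Fᵀ k p * P.F.map star p l) h0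
          have h1 : P.F p k ≠ 0 := left_ne_zero_of_mul hp
          have h2 : P.F p l ≠ 0 := star_ne_zero.1 (right_ne_zero_of_mul hp)
          have := F_homogeneous h1
          have := F_homogeneous h2
          omega
        rw [this]
    have h1 := Matrix.mul_conj_diagonal_comp hVU hUV hVU hUV hc (fun x => x ^ w)
    have h2 := congrFun (congrFun h1 i) j
    rw [diagonal_mul, mul_diagonal, mul_comm] at h2
    exact_mod_cast mul_left_cancel₀ h h2
  have haa : ∀ w v, a w * a v = a (w + v) := fun w v => by
    funext i
    exact (Complex.cpow_add _ _ (hm0 i)).symm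
  have ha0 : a 0 = 1 := by
    funext i
    exact Complex.cpow_zero _
  have ha1 : Φ (a 1) = N := by
    rw [hspec]
    change U * diagonal (a 1) * V = _
    congr 3
    funext i
    exact Complex.cpow_one _
  have hastar : ∀ w, star (a w) = a (star w) := fun w => by
    funext i
    change star ((m i : ℂ) ^ w) = (m i : ℂ) ^ (star w)
    have := Complex.cpow_conj (m i : ℂ) w (by
      rw [Complex.arg_ofReal_of_nonneg (hm i).le]; exact Real.pi_pos.ne)
    rw [Complex.conj_ofReal] at this
    exact this.symm
  refine ⟨fun s => Φ (a (-(1 / 2 + Complex.I * s))), fun s => Φ (a (1 / 2 + Complex.I * s)),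
    hdiff _ (by fun_prop), hdiff _ (by fun_prop), fun s => ?_, ?_, fun s => hdeg _,
    fun s => hdeg _, fun s => ?_, fun s => ?_⟩
  · rw [hΦ, haa, neg_add_cancel, ha0, hΦ1]
  · have : -(1 / 2 + Complex.I * (Complex.I / 2)) = 0 := by
      rw [mul_div, Complex.I_mul_I]; norm_num
    simp only [this, ha0, hΦ1]
  · set w := -(1 / 2 + Complex.I * (s : ℂ)) with hw
    -- For real `s` the exponents satisfy `w + w̄ = -1`, so `A* A = N⁻¹`. Entrywise conjugation
    -- gives the claim, because `N̄ = F* F`.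
    have h1 : Φ (star (a w) * a w) * N = 1 := by
      rw [hastar, haa, ← ha1, hΦ, haa, ← hΦ1, ← ha0]
      congr 2
      simp only [hw, Complex.star_def, map_neg, map_add, _root_.map_mul, map_div₀, Complex.conj_I,
        Complex.conj_ofReal, map_one, map_ofNat]
      ring
    have h2 := congrArg (fun X : Matrix (Fin n) (Fin n) ℂ => X.map star) h1
    rw [← hΦ, ← hΦs] at h2
    simp only [map_mul] at h2
    have e1 : ((Φ (a w))ᴴ).map star = (Φ (a w))ᵀ := by ext; simp
    have e2 : N.map star = P.Fᴴ * P.F := by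
      rw [hNdef, map_mul]; congr 1; ext; simp
    have e3 : (1 : Matrix (Fin n) (Fin n) ℂ).map star = 1 :=
      Matrix.map_one _ (star_zero _) (star_one _)
    rw [e1, e2, e3] at h2
    exact h2
  · set w := -(1 / 2 + Complex.I * (s : ℂ)) with hw
    have hκ0 : (κ : ℂ) ≠ 0 := Complex.ofReal_ne_zero.2 hκ.ne'
    have hFF : P.F * P.Fᴴ = (κ : ℂ) • Φ (a (-1)) := by
      calc P.F * P.Fᴴ = P.F * P.Fᴴ * N * Φ (a (-1)) := by
            rw [mul_assoc _ N, ← ha1, hΦ, haa, add_neg_cancel, ha0, hΦ1, mul_one]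
        _ = _ := by rw [hN, Matrix.smul_mul, one_mul]
    have hstar : ∀ b, (Φ b).map star = U.map star * diagonal (star b) * V.map star := fun b => by
      change (U * diagonal b * V).map star = _
      rw [map_mul, map_mul, diagonal_map (star_zero _)]
      rfl
    have e1 : (1 : Matrix (Fin n) (Fin n) ℂ).map star = 1 :=
      Matrix.map_one _ (star_zero _) (star_one _)
    -- `F N̄ = F F* F = κ N⁻¹ F`, so `F` intertwines `N̄` with `κ N⁻¹` and hence their powers. Then
    -- `F Ā F* = κ^{w̄} N^{-w̄} F F* = κ^{w̄ + 1} N^{-w̄ - 1}`, and `-w̄ - 1 = w`.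
    have hint : P.F * (U.map star * diagonal (fun i => (m i : ℂ)) * V.map star) =
        U * diagonal (fun i => ((κ / m i : ℝ) : ℂ)) * V * P.F := by
      have e2 : U.map star * diagonal (fun i => (m i : ℂ)) * V.map star = P.Fᴴ * P.F := by
        have e3 := hstar (a 1)
        rw [hastar, star_one, ha1] at e3
        have e4 : a 1 = fun i => (m i : ℂ) := funext fun i => Complex.cpow_one _
        rw [← e4, ← e3, hNdef, map_mul]
        congr 1
        ext; simp
      have e5 : U * diagonal (fun i => ((κ / m i : ℝ) : ℂ)) * V = (κ : ℂ) • Φ (a (-1)) := by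
        change _ = (κ : ℂ) • (U * diagonal (a (-1)) * V)
        rw [← Matrix.smul_mul, ← Matrix.mul_smul, ← diagonal_smul]
        congr 3
        funext i
        simp only [a, Pi.smul_apply, Complex.cpow_neg_one, smul_eq_mul, div_eq_mul_inv,
          Complex.ofReal_mul, Complex.ofReal_inv]
      rw [e2, e5, ← hFF, mul_assoc]
    have h1 := Matrix.mul_conj_diagonal_comp (by rw [← map_mul, hVU, e1]) hUV hVU
      (by rw [← map_mul, hUV, e1]) hint (fun x => x ^ star w)
    have e6 : ((fun x : ℂ => x ^ star w) ∘ fun i => ((κ / m i : ℝ) : ℂ)) =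
        (κ : ℂ) ^ star w • a (-star w) := by
      funext i
      simp only [Function.comp_apply, Pi.smul_apply, a, smul_eq_mul]
      rw [div_eq_mul_inv, Complex.ofReal_mul, Complex.mul_cpow_ofReal_nonneg hκ.le
        (inv_nonneg.2 (hm i).le), Complex.ofReal_inv, Complex.inv_cpow, Complex.cpow_neg]
      rw [Complex.arg_ofReal_of_nonneg (hm i).le]
      exact Real.pi_pos.ne
    have e7 : (fun x : ℂ => x ^ star w) ∘ (fun i => (m i : ℂ)) = star (a w) := by
      rw [hastar]; rfl
    refine ⟨(κ : ℂ) ^ star w * κ, mul_ne_zero ?_ hκ0, ?_⟩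
    · rw [Complex.cpow_ne_zero_iff]; exact Or.inl hκ0
    · rw [hstar, ← e7, h1, e6, mul_assoc, hFF, diagonal_smul]
      simp only [Matrix.mul_smul, Matrix.smul_mul, smul_smul]
      rw [mul_comm (κ : ℂ)]
      congr 1
      change Φ _ * Φ _ = Φ _
      rw [hΦ, haa]
      congr 2
      simp only [hw, Complex.star_def, map_neg, map_add, _root_.map_mul, map_div₀, Complex.conj_I,
        Complex.conj_ofReal, map_one, map_ofNat]
      ring

end BraidedDatum

/-! ## Antihomomorphisms of `A_o(V, π, ω)` to the bosonisation -/

namespace BraidedDatum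

variable {n : ℕ} {P : BraidedDatum n}

namespace FaithfulRep

attribute [local instance] cstarAlgebraBosonisation cstarAlgebraSquare cstarAlgebraTriple

variable {ι : Type*} (R : P.FaithfulRep ι)

/-- Scalar matrices over the bosonisation. -/
noncomputable def scalarMatrix :
    Matrix (Fin n) (Fin n) ℂ →+* Matrix (Fin n) (Fin n) R.bosonisation :=
  (algebraMap ℂ R.bosonisation).mapMatrix

theorem scalarMatrix_apply (a : Matrix (Fin n) (Fin n) ℂ) (i j : Fin n) :
    R.scalarMatrix a i j = algebraMap ℂ R.bosonisation (a i j) := rfl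

theorem scalarMatrix_mul_apply (a : Matrix (Fin n) (Fin n) ℂ)
    (M : Matrix (Fin n) (Fin n) R.bosonisation) (i j : Fin n) :
    (R.scalarMatrix a * M) i j = ∑ k, a i k • M k j := by
  rw [Matrix.mul_apply]
  refine Finset.sum_congr rfl fun k _ => ?_
  rw [scalarMatrix_apply, Algebra.smul_def]

theorem mul_scalarMatrix_apply (a : Matrix (Fin n) (Fin n) ℂ)
    (M : Matrix (Fin n) (Fin n) R.bosonisation) (i j : Fin n) :
    (M * R.scalarMatrix a) i j = ∑ k, a k j • M i k := by
  rw [Matrix.mul_apply]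
  refine Finset.sum_congr rfl fun k _ => ?_
  rw [scalarMatrix_apply, ← Algebra.commutes, Algebra.smul_def]

theorem transpose_scalarMatrix_mul (a : Matrix (Fin n) (Fin n) ℂ)
    (M : Matrix (Fin n) (Fin n) R.bosonisation) :
    (R.scalarMatrix a * M).transpose = M.transpose * R.scalarMatrix a.transpose := by
  refine Matrix.ext fun i j => ?_
  rw [Matrix.transpose_apply, scalarMatrix_mul_apply, mul_scalarMatrix_apply]
  rfl

theorem transpose_mul_scalarMatrix (a : Matrix (Fin n) (Fin n) ℂ)
    (M : Matrix (Fin n) (Fin n) R.bosonisation) :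
    (M * R.scalarMatrix a).transpose = R.scalarMatrix a.transpose * M.transpose := by
  refine Matrix.ext fun i j => ?_
  rw [Matrix.transpose_apply, scalarMatrix_mul_apply, mul_scalarMatrix_apply]
  rfl

theorem map_star_scalarMatrix_mul (a : Matrix (Fin n) (Fin n) ℂ)
    (M : Matrix (Fin n) (Fin n) R.bosonisation) :
    (R.scalarMatrix a * M).map star = R.scalarMatrix (a.map star) * M.map star := by
  refine Matrix.ext fun i j => ?_
  rw [Matrix.map_apply, scalarMatrix_mul_apply, scalarMatrix_mul_apply, star_sum]
  exact Finset.sum_congr rfl fun k _ => star_smul _ _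

theorem map_star_mul_scalarMatrix (a : Matrix (Fin n) (Fin n) ℂ)
    (M : Matrix (Fin n) (Fin n) R.bosonisation) :
    (M * R.scalarMatrix a).map star = M.map star * R.scalarMatrix (a.map star) := by
  refine Matrix.ext fun i j => ?_
  rw [Matrix.map_apply, mul_scalarMatrix_apply, mul_scalarMatrix_apply, star_sum]
  exact Finset.sum_congr rfl fun k _ => star_smul _ _

/-- The diagonal matrix with all entries `z ^ k`. -/
noncomputable def zdiag (k : ℤ) : Matrix (Fin n) (Fin n) R.bosonisation :=
  Matrix.diagonal fun _ => R.zpow k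

theorem zdiag_mul_zdiag_neg (k : ℤ) : R.zdiag k * R.zdiag (-k) = 1 := by
  rw [zdiag, zdiag, Matrix.diagonal_mul_diagonal, ← Matrix.diagonal_one]
  congr 1
  exact funext fun _ => R.zpow_mul_zpow_neg k

theorem zdiag_neg_mul_zdiag (k : ℤ) : R.zdiag (-k) * R.zdiag k = 1 := by
  simpa only [neg_neg] using R.zdiag_mul_zdiag_neg (-k)

theorem zdiag_mul_scalarMatrix (k : ℤ) (a : Matrix (Fin n) (Fin n) ℂ) :
    R.zdiag k * R.scalarMatrix a = R.scalarMatrix a * R.zdiag k := by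
  refine Matrix.ext fun i j => ?_
  rw [zdiag, Matrix.diagonal_mul, Matrix.mul_diagonal, scalarMatrix_apply, Algebra.commutes]

theorem t_mul_scalarMatrix_F :
    R.t * R.scalarMatrix P.F = R.zdiag P.d * R.scalarMatrix P.F * R.t.map star := by
  rw [mul_assoc, zdiag, ← Matrix.smul_eq_diagonal_mul]
  exact R.t_mul_F

theorem scalarMatrix_F_mul_star_t :
    R.scalarMatrix P.F.conjTranspose * star R.t =
      R.t.transpose * R.scalarMatrix P.F.conjTranspose * R.zdiag (-P.d) := by
  have hs : star (R.scalarMatrix P.F) = R.scalarMatrix P.F.conjTranspose := by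
    refine Matrix.ext fun i j => ?_
    rw [Matrix.star_apply, scalarMatrix_apply, scalarMatrix_apply, ← algebraMap_star_comm,
      Matrix.conjTranspose_apply]
  have hz : star (R.zdiag P.d) = R.zdiag (-P.d) := by
    rw [zdiag, zdiag, Matrix.star_eq_conjTranspose, Matrix.diagonal_conjTranspose]
    congr 1
    exact funext fun _ => R.star_zpow _
  have ht : star (R.t.map star) = R.t.transpose := Matrix.ext fun i j => star_star _
  have h := congrArg star R.t_mul_scalarMatrix_F
  rw [star_mul, star_mul, star_mul, hs, hz, ht, ← mul_assoc] at h
  exact h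

/-- The image of `u h i` under the antihomomorphism attached to the matrix `A` with
inverse `A'`. -/
noncomputable def twist (A A' : Matrix (Fin n) (Fin n) ℂ) (h i : Fin n) : R.bosonisation :=
  (R.scalarMatrix A * star R.t * R.scalarMatrix A') h i * R.zpow (P.deg h)

theorem twist_eq_sum (A A' : Matrix (Fin n) (Fin n) ℂ) (h i : Fin n) : R.twist A A' h i =
    ∑ k, ∑ l, (A' k i * A h l) • (star (R.t k l) * R.zpow (P.deg h)) := by
  rw [twist, mul_scalarMatrix_apply, Finset.sum_mul]
  refine Finset.sum_congr rfl fun k _ => ?_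
  rw [scalarMatrix_mul_apply, Finset.smul_sum, Finset.sum_mul]
  refine Finset.sum_congr rfl fun l _ => ?_
  rw [smul_smul, smul_mul_assoc]
  rfl

theorem twist_one (h i : Fin n) : R.twist 1 1 h i = star (R.t i h) * R.zpow (P.deg h) := by
  rw [twist, map_one, one_mul, mul_one]
  rfl

theorem twist_mem (A A' : Matrix (Fin n) (Fin n) ℂ) (h i : Fin n) :
    R.twist A A' h i ∈ coeffAlgebra R.zt := by
  rw [twist_eq_sum]
  exact sum_mem fun k _ => sum_mem fun l _ => SMulMemClass.smul_mem _
    (mul_mem (star_mem (R.t_mem_coeffAlgebra k l)) (R.zpow_mem_coeffAlgebra _))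

variable {A A' : Matrix (Fin n) (Fin n) ℂ}

theorem hasDeg_twisted (hA : ∀ i j, A i j ≠ 0 → P.deg i = P.deg j)
    (hA' : ∀ i j, A' i j ≠ 0 → P.deg i = P.deg j) (h i : Fin n) :
    R.HasDeg (P.deg i - P.deg h) ((R.scalarMatrix A * star R.t * R.scalarMatrix A') h i) := by
  rw [mul_scalarMatrix_apply]
  refine HasDeg.sum fun k _ => ?_
  rw [scalarMatrix_mul_apply, Finset.smul_sum]
  refine HasDeg.sum fun l _ => ?_
  rw [smul_smul]
  by_cases h0 : A' k i * A h l = 0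
  · rw [h0, zero_smul]
    intro m
    rw [zero_mul, mul_zero, smul_zero]
  · rw [← hA' k i (left_ne_zero_of_mul h0), hA h l (right_ne_zero_of_mul h0),
      ← neg_sub (P.deg l)]
    exact (R.hasDeg_t k l).star.smul _

theorem hasDeg_twist (hA : ∀ i j, A i j ≠ 0 → P.deg i = P.deg j)
    (hA' : ∀ i j, A' i j ≠ 0 → P.deg i = P.deg j) (h i : Fin n) :
    R.HasDeg (P.deg i - P.deg h) (R.twist A A' h i) :=
  (R.hasDeg_twisted hA hA' h i).mul_zpow _

/-- Put `r = A t* A⁻¹`. Multiplication in the opposite algebra turns the relations into `rᵀ r̄ = r̄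
rᵀ = 1` and `r F = F r̄ z^{-d}`. The hypothesis `hAF` yields the first two, `hμ` the third. Degree
preservation by `A` and `A'` controls the phases in the third. -/
theorem relations_twist (hF : IsUnit P.F) (hAA : A * A' = 1)
    (hA : ∀ i j, A i j ≠ 0 → P.deg i = P.deg j) (hA' : ∀ i j, A' i j ≠ 0 → P.deg i = P.deg j)
    (hAF : A.transpose * A.map star * (P.F.conjTranspose * P.F) = 1)
    (hμ : ∃ μ : ℂ, μ ≠ 0 ∧ P.F * A.map star * P.F.conjTranspose = μ • A) :
    P.Relations fun h i => MulOpposite.op (R.twist A A' h i) := by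
  have hA'A : A' * A = 1 := mul_eq_one_comm.1 hAA
  obtain ⟨⟨F, G, hFG, hGF⟩, rfl : F = P.F⟩ := hF
  set H := P.F.conjTranspose with hH
  set K := G.conjTranspose with hK
  have hKH : K * H = 1 := by
    rw [hK, hH, ← Matrix.conjTranspose_mul, hFG, Matrix.conjTranspose_one]
  have hHK : H * K = 1 := mul_eq_one_comm.1 hKH
  set E := R.scalarMatrix with hE
  set T := R.t with hT
  set Z := R.zdiag P.d with hZ
  set Z' := R.zdiag (-P.d) with hZ'
  have hZZ : Z * Z' = 1 := R.zdiag_mul_zdiag_neg _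
  have hZZ' : Z' * Z = 1 := R.zdiag_neg_mul_zdiag _
  have hc : ∀ a, Z * E a = E a * Z := R.zdiag_mul_scalarMatrix _
  have hc' : ∀ a, Z' * E a = E a * Z' := R.zdiag_mul_scalarMatrix _
  have htb : T.map star = E G * Z' * T * E P.F := by
    rw [mul_assoc _ T, R.t_mul_scalarMatrix_F, ← hZ, ← hE, ← mul_assoc, ← mul_assoc,
      mul_assoc (E G), hZZ', mul_one, ← map_mul, hGF, map_one, one_mul]
  have htt : T.transpose = E H * star T * Z * E K := by
    rw [R.scalarMatrix_F_mul_star_t, ← hZ', mul_assoc _ Z' Z, hZZ', mul_one, mul_assoc, ← hE,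
      ← map_mul, ← hH, hHK, map_one, mul_one]
  have hTT : star T * T = 1 := R.star_t_mul_t
  have hTT' : T * star T = 1 := R.t_mul_star_t
  -- Although `t` is unitary, `t̄` and `tᵀ` are mutually inverse only up to the scalar matrices `F⁻¹
  -- (F*)⁻¹` and `F* F`. By `hAF` the former equals `Aᵀ Ā`, so conjugation by `A` corrects the
  -- defect.
  have hK1 : T.map star * E (G * K) * T.transpose = E (G * K) := by
    rw [htb, htt]
    calc E G * Z' * T * E P.F * E (G * K) * (E H * star T * Z * E K)
        = E G * Z' * T * (E P.F * E (G * K) * E H) * star T * Z * E K := by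
          simp only [mul_assoc]
      _ = E G * (Z' * (T * star T) * Z) * E K := by
          rw [← map_mul, ← map_mul, ← mul_assoc, hFG, one_mul, hKH, map_one, mul_one]
          simp only [mul_assoc]
      _ = _ := by rw [hTT', mul_one, hZZ', mul_one, map_mul]
  have hK2 : T.transpose * E (H * P.F) * T.map star = E (H * P.F) := by
    rw [htb, htt]
    calc E H * star T * Z * E K * E (H * P.F) * (E G * Z' * T * E P.F)
        = E H * star T * Z * (E K * E (H * P.F) * E G) * Z' * T * E P.F := by
          simp only [mul_assoc]
      _ = E H * (star T * (Z * Z') * T) * E P.F := by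
          rw [← map_mul, ← map_mul, ← mul_assoc, hKH, one_mul, hFG, map_one, mul_one]
          simp only [mul_assoc]
      _ = _ := by rw [hZZ, mul_one, hTT, mul_one, map_mul]
  have hbar : A.map star * A'.map star = 1 := by
    refine (Matrix.map_mul (f := starRingEnd ℂ)).symm.trans ?_
    exact (congrArg (fun X : Matrix (Fin n) (Fin n) ℂ => X.map star) hAA).trans
      (Matrix.map_one _ (star_zero _) (star_one _))
  have hbar' : A'.map star * A.map star = 1 := mul_eq_one_comm.1 hbar
  have htr : A'.transpose * A.transpose = 1 := by
    rw [← Matrix.transpose_mul, hAA, Matrix.transpose_one]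
  have htr' : A.transpose * A'.transpose = 1 := mul_eq_one_comm.1 htr
  have hAAb : A.transpose * A.map star = G * K := by
    calc A.transpose * A.map star = A.transpose * A.map star * (H * P.F) * (G * K) := by
          rw [mul_assoc _ (H * P.F), mul_assoc H, ← mul_assoc P.F, hFG, one_mul, hHK, mul_one]
      _ = _ := by rw [hAF, one_mul]
  have hAAb' : A'.map star * A'.transpose = H * P.F := by
    have : A.transpose * A.map star * (A'.map star * A'.transpose) = 1 := by
      rw [mul_assoc, ← mul_assoc (A.map star), hbar, one_mul, htr']
    exact left_inv_eq_right_inv (mul_eq_one_comm.1 this)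
      hAF
  set r := E A * star T * E A' with hr
  have hrt : r.transpose = E A'.transpose * T.map star * E A.transpose := by
    rw [hr, transpose_mul_scalarMatrix, transpose_scalarMatrix_mul, mul_assoc]
    rfl
  have hrb : r.map star = E (A.map star) * T.transpose * E (A'.map star) := by
    rw [hr, map_star_mul_scalarMatrix, map_star_scalarMatrix_mul]
    have h1 : (star T).map star = T.transpose := Matrix.ext fun i j => star_star _
    rw [h1]
  have hiso : r.transpose * r.map star = 1 := by
    rw [hrt, hrb]
    calc E A'.transpose * T.map star * E A.transpose *
          (E (A.map star) * T.transpose * E (A'.map star))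
        = E A'.transpose * (T.map star * (E A.transpose * E (A.map star)) * T.transpose) *
          E (A'.map star) := by simp only [mul_assoc]
      _ = 1 := by
        rw [← map_mul, hAAb, hK1, ← hAAb, map_mul, ← mul_assoc, ← map_mul, htr, map_one, one_mul,
          ← map_mul, hbar, map_one]
  have hcoiso : r.map star * r.transpose = 1 := by
    rw [hrt, hrb]
    calc E (A.map star) * T.transpose * E (A'.map star) *
          (E A'.transpose * T.map star * E A.transpose)
        = E (A.map star) * (T.transpose * (E (A'.map star) * E A'.transpose) * T.map star) *
          E A.transpose := by simp only [mul_assoc]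
      _ = 1 := by
        rw [← map_mul, hAAb', hK2, ← hAAb', map_mul, ← mul_assoc, ← map_mul, hbar, map_one,
          one_mul, ← map_mul, htr, map_one]
  have hinv : r * E P.F = E P.F * r.map star * Z' := by
    obtain ⟨μ, hμ0, hμ⟩ := hμ
    have h1 : μ • (K * A'.map star) = A' * P.F := by
      have h2 : μ • A * (K * A'.map star) = P.F := by
        rw [← hμ, mul_assoc, ← mul_assoc H, hHK, one_mul, mul_assoc, hbar, mul_one]
      rw [Matrix.smul_mul] at h2
      rw [← h2, Matrix.mul_smul, ← mul_assoc, hA'A, one_mul]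
    have h3 : P.F * A.map star * H = μ • A := hμ
    rw [hrb, htt, hr]
    calc E A * star T * E A' * E P.F = E A * star T * E (A' * P.F) := by rw [mul_assoc, map_mul]
      _ = E (μ • A) * star T * E (K * A'.map star) := by
        rw [← h1]
        refine Matrix.ext fun i j => ?_
        simp only [hE, mul_scalarMatrix_apply, scalarMatrix_mul_apply, Matrix.smul_apply,
          Finset.smul_sum, smul_smul, smul_eq_mul]
        refine Finset.sum_congr rfl fun k _ => Finset.sum_congr rfl fun l _ => ?_
        congr 1
        ring
      _ = E P.F * E (A.map star) * E H * star T * (Z * Z') * (E K * E (A'.map star)) := by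
        rw [hZZ, mul_one, ← h3, map_mul, map_mul, map_mul]
      _ = E P.F * E (A.map star) * E H * star T * Z * (E K * E (A'.map star) * Z') := by
        rw [← map_mul E K, ← hc']
        simp only [mul_assoc]
      _ = _ := by simp only [mul_assoc]
  have hv : ∀ h i, R.twist A A' h i = r h i * R.zpow (P.deg h) := fun h i => rfl
  have hop : ∀ x : R.bosonisation, star (MulOpposite.op x) = MulOpposite.op (star x) :=
    fun x => rfl
  refine ⟨fun i j => ?_, fun i j => ?_, fun i j => ?_⟩
  · have h1 := congrFun (congrFun hiso j) i
    rw [Matrix.mul_apply, Matrix.one_apply] at h1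
    have h2 : ∀ k, star (MulOpposite.op (R.twist A A' k i)) * MulOpposite.op (R.twist A A' k j) =
        MulOpposite.op (r k j * star (r k i)) := fun k => by
      rw [hop, ← MulOpposite.op_mul, hv, hv, star_mul, star_zpow, mul_assoc,
        ← mul_assoc (R.zpow _), zpow_mul_zpow_neg, one_mul]
    simp only [h2]
    rw [← Finset.op_sum]
    have h3 : ∑ k, r k j * star (r k i) = if j = i then 1 else 0 := h1
    rw [h3]
    simp only [eq_comm (a := j), apply_ite MulOpposite.op, MulOpposite.op_one, MulOpposite.op_zero]
  · have h1 := congrFun (congrFun hcoiso j) i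
    rw [Matrix.mul_apply, Matrix.one_apply] at h1
    have h2 : ∀ k, MulOpposite.op (R.twist A A' i k) * star (MulOpposite.op (R.twist A A' j k)) =
        MulOpposite.op (R.zpow (-P.deg j) * (star (r j k) * r i k) * R.zpow (P.deg i)) :=
      fun k => by
        rw [hop, ← MulOpposite.op_mul, hv, hv, star_mul, star_zpow]
        simp only [mul_assoc]
    simp only [h2]
    rw [← Finset.op_sum, ← Finset.sum_mul, ← Finset.mul_sum]
    have h3 : ∑ k, star (r j k) * r i k = if j = i then 1 else 0 := h1
    rw [h3]
    by_cases hij : j = i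
    · rw [if_pos hij, if_pos hij.symm, mul_one, hij, zpow_neg_mul_zpow, MulOpposite.op_one]
    · rw [if_neg hij, if_neg (Ne.symm hij), mul_zero, zero_mul, MulOpposite.op_zero]
  · have h1 := congrFun (congrFun hinv j) i
    have h2 : (E P.F * r.map star * Z') j i = (E P.F * r.map star) j i * R.zpow (-P.d) := by
      rw [hZ', zdiag, Matrix.mul_diagonal]
    rw [h2] at h1
    set X := (E P.F * r.map star) j i with hX
    -- The two sides of the invariance relation have the power of `z` on opposite sides of `X`. The
    -- degree of `X` gives the phase for exchanging them.
    have hXdeg : R.HasDeg (P.d - P.deg j - P.deg i) X := by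
      rw [hX, hE, scalarMatrix_mul_apply]
      refine HasDeg.sum fun k _ => ?_
      by_cases h0 : P.F j k = 0
      · rw [h0, zero_smul]
        intro m
        rw [zero_mul, mul_zero, smul_zero]
      · have e1 : P.d - P.deg j - P.deg i = -(P.deg i - P.deg k) := by
          rw [← F_homogeneous h0]; ring
        rw [e1]
        exact (R.hasDeg_twisted hA hA' k i).star.smul _
    have hL : ∑ k, P.ω i k • R.twist A A' j k = P.ζpow (-(P.d * P.deg i)) •
        (X * R.zpow (P.deg j - P.d)) := by
      rw [sub_eq_neg_add, FaithfulRep.zpow_add, ← mul_assoc, ← h1, hE, mul_scalarMatrix_apply,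
        Finset.sum_mul, Finset.smul_sum]
      refine Finset.sum_congr rfl fun k _ => ?_
      rw [F_apply, hv, smul_mul_assoc, smul_smul, ← mul_assoc, ← ζpow_add, neg_add_cancel,
        ζpow_zero, one_mul]
    have hR : ∑ k, P.ω k j • star (R.twist A A' k i) = P.ζpow (-(P.d * (P.d - P.deg j))) •
        (R.zpow (P.deg j - P.d) * X) := by
      rw [hX, hE, scalarMatrix_mul_apply, Finset.mul_sum, Finset.smul_sum]
      refine Finset.sum_congr rfl fun k _ => ?_
      by_cases h0 : P.ω k j = 0
      · rw [F_apply, h0]; simp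
      · have e1 := P.homogeneous k j h0
        have e2 : P.d - P.deg j = P.deg k := by omega
        have e3 : P.deg j - P.d = -P.deg k := by omega
        rw [F_apply, hv, star_mul, star_zpow, mul_smul_comm, smul_smul, ← mul_assoc, ← ζpow_add,
          e2, e3, neg_add_cancel, ζpow_zero, one_mul]
        rfl
    have hopsum : ∀ (c : Fin n → ℂ) (x : Fin n → R.bosonisation),
        ∑ k, c k • MulOpposite.op (x k) = MulOpposite.op (∑ k, c k • x k) := fun c x => by
      rw [Finset.op_sum]; rfl
    simp only [hop]
    rw [hopsum, hopsum, hL, hR, hXdeg, ← MulOpposite.op_smul, ← MulOpposite.op_smul]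
    rw [smul_smul, smul_smul, smul_smul, ← ζpow_add, ← ζpow_add, ← ζpow_add]
    congr 3
    ring

end FaithfulRep

end BraidedDatum

/-! ## Analytic continuation of the antihomomorphisms -/

namespace BraidedDatum

variable {n : ℕ} {P : BraidedDatum n}

namespace FaithfulRep

attribute [local instance] cstarAlgebraBosonisation cstarAlgebraSquare cstarAlgebraTriple

variable {ι : Type*} (R : P.FaithfulRep ι)

/-- Conjugation by the unitary `z^l` makes this an equality of two *-homomorphisms in `b`, so it
follows from the commutation rule for generators. -/
theorem fromAo_mul_zpow (b : P.Ao) (l : ℤ) :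
    R.fromAo b * R.zpow l = R.zpow l * R.fromAo (P.β (P.ζ ^ l) b) := by
  let w : unitary R.bosonisation := R.fromCircle.mapUnitary circleGen ^ l
  have hw : (w : R.bosonisation) = R.zpow l := (R.zpow_eq l).symm
  have h1 : R.fromAo = ((Unitary.conjStarAlgAut ℂ R.bosonisation w : _ ≃⋆ₐ[ℂ] _) :
      R.bosonisation →⋆ₐ[ℂ] R.bosonisation).comp (R.fromAo.comp (P.β (P.ζ ^ l))) :=
    P.hom_ext fun i k => by
      rw [StarAlgHom.comp_apply, StarAlgHom.comp_apply]
      change _ = (w : R.bosonisation) * R.fromAo (P.β (P.ζ ^ l) (P.u i k)) * star (w : R.bosonisation)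
      have h2 := R.hasDeg_fromAo (R.homog_σ_u i k) l
      rw [hw, star_zpow, P.β_u, map_smul, mul_smul_comm, ← zpow_mul, mul_comm l]
      change _ = (P.ζpow ((P.deg k - P.deg i) * l) • _) * _
      rw [← h2, mul_assoc, zpow_mul_zpow_neg, mul_one]
  have h2 : R.fromAo b = R.zpow l * R.fromAo (P.β (P.ζ ^ l) b) * R.zpow (-l) := by
    rw [← hw, ← star_zpow, ← hw]
    exact congrArg (fun φ : P.Ao →⋆ₐ[ℂ] R.bosonisation => φ b) h1
  rw [h2, mul_assoc, zpow_neg_mul_zpow, mul_one]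

/-- The family of maps `s ↦ ρ s b` extends to an entire function with value `c` at `i / 2`. -/
def Continues (ρ : ℝ → P.Ao →⋆ₐ[ℂ] (R.bosonisation)ᵐᵒᵖ) (b : P.Ao) (c : R.bosonisation) : Prop :=
  c ∈ coeffAlgebra R.zt ∧ ∃ f : ℂ → R.bosonisation, Differentiable ℂ f ∧
    (∀ s : ℝ, MulOpposite.op (f s) = ρ s b) ∧ f (Complex.I / 2) = c

variable {R} {ρ : ℝ → P.Ao →⋆ₐ[ℂ] (R.bosonisation)ᵐᵒᵖ}

/-- Two entire extensions agree on the real line, whose points accumulate at `0`, so they agree at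
`i/2`. This makes the value at `i/2` independent of any presentation of `b` by generators. -/
theorem Continues.unique {b : P.Ao} {c c' : R.bosonisation} (h : R.Continues ρ b c)
    (h' : R.Continues ρ b c') : c = c' := by
  obtain ⟨-, f, hf, hfρ, rfl⟩ := h
  obtain ⟨-, g, hg, hgρ, rfl⟩ := h'
  have hfg : f = g := by
    refine AnalyticOnNhd.eq_of_frequently_eq (z₀ := 0) (hf.differentiableOn.analyticOnNhd isOpen_univ)
      (hg.differentiableOn.analyticOnNhd isOpen_univ) ?_
    have h1 : Filter.Tendsto (fun s : ℝ => (s : ℂ)) (nhdsWithin 0 {0}ᶜ) (nhdsWithin 0 {0}ᶜ) := by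
      refine tendsto_nhdsWithin_of_tendsto_nhds_of_eventually_within _
        (Complex.continuous_ofReal.tendsto' 0 0 Complex.ofReal_zero |>.mono_left nhdsWithin_le_nhds)
        ?_
      filter_upwards [self_mem_nhdsWithin] with s hs
      exact Complex.ofReal_ne_zero.2 hs
    refine h1.frequently (Filter.Frequently.of_forall fun s => ?_)
    exact MulOpposite.op_injective ((hfρ s).trans (hgρ s).symm)
  rw [hfg]

theorem Continues.add {b b' : P.Ao} {c c' : R.bosonisation} (h : R.Continues ρ b c)
    (h' : R.Continues ρ b' c') : R.Continues ρ (b + b') (c + c') := by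
  obtain ⟨hc, f, hf, hfρ, rfl⟩ := h
  obtain ⟨hc', g, hg, hgρ, rfl⟩ := h'
  refine ⟨add_mem hc hc', f + g, hf.add hg, fun s => ?_, rfl⟩
  rw [map_add, ← hfρ, ← hgρ]
  rfl

theorem Continues.mul {b b' : P.Ao} {c c' : R.bosonisation} (h : R.Continues ρ b c)
    (h' : R.Continues ρ b' c') : R.Continues ρ (b * b') (c' * c) := by
  obtain ⟨hc, f, hf, hfρ, rfl⟩ := h
  obtain ⟨hc', g, hg, hgρ, rfl⟩ := h'
  refine ⟨mul_mem hc' hc, g * f, hg.mul hf, fun s => ?_, rfl⟩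
  rw [map_mul, ← hfρ, ← hgρ]
  rfl

theorem continues_algebraMap (r : ℂ) :
    R.Continues ρ (algebraMap ℂ P.Ao r) (algebraMap ℂ R.bosonisation r) := by
  refine ⟨algebraMap_mem _ r, fun _ => algebraMap ℂ R.bosonisation r, differentiable_const _,
    fun s => ?_, rfl⟩
  rw [AlgHomClass.commutes]
  rfl

theorem Continues.smul {b : P.Ao} {c : R.bosonisation} (h : R.Continues ρ b c) (r : ℂ) :
    R.Continues ρ (r • b) (r • c) := by
  have h1 := (continues_algebraMap (ρ := ρ) r).mul h
  rwa [← Algebra.commutes, ← Algebra.smul_def, ← Algebra.smul_def] at h1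

theorem continues_zero : R.Continues ρ 0 0 := by
  simpa only [map_zero] using continues_algebraMap (R := R) (ρ := ρ) 0

theorem continues_one : R.Continues ρ 1 1 := by
  simpa only [map_one] using continues_algebraMap (R := R) (ρ := ρ) 1

variable (R)

/-- Continuation replaces the coinverse on `B`, which need not be bounded, by bounded
*-homomorphisms at real parameters. The last clause gives the compatibility with powers of `z` that
is needed for multiplicativity on `C`. -/
theorem exists_continues (hω : ∃ c : ℂ, c ≠ 0 ∧
    P.ω.map star * P.ω = c • Matrix.diagonal fun i => P.ζpow (P.d * P.deg i)) :
    ∃ ρ : ℝ → P.Ao →⋆ₐ[ℂ] (R.bosonisation)ᵐᵒᵖ,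
      (∀ h i, R.Continues ρ (P.u h i) (star (R.t i h) * R.zpow (P.deg h))) ∧
      (∀ h i, ∃ c, R.Continues ρ (star (P.u h i)) c) ∧
      ∀ (b : P.Ao) (c : R.bosonisation) (l : ℤ), R.Continues ρ b c →
        R.Continues ρ (P.β (P.ζ ^ l) b) (R.zpow (-l) * c * R.zpow l) := by
  obtain ⟨A, A', hAd, hA'd, hAA, hA1, hA, hA', hAF, hμ⟩ := exists_powers hω
  have hF := isUnit_F hω
  have hA'1 : A' (Complex.I / 2) = 1 := by
    have h := hAA (Complex.I / 2)
    rwa [hA1, one_mul] at h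
  let ρ : ℝ → P.Ao →⋆ₐ[ℂ] (R.bosonisation)ᵐᵒᵖ := fun s =>
    P.lift (R.relations_twist hF (hAA s) (hA s) (hA' s) (hAF s) (hμ s))
  have hρ : ∀ s h i, ρ s (P.u h i) = MulOpposite.op (R.twist (A s) (A' s) h i) := fun s h i =>
    P.lift_u _ h i
  refine ⟨ρ, fun h i => ⟨?_, fun s => R.twist (A s) (A' s) h i, ?_, fun s => (hρ s h i).symm, ?_⟩,
    -- Conjugating both the parameter and the value keeps the function entire, and for real `s` it
    -- is the adjoint of the twist. At `i/2` it involves `A(-i/2)`, so it need not be the adjoint of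
    -- the value for `u h i`.
    fun h i => ⟨_, ?_, fun s => ∑ k, ∑ l, (star (A' (star s) k i) * star (A (star s) h l)) •
      star (star (R.t k l) * R.zpow (P.deg h)), ?_, fun s => ?_, rfl⟩, ?_⟩
  · rw [← twist_one]
    exact R.twist_mem _ _ h i
  · have h1 : (fun s => R.twist (A s) (A' s) h i) = fun s =>
        ∑ k, ∑ l, (A' s k i * A s h l) • (star (R.t k l) * R.zpow (P.deg h)) :=
      funext fun s => R.twist_eq_sum _ _ h i
    rw [h1]
    exact Differentiable.fun_sum fun k _ => Differentiable.fun_sum fun l _ =>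
      ((hA'd k i).mul (hAd h l)).smul_const _
  · beta_reduce
    rw [hA1, hA'1, twist_one]
  · exact sum_mem fun k _ => sum_mem fun l _ => SMulMemClass.smul_mem _ (star_mem
      (mul_mem (star_mem (R.t_mem_coeffAlgebra k l)) (R.zpow_mem_coeffAlgebra _)))
  · exact Differentiable.fun_sum fun k _ => Differentiable.fun_sum fun l _ =>
      (Differentiable.mul (fun s => differentiableAt_star_conj_iff.2 (hA'd k i _))
        (fun s => differentiableAt_star_conj_iff.2 (hAd h l _))).smul_const _
  · have h1 : star (s : ℂ) = s := Complex.conj_ofReal s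
    have h2 : (MulOpposite.op (star (R.twist (A s) (A' s) h i))) = star (ρ s (P.u h i)) := by
      rw [hρ]; rfl
    beta_reduce
    rw [map_star, ← h2, twist_eq_sum, h1]
    simp only [star_sum, star_smul, star_mul']
  · rintro b c l ⟨hc, f, hf, hfρ, rfl⟩
    refine ⟨mul_mem (mul_mem (R.zpow_mem_coeffAlgebra _) hc) (R.zpow_mem_coeffAlgebra _),
      fun s => R.zpow (-l) * f s * R.zpow l, (hf.const_mul _).mul_const _, fun s => ?_, rfl⟩
    let w : unitary (R.bosonisation)ᵐᵒᵖ := ⟨MulOpposite.op (R.zpow l), by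
      have h1 : star (MulOpposite.op (R.zpow l)) = MulOpposite.op (R.zpow (-l)) := by
        rw [← R.star_zpow l]; rfl
      rw [Unitary.mem_iff, h1, ← MulOpposite.op_mul, ← MulOpposite.op_mul, zpow_mul_zpow_neg,
        zpow_neg_mul_zpow]
      exact ⟨rfl, rfl⟩⟩
    -- `ρ_s(u i k)` has the same degree as `u i k`, so `ρ_s` carries `β_{ζ^l}` to conjugation by
    -- `z^l`. This passes to the extension in `s`.
    have h1 : (ρ s).comp (P.β (P.ζ ^ l)) =
        ((Unitary.conjStarAlgAut ℂ (R.bosonisation)ᵐᵒᵖ w : _ ≃⋆ₐ[ℂ] _) :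
          (R.bosonisation)ᵐᵒᵖ →⋆ₐ[ℂ] (R.bosonisation)ᵐᵒᵖ).comp (ρ s) :=
      P.hom_ext fun i k => by
        rw [StarAlgHom.comp_apply, StarAlgHom.comp_apply, P.β_u, map_smul, hρ]
        change _ = MulOpposite.op (star (R.zpow l) * (R.twist (A s) (A' s) i k * R.zpow l))
        have h2 := R.hasDeg_twist (hA s) (hA' s) i k l
        rw [h2, mul_smul_comm, ← mul_assoc, star_zpow, zpow_neg_mul_zpow, one_mul, ← zpow_mul,
          mul_comm l]
        rfl
    have h2 := congrArg (fun φ : P.Ao →⋆ₐ[ℂ] (R.bosonisation)ᵐᵒᵖ => φ b) h1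
    refine Eq.trans ?_ h2.symm
    rw [StarAlgHom.comp_apply, ← hfρ]
    change _ = MulOpposite.op (star (R.zpow l) * (f s * R.zpow l))
    rw [star_zpow, ← mul_assoc]

end FaithfulRep

end BraidedDatum

/-! ## The coinverse -/

@[elab_as_elim]
theorem coeffAlgebra_induction {D m : Type*} [Ring D] [StarRing D] [Algebra ℂ D] [StarModule ℂ D]
    {w : Matrix m m D} {p : coeffAlgebra w → Prop} (coeff : ∀ k l, p (coeff w k l))
    (algebraMap : ∀ c : ℂ, p (algebraMap ℂ _ c)) (add : ∀ a b, p a → p b → p (a + b))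
    (mul : ∀ a b, p a → p b → p (a * b)) (star : ∀ a, p a → p (star a)) (a : coeffAlgebra w) :
    p a :=
  StarAlgebra.adjoin_induction_subtype (R := ℂ) (p := p) a
    (by rintro _ ⟨⟨k, l⟩, rfl⟩; exact coeff k l) algebraMap add mul star

/-- A linear antimultiplicative map that sends the entries of a unitary matrix to those of the
adjoint matrix is a coinverse. -/
theorem coinverse_of_antimultiplicative {D m : Type*} [Fintype m] [DecidableEq m] [Ring D]
    [StarRing D] [Algebra ℂ D] [StarModule ℂ D] {w : Matrix m m D} (hw : w ∈ unitary (Matrix m m D))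
    (S : coeffAlgebra w →ₗ[ℂ] coeffAlgebra w) (h1 : S 1 = 1) (hS : ∀ a b, S (a * b) = S b * S a)
    (hSw : ∀ k l, S (coeff w k l) = star (coeff w l k)) :
    (∀ a, S (star (S (star a))) = a) ∧
      (∀ k l, ∑ r, S (coeff w k r) * coeff w r l = if k = l then 1 else 0) ∧
      (∀ k l, ∑ r, coeff w k r * S (coeff w r l) = if k = l then 1 else 0) := by
  have hL : ∀ k l, ∑ r, S (coeff w k r) * coeff w r l = if k = l then 1 else 0 := fun k l => by
    have h2 := congrFun (congrFun hw.1 k) l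
    rw [Matrix.mul_apply, Matrix.one_apply] at h2
    simp only [hSw]
    refine Subtype.ext ?_
    rw [AddSubmonoidClass.coe_finsetSum, apply_ite Subtype.val]
    exact h2
  have hR : ∀ k l, ∑ r, coeff w k r * S (coeff w r l) = if k = l then 1 else 0 := fun k l => by
    have h2 := congrFun (congrFun hw.2 k) l
    rw [Matrix.mul_apply, Matrix.one_apply] at h2
    simp only [hSw]
    refine Subtype.ext ?_
    rw [AddSubmonoidClass.coe_finsetSum, apply_ite Subtype.val]
    exact h2
  refine ⟨?_, hL, hR⟩
  -- The two adjoints and the two uses of `S` cancel in pairs: `H` is complex linear and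
  -- multiplicative, so it suffices to fix the entries of `w` and their adjoints.
  let H : coeffAlgebra w → coeffAlgebra w := fun a => S (star (S (star a)))
  have Hadd : ∀ a b, H (a + b) = H a + H b := fun a b => by simp only [H, star_add, map_add]
  have Hmul : ∀ a b, H (a * b) = H a * H b := fun a b => by simp only [H, star_mul, hS]
  have Hsmul : ∀ (c : ℂ) a, H (c • a) = c • H a := fun c a => by
    simp only [H, star_smul, map_smul, star_star]
  have H1 : H 1 = 1 := by simp only [H, star_one, h1]
  have H0 : H 0 = 0 := by simp only [H, star_zero, map_zero]
  have Hsum : ∀ f : m → coeffAlgebra w, H (∑ r, f r) = ∑ r, H (f r) := fun f => by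
    simp only [H, star_sum, map_sum]
  have Hw' : ∀ k l, H (star (coeff w k l)) = star (coeff w k l) := fun k l => by
    simp only [H, star_star, hSw]
  -- `H` fixes the entries of `w*`. Applying it to `w w* = 1` shows that `H(w)` is a left inverse of
  -- `w*`, so it equals the right inverse `w`.
  have Hw : ∀ k l, H (coeff w k l) = coeff w k l := by
    let W : Matrix m m (coeffAlgebra w) := Matrix.of (coeff w)
    let W' : Matrix m m (coeffAlgebra w) := Matrix.of fun k l => star (coeff w l k)
    have e1 : W' * W = 1 := by
      refine Matrix.ext fun k l => ?_
      rw [Matrix.mul_apply, Matrix.one_apply, ← hL]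
      exact Finset.sum_congr rfl fun r _ => by rw [hSw]; rfl
    have e2 : (Matrix.of fun k l => H (coeff w k l)) * W' = 1 := by
      refine Matrix.ext fun k l => ?_
      have h2 := congrArg H (hR k l)
      rw [Hsum, apply_ite H, H0, H1] at h2
      rw [Matrix.mul_apply, Matrix.one_apply, ← h2]
      refine Finset.sum_congr rfl fun r _ => ?_
      rw [Hmul, hSw, Hw']
      rfl
    have e3 := left_inv_eq_right_inv e2 e1
    exact fun k l => congrFun (congrFun e3 k) l
  intro a
  change H a = a
  suffices h : H a = a ∧ H (star a) = star a from h.1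
  induction a using coeffAlgebra_induction with
  | coeff k l => exact ⟨Hw k l, Hw' k l⟩
  | algebraMap c =>
    have h2 : ∀ c : ℂ, H (algebraMap ℂ _ c) = algebraMap ℂ _ c := fun c => by
      rw [Algebra.algebraMap_eq_smul_one, Hsmul, H1]
    exact ⟨h2 c, by rw [← algebraMap_star_comm, h2]⟩
  | add a b ha hb => exact ⟨by rw [Hadd, ha.1, hb.1], by rw [star_add, Hadd, ha.2, hb.2]⟩
  | mul a b ha hb => exact ⟨by rw [Hmul, ha.1, hb.1], by rw [star_mul, Hmul, ha.2, hb.2]⟩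
  | star a ha => exact ⟨ha.2, by rw [star_star, ha.1]⟩

/-! ### The coinverse on the algebra of coefficients, through its graph -/

namespace BraidedDatum

variable {n : ℕ} {P : BraidedDatum n}

namespace FaithfulRep

attribute [local instance] cstarAlgebraBosonisation cstarAlgebraSquare cstarAlgebraTriple

variable {ι : Type*} (R : P.FaithfulRep ι)

/-- The basis vector `0` of `L²(𝕋)` has degree zero, so the braiding does not rotate `b` there, and
column `0` displays the coefficient of each `z^k`. -/
theorem coe_zpow_mul_fromAo_mul_block (k : ℤ) (b : P.Ao) :
    ((R.zpow k * R.fromAo b : R.bosonisation) : Op (ℤ × ι)) * Op.block 0 0 1 =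
      Op.block k 0 (R.σ b) := by
  have h1 : ((shift ^ k : unitary (Op ℤ)) : Op ℤ) * Op.unit 0 0 = Op.unit k 0 := by
    ext f l
    rw [Op.mul_apply, Op.unit_apply, Op.map_smul', Op.unit_apply, L2.smul_apply, L2.smul_apply,
      shift_zpow_apply, L2.single_apply, L2.single_apply]
    simp only [sub_eq_zero]
  have h2 : Op.conj (circleRep R.deg (P.ζ ^ (0 : ℤ))) (R.σ b) = R.σ b := by
    rw [← R.equivariant, _root_.zpow_zero]
    have h3 : P.β 1 = StarAlgHom.id ℂ P.Ao := P.hom_ext fun i k => by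
      rw [P.β_u, one_zpow, Circle.coe_one, one_smul]; rfl
    rw [h3]; rfl
  have h3 : ((R.zpow k * R.fromAo b : R.bosonisation) : Op (ℤ × ι)) =
      Op.amp ι ((shift ^ k : unitary (Op ℤ)) : Op ℤ) *
        secondLeg P.ζ (fun k : ℤ => k) R.deg (R.σ b) := by
    rw [← coe_circleGen_zpow]; rfl
  rw [h3, mul_assoc, Op.secondLeg_mul_block_one, h2, Op.amp_mul_block, h1]
  rfl

/-- The elements `(z ^ k b, c z ^ (-k))`, where `c` is obtained from `b` by continuation. -/
def coinverseGraphSet (ρ : ℝ → P.Ao →⋆ₐ[ℂ] (R.bosonisation)ᵐᵒᵖ) :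
    Set (R.bosonisation × (R.bosonisation)ᵐᵒᵖ) :=
  {p | ∃ (k : ℤ) (b : P.Ao) (c : R.bosonisation), R.Continues ρ b c ∧
    p = (R.zpow k * R.fromAo b, MulOpposite.op (c * R.zpow (-k)))}

/-- The graph of the coinverse. -/
noncomputable def coinverseGraph (ρ : ℝ → P.Ao →⋆ₐ[ℂ] (R.bosonisation)ᵐᵒᵖ) :
    Submodule ℂ (R.bosonisation × (R.bosonisation)ᵐᵒᵖ) :=
  Submodule.span ℂ (R.coinverseGraphSet ρ)

variable {R} {ρ : ℝ → P.Ao →⋆ₐ[ℂ] (R.bosonisation)ᵐᵒᵖ}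

theorem Continues.mem_coinverseGraph {b : P.Ao} {c : R.bosonisation} (h : R.Continues ρ b c)
    (k : ℤ) : (R.zpow k * R.fromAo b, MulOpposite.op (c * R.zpow (-k))) ∈ R.coinverseGraph ρ :=
  Submodule.subset_span ⟨k, b, c, h, rfl⟩

/-- The graph lies in `C × Cᵒᵖ`, so closure under products is antimultiplicativity of the coinverse.
Moving `z^l` to the left past `b` applies `β_{ζ^l}`, which the hypothesis matches with conjugation
of `c` by `z^l`. -/
theorem mul_mem_coinverseGraph
    (hρ : ∀ (b : P.Ao) (c : R.bosonisation) (l : ℤ), R.Continues ρ b c →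
        R.Continues ρ (P.β (P.ζ ^ l) b) (R.zpow (-l) * c * R.zpow l))
    {p q : R.bosonisation × (R.bosonisation)ᵐᵒᵖ} (hp : p ∈ R.coinverseGraph ρ)
    (hq : q ∈ R.coinverseGraph ρ) : p * q ∈ R.coinverseGraph ρ := by
  have h1 : R.coinverseGraph ρ * R.coinverseGraph ρ ≤ R.coinverseGraph ρ := by
    rw [coinverseGraph, Submodule.span_mul_span]
    refine Submodule.span_mono ?_
    rintro _ ⟨_, ⟨k, b, c, h, rfl⟩, _, ⟨l, b', c', h', rfl⟩, rfl⟩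
    refine ⟨k + l, _, _, (hρ b c l h).mul h', Prod.ext ?_ ?_⟩
    · change R.zpow k * R.fromAo b * (R.zpow l * R.fromAo b') = _
      rw [mul_assoc, ← mul_assoc (R.fromAo b), fromAo_mul_zpow, zpow_add, map_mul]
      simp only [mul_assoc]
    · change MulOpposite.op (c' * R.zpow (-l) * (c * R.zpow (-k))) = _
      -- Splitting the exponent exhibits `c' (z^{-l} c z^l) z^{-(k+l)}`.
      have h2 : -k = l + -(k + l) := by ring
      rw [h2, zpow_add]
      simp only [mul_assoc]
  exact h1 (Submodule.mul_mem_mul hp hq)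

/-- Because continuation is linear, all terms with the same power of `z` merge into one pair. -/
theorem exists_finsupp_of_mem_coinverseGraph {p : R.bosonisation × (R.bosonisation)ᵐᵒᵖ}
    (hp : p ∈ R.coinverseGraph ρ) : ∃ f : ℤ →₀ P.Ao × R.bosonisation,
      (∀ k, R.Continues ρ (f k).1 (f k).2) ∧
      p.1 = f.sum (fun k x => R.zpow k * R.fromAo x.1) ∧
      p.2 = MulOpposite.op (f.sum fun k x => x.2 * R.zpow (-k)) := by
  have e1 : ∀ k, R.zpow k * R.fromAo (0 : P.Ao × R.bosonisation).1 = 0 := fun k => by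
    rw [Prod.fst_zero, map_zero, mul_zero]
  have e2 : ∀ k, (0 : P.Ao × R.bosonisation).2 * R.zpow (-k) = 0 := fun k => by
    rw [Prod.snd_zero, zero_mul]
  induction hp using Submodule.span_induction with
  | mem p hp =>
    obtain ⟨k, b, c, h, rfl⟩ := hp
    refine ⟨Finsupp.single k (b, c), fun l => ?_, ?_, ?_⟩
    · by_cases hl : k = l
      · rw [← hl, Finsupp.single_eq_same]; exact h
      · rw [Finsupp.single_eq_of_ne (Ne.symm hl)]; exact continues_zero
    · rw [Finsupp.sum_single_index (e1 k)]
    · rw [Finsupp.sum_single_index (e2 k)]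
  | zero => exact ⟨0, fun k => continues_zero, by rw [Finsupp.sum_zero_index]; rfl,
      by rw [Finsupp.sum_zero_index]; rfl⟩
  | add p q _ _ hp hq =>
    obtain ⟨f, hf, hf1, hf2⟩ := hp
    obtain ⟨g, hg, hg1, hg2⟩ := hq
    refine ⟨f + g, fun k => (hf k).add (hg k), ?_, ?_⟩
    · rw [Finsupp.sum_add_index' e1 fun k x y => by rw [Prod.fst_add, map_add, mul_add], ← hf1,
        ← hg1]
      rfl
    · rw [Finsupp.sum_add_index' e2 fun k x y => by rw [Prod.snd_add, add_mul],
        MulOpposite.op_add, ← hf2, ← hg2]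
      rfl
  | smul r p _ hp =>
    obtain ⟨f, hf, hf1, hf2⟩ := hp
    refine ⟨r • f, fun k => (hf k).smul r, ?_, ?_⟩
    · rw [Finsupp.sum_smul_index' e1, Prod.smul_fst, hf1, Finsupp.smul_sum]
      refine Finsupp.sum_congr fun k _ => ?_
      rw [Prod.smul_fst, map_smul, mul_smul_comm]
    · rw [Finsupp.sum_smul_index' e2, Prod.smul_snd, hf2, ← MulOpposite.op_smul, Finsupp.smul_sum]
      refine congrArg _ (Finsupp.sum_congr fun k _ => ?_)
      rw [Prod.smul_snd, smul_mul_assoc]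

/-- The graph is single valued: block column `0` shows that every coefficient `b_k` vanishes, and
the only continuation of `0` is `0`. -/
theorem snd_eq_zero_of_mem_coinverseGraph {p : R.bosonisation × (R.bosonisation)ᵐᵒᵖ}
    (hp : p ∈ R.coinverseGraph ρ) (h0 : p.1 = 0) : p.2 = 0 := by
  obtain ⟨f, hf, hf1, hf2⟩ := exists_finsupp_of_mem_coinverseGraph hp
  have h1 : ∀ k, (f k).1 = 0 := fun k => by
    have h2 : (∑ l ∈ f.support, Op.block l 0 (R.σ (f l).1) : Op (ℤ × ι)) = 0 := by
      have h3 := congrArg (fun x : R.bosonisation => (x : Op (ℤ × ι)) * Op.block 0 0 1)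
        (hf1.symm.trans h0)
      beta_reduce at h3
      rw [Finsupp.sum, AddSubmonoidClass.coe_finsetSum, Finset.sum_mul] at h3
      simp only [coe_zpow_mul_fromAo_mul_block] at h3
      rw [h3]
      exact zero_mul _
    by_cases hk : k ∈ f.support
    · have h4 := congrArg (fun x : Op (ℤ × ι) => Op.block k k 1 * x) h2
      simp only [Finset.mul_sum, Op.block_mul_block, mul_zero, one_mul] at h4
      rw [Finset.sum_ite_eq, if_pos hk, ← Op.block_zero k 0] at h4
      exact R.injective ((Op.block_injective k 0 h4).trans (map_zero R.σ).symm)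
    · rw [Finsupp.notMem_support_iff.1 hk]; rfl
  have h2 : ∀ k, (f k).2 = 0 := fun k => by
    have h3 := hf k
    rw [h1 k] at h3
    exact h3.unique continues_zero
  rw [hf2, Finsupp.sum, Finset.sum_eq_zero fun k _ => by rw [h2, zero_mul], MulOpposite.op_zero]

theorem unop_snd_mem_of_mem_coinverseGraph {p : R.bosonisation × (R.bosonisation)ᵐᵒᵖ}
    (hp : p ∈ R.coinverseGraph ρ) : p.2.unop ∈ coeffAlgebra R.zt := by
  induction hp using Submodule.span_induction with
  | mem p hp =>
    obtain ⟨k, b, c, h, rfl⟩ := hp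
    exact mul_mem h.1 (R.zpow_mem_coeffAlgebra _)
  | zero => exact zero_mem _
  | add p q _ _ hp hq => exact add_mem hp hq
  | smul r p _ hp => exact SMulMemClass.smul_mem r hp

variable (R)

theorem exists_coinverse (hω : ∃ c : ℂ, c ≠ 0 ∧
    P.ω.map star * P.ω = c • Matrix.diagonal fun i => P.ζpow (P.d * P.deg i)) :
    ∃ S : coeffAlgebra R.zt →ₗ[ℂ] coeffAlgebra R.zt,
      (∀ a b, S (a * b) = S b * S a) ∧ (∀ a, S (star (S (star a))) = a) ∧
      (∀ k l, ∑ r, S (coeff R.zt k r) * coeff R.zt r l = if k = l then 1 else 0) ∧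
      (∀ k l, ∑ r, coeff R.zt k r * S (coeff R.zt r l) = if k = l then 1 else 0) := by
  obtain ⟨ρ, hu, hu', hρ⟩ := R.exists_continues hω
  set G := R.coinverseGraph ρ with hG
  have hz : ∀ k, (R.zpow k, MulOpposite.op (R.zpow (-k))) ∈ G := fun k => by
    have h := (continues_one (R := R) (ρ := ρ)).mem_coinverseGraph k
    rwa [map_one, mul_one, one_mul] at h
  have ht : ∀ i j, (R.t i j, MulOpposite.op (star (R.t j i))) ∈ G := fun i j => by
    have h := (hu i j).mem_coinverseGraph (P.deg i)
    rwa [mul_assoc, zpow_mul_zpow_neg, mul_one] at h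
  have h0 : ∀ x y : R.bosonisation, x = 0 → y = 0 → (x, MulOpposite.op (star y)) ∈ G := by
    rintro _ _ rfl rfl
    rw [star_zero]
    exact zero_mem G
  have hzt : ∀ k l, (R.zt k l, MulOpposite.op (star (R.zt l k))) ∈ G := by
    rintro (k | k) (l | l)
    · have h := hz 1
      rw [← star_zpow] at h
      exact h
    · exact h0 _ _ rfl rfl
    · exact h0 _ _ rfl rfl
    · exact ht k l
  have h1G : (1, 1) ∈ G := by
    have h := hz 0
    rwa [neg_zero, zpow_zero] at h
  have halg : ∀ r : ℂ, ∃ p ∈ G, p.1 = algebraMap ℂ R.bosonisation r := fun r =>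
    ⟨_, G.smul_mem r h1G, (Algebra.algebraMap_eq_smul_one r).symm⟩
  -- The domain must contain adjoints, which does not follow from the generators since the coinverse
  -- need not preserve them. For `t` one writes `t* = u* z^{-deg k} = z^{-deg k} β(u*)`, with `β`
  -- taken at `ζ^{-deg k}`, and uses the continuation of `u*`.
  have hstar : ∀ k l, ∃ p ∈ G, p.1 = star (R.zt k l) := by
    rintro (k | k) (l | l)
    · exact ⟨_, hz (-1), (R.star_zpow 1).symm⟩
    · exact ⟨0, zero_mem G, (star_zero _).symm⟩
    · exact ⟨0, zero_mem G, (star_zero _).symm⟩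
    · obtain ⟨c, hc⟩ := hu' k l
      refine ⟨_, (hρ _ c (-P.deg k) hc).mem_coinverseGraph (-P.deg k), ?_⟩
      change R.zpow _ * R.fromAo _ = star (R.t k l)
      rw [star_t_apply, ← map_star, fromAo_mul_zpow]
  have htot' : ∀ a : coeffAlgebra R.zt, (∃ p ∈ G, p.1 = a) ∧
      ∃ p ∈ G, p.1 = star (a : R.bosonisation) := fun a => by
    induction a using coeffAlgebra_induction with
    | coeff k l => exact ⟨⟨_, hzt k l, rfl⟩, hstar k l⟩
    | algebraMap r => exact ⟨halg r, by
        obtain ⟨p, hp, h⟩ := halg (star r)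
        exact ⟨p, hp, h.trans (algebraMap_star_comm r)⟩⟩
    | add a b ha hb =>
      obtain ⟨⟨p, hp, hpa⟩, p', hp', hpa'⟩ := ha
      obtain ⟨⟨q, hq, hqb⟩, q', hq', hqb'⟩ := hb
      refine ⟨⟨_, add_mem hp hq, ?_⟩, _, add_mem hp' hq', ?_⟩
      · rw [Prod.fst_add, hpa, hqb]; rfl
      · rw [Prod.fst_add, hpa', hqb', ← star_add]; rfl
    | mul a b ha hb =>
      obtain ⟨⟨p, hp, hpa⟩, p', hp', hpa'⟩ := ha
      obtain ⟨⟨q, hq, hqb⟩, q', hq', hqb'⟩ := hb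
      refine ⟨⟨_, mul_mem_coinverseGraph hρ hp hq, ?_⟩, _, mul_mem_coinverseGraph hρ hq' hp', ?_⟩
      · rw [Prod.fst_mul, hpa, hqb]; rfl
      · rw [Prod.fst_mul, hpa', hqb', ← star_mul]; rfl
    | star a ha =>
      refine ⟨ha.2, ?_⟩
      obtain ⟨p, hp, hpa⟩ := ha.1
      exact ⟨p, hp, hpa.trans (star_star _).symm⟩
  have htot : ∀ a : coeffAlgebra R.zt, ∃ c : coeffAlgebra R.zt,
      ((a : R.bosonisation), MulOpposite.op (c : R.bosonisation)) ∈ G := fun a => by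
    obtain ⟨⟨_, c⟩, hp, rfl⟩ := (htot' a).1
    exact ⟨⟨c.unop, unop_snd_mem_of_mem_coinverseGraph hp⟩, hp⟩
  have huniq : ∀ {a c c' : R.bosonisation}, (a, MulOpposite.op c) ∈ G →
      (a, MulOpposite.op c') ∈ G → c = c' := fun h h' => by
    have h2 := snd_eq_zero_of_mem_coinverseGraph (sub_mem h h') (sub_self _)
    exact MulOpposite.op_injective (sub_eq_zero.1 h2)
  choose S hS using htot
  let S' : coeffAlgebra R.zt →ₗ[ℂ] coeffAlgebra R.zt :=
    { toFun := S
      map_add' := fun a b => Subtype.ext (huniq (hS (a + b)) (add_mem (hS a) (hS b)))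
      map_smul' := fun r a => Subtype.ext (huniq (hS (r • a)) (G.smul_mem r (hS a))) }
  have hSmul : ∀ a b, S' (a * b) = S' b * S' a := fun a b =>
    Subtype.ext (huniq (hS (a * b)) (mul_mem_coinverseGraph hρ (hS a) (hS b)))
  exact ⟨S', hSmul, coinverse_of_antimultiplicative R.zt_mem_unitary S'
    (Subtype.ext (huniq (hS 1) h1G)) hSmul
    fun k l => Subtype.ext (huniq (hS (coeff R.zt k l)) (hzt k l))⟩

end FaithfulRep

end BraidedDatum

theorem mainTheorem10 {n : ℕ} (P : BraidedDatum n)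
    (hω : ∃ c : ℂ, c ≠ 0 ∧
      P.ω.map star * P.ω = c • Matrix.diagonal fun i => P.ζpow (P.d * P.deg i))
    {ι : Type*} (R : P.FaithfulRep ι) :
    (coeffAlgebra R.zt).topologicalClosure = ⊤ ∧
    (∃! Δ : R.bosonisation →⋆ₐ[ℂ] spatialTensor R.bosonisation R.bosonisation, R.IsComul Δ) ∧
    (∀ Δ : R.bosonisation →⋆ₐ[ℂ] spatialTensor R.bosonisation R.bosonisation, R.IsComul Δ →
      IsCompactMatrixQuantumGroup R.bosonisation R.zt Δ) ∧
    R.zt ∈ unitary (Matrix (Unit ⊕ Fin n) (Unit ⊕ Fin n) R.bosonisation) ∧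
    IsUnit (R.zt.map star) ∧
    IsUnit P.F ∧
    R.t * P.F.map (algebraMap ℂ R.bosonisation) =
      R.zpow P.d • (P.F.map (algebraMap ℂ R.bosonisation) * R.t.map star) := by
  obtain ⟨Δ₀, hΔ₀⟩ := R.exists_isComul
  exact ⟨R.topologicalClosure_coeffAlgebra, ⟨Δ₀, hΔ₀, fun Δ hΔ => hΔ.unique hΔ₀⟩,
    fun Δ hΔ => ⟨StarSubalgebra.isClosed_topologicalClosure _, R.topologicalClosure_coeffAlgebra,
      hΔ.zt, R.exists_coinverse hω⟩, R.zt_mem_unitary,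
    R.isUnit_zt_map_star (BraidedDatum.isUnit_F hω), BraidedDatum.isUnit_F hω, R.t_mul_F⟩
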